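/- Let $\Lambda$ be a finite set of sites with boson operators $b_i, b_i^\dagger$ ($i\in\Lambda$), $[b_i,b_j^\dagger]=\delta_{ij}$, acting on the Fock space $\bigotimes_{i\in\Lambda}\ell^2(\mathbb N)$, and let $\hat n_i=b_i^\dagger b_i$, $\phi_i=(b_i+b_i^\dagger)/\sqrt2$ and $\pi_i=-\mathrm{i}(b_i-b_i^\dagger)/\sqrt2$. Let $k\ge 2$ be an even integer, $\mu_i\in\mathbb R$ ($i\in\Lambda$), $f_{i_1,\dots,i_{2r}}\in\mathbb R$ ($1\le r\le k/2$, $i_1,\dots,i_{2r}\in\Lambda$, not necessarily distinct), and let $$H=\sum_{i\in\Lambda}\mu_i\pi_i^2+\sum_{r=1}^{k/2}\ \sum_{i_1,\dots,i_{2r}\in\Lambda} f_{i_1,\dots,i_{2r}}\,\phi_{i_1}\phi_{i_2}\cdots\phi_{i_{2r}},$$ understood as the closure of this expression on the finite linear combinations of occupation-number states. Suppose that $H$ has a ground state $|\Omega\rangle$, i.e. a unit vector in the domain of $H$ that minimises $\langle\psi|H|\psi\rangle$ over all unit vectors $\psi$ in the domain of $H$, with spectral gap $$\Delta=\inf\{\langle\psi|H|\psi\rangle-\langle\Omega|H|\Omega\rangle:\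 \psi\in\mathrm{dom}(H),\ \|\psi\|=1,\ \langle\Omega|\psi\rangle=0\}>0 .$$ Put $$\bar\mu=\max_{i\in\Lambda}\mu_i,\qquad \bar f=\max_{i\in\Lambda}\ \sum_{r=1}^{k/2}\ \sum_{\substack{i_1,\dots,i_{2r}\in\Lambda\\ \{i_1,\dots,i_{2r}\}\ni i}}|f_{i_1,\dots,i_{2r}}|,\qquad \bar f'=\max(\bar f,\bar\mu/2),$$ $$\tilde C=k^2\left(\frac{\bar f'}{\bar\mu}\right)^{1/k}\left[4\left(\frac{\bar\mu}{\Delta}\right)^{1/2}+1\right].$$ Then for every site $i\in\Lambda$ and every real $x\ge 0$, the projection $\Pi_{i,>x}$ onto the states with more than $x$ bosons at the site $i$ satisfies $$\langle\Omega|\Pi_{i,>x}|\Omega\rangle\le 4e^{k}\exp\left(-\frac{k\,x^{1/k}}{8e\,\tilde C}\right).$$ -/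

import Mathlib

open scoped BigOperators

noncomputable section

namespace Phi4

variable {Λ : Type*}

/-- Boson configurations ("Mott" labels): `N i` is the number of bosons at the site `i`. -/
abbrev Config (Λ : Type*) : Type _ := Λ → ℕ

/-- The bosonic Fock space of the sites `Λ`, i.e. `⨂_{i ∈ Λ} ℓ²(ℕ)`, realised as `ℓ²` over the
configurations; the Mott state `|N⟩` is the basis vector with label `N`. -/
abbrev Fock (Λ : Type*) : Type _ := lp (fun _ : Config Λ => ℂ) 2

/-- Finite linear combinations of Mott states, written in coordinates. -/
abbrev FinVec (Λ : Type*) : Type _ := Config Λ →₀ ℂ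

/-- The Mott state `|N⟩`. -/
def mott (N : Config Λ) : Fock Λ := by
  classical exact lp.single 2 N (1 : ℂ)

/-- The inclusion of the finite linear combinations of Mott states into the Fock space. -/
def toFock : FinVec Λ →ₗ[ℂ] Fock Λ := Finsupp.linearCombination ℂ mott

/-- The annihilation operator: `b_i |N⟩ = √(N_i) |N - e_i⟩`. -/
def ann [DecidableEq Λ] (i : Λ) : Module.End ℂ (FinVec Λ) :=
  Finsupp.linearCombination ℂ fun N : Config Λ =>
    Finsupp.single (Function.update N i (N i - 1)) ((Real.sqrt (N i) : ℝ) : ℂ)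

/-- The creation operator: `b_i† |N⟩ = √(N_i + 1) |N + e_i⟩`. -/
def cre [DecidableEq Λ] (i : Λ) : Module.End ℂ (FinVec Λ) :=
  Finsupp.linearCombination ℂ fun N : Config Λ =>
    Finsupp.single (Function.update N i (N i + 1)) ((Real.sqrt (N i + 1) : ℝ) : ℂ)

/-- `φ_i = (b_i + b_i†) / √2`. -/
def phi [DecidableEq Λ] (i : Λ) : Module.End ℂ (FinVec Λ) :=
  ((Real.sqrt 2 : ℝ) : ℂ)⁻¹ • (ann i + cre i)

/-- `π_i = -i (b_i - b_i†) / √2`. -/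
def mom [DecidableEq Λ] (i : Λ) : Module.End ℂ (FinVec Λ) :=
  (-Complex.I * ((Real.sqrt 2 : ℝ) : ℂ)⁻¹) • (ann i - cre i)

/-- The product `φ_{t 0} φ_{t 1} ⋯ φ_{t (n-1)}`. -/
def phiProd [DecidableEq Λ] {n : ℕ} (t : Fin n → Λ) : Module.End ℂ (FinVec Λ) :=
  (List.ofFn fun j => phi (t j)).prod

/-- The even polynomial
`F(φ) = ∑_{1 ≤ r ≤ k/2} ∑_{i_1, …, i_{2r} ∈ Λ} f_{i_1,…,i_{2r}} φ_{i_1} ⋯ φ_{i_{2r}}`. -/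
def evenPoly [Fintype Λ] [DecidableEq Λ] (k : ℕ) (f : (r : ℕ) → (Fin (2 * r) → Λ) → ℝ) : Module.End ℂ (FinVec Λ) :=
  ∑ r ∈ Finset.Icc 1 (k / 2), ∑ t : Fin (2 * r) → Λ, ((f r t : ℝ) : ℂ) • phiProd t

/-- The expression `∑_i μ_i π_i² + F(φ)`, acting on finite combinations of Mott states. -/
def hamEnd [Fintype Λ] [DecidableEq Λ] (k : ℕ) (μ : Λ → ℝ) (f : (r : ℕ) → (Fin (2 * r) → Λ) → ℝ) :
    Module.End ℂ (FinVec Λ) :=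
  ∑ i, ((μ i : ℝ) : ℂ) • mom i ^ 2 + evenPoly k f

theorem toFock_apply (u : FinVec Λ) (N : Config Λ) : toFock u N = u N := by
  classical
  induction u using Finsupp.induction_linear with
  | zero => simp
  | add u v hu hv => simp [map_add, hu, hv]
  | single M c =>
    simp only [toFock, Finsupp.linearCombination_single, mott, lp.coeFn_smul, Pi.smul_apply,
      lp.single_apply, Finsupp.single_apply, Pi.single_apply]
    by_cases h : M = N
    · subst h; simp
    · simp [h, Ne.symm h]

theorem toFock_injective : Function.Injective (toFock (Λ := Λ)) := fun u v h =>
  Finsupp.ext fun N => by rw [← toFock_apply u N, ← toFock_apply v N, h]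

/-- An operator on finite combinations of Mott states, as a densely defined operator on the Fock
space whose domain consists of these combinations. -/
def onFock (A : Module.End ℂ (FinVec Λ)) : Fock Λ →ₗ.[ℂ] Fock Λ where
  domain := LinearMap.range toFock
  toFun := toFock ∘ₗ A ∘ₗ (LinearEquiv.ofInjective toFock toFock_injective).symm.toLinearMap

/-- The Hamiltonian `H = ∑_i μ_i π_i² + F(φ)`: the closure of the expression `hamEnd` defined on
the finite combinations of Mott states. -/
def hamiltonian [Fintype Λ] [DecidableEq Λ] (k : ℕ) (μ : Λ → ℝ) (f : (r : ℕ) → (Fin (2 * r) → Λ) → ℝ) :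
    Fock Λ →ₗ.[ℂ] Fock Λ :=
  (onFock (hamEnd k μ f)).closure

/-- The expectation value `⟨ψ|T|ψ⟩` (a real number for the symmetric operators used here). -/
def expect {E : Type*} [NormedAddCommGroup E] [InnerProductSpace ℂ E] (T : E →ₗ.[ℂ] E)
    (ψ : T.domain) : ℝ :=
  (inner ℂ (ψ : E) (T ψ)).re

/-- `Ω` is a ground state of `T`: a normalised state of minimal energy. -/
def IsGroundState {E : Type*} [NormedAddCommGroup E] [InnerProductSpace ℂ E] (T : E →ₗ.[ℂ] E)
    (Ω : T.domain) : Prop :=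
  ‖(Ω : E)‖ = 1 ∧ ∀ ψ : T.domain, ‖(ψ : E)‖ = 1 → expect T Ω ≤ expect T ψ

/-- `Δ` is the spectral gap above the ground state `Ω`: the infimum of
`⟨ψ|T|ψ⟩ - ⟨Ω|T|Ω⟩` over the normalised states `ψ` orthogonal to `Ω`.
It is `0` if the ground state is degenerate. -/
def IsSpectralGap {E : Type*} [NormedAddCommGroup E] [InnerProductSpace ℂ E] (T : E →ₗ.[ℂ] E)
    (Ω : T.domain) (Δ : ℝ) : Prop :=
  IsGLB {e : ℝ | ∃ ψ : T.domain, ‖(ψ : E)‖ = 1 ∧ inner ℂ (Ω : E) (ψ : E) = 0 ∧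
    e = expect T ψ - expect T Ω} Δ

/-- The projection `Π_{i,>x}` onto the states with more than `x` bosons at the site `i`. -/
def numberTail (i : Λ) (x : ℝ) : Fock Λ →ₗ[ℂ] Fock Λ where
  toFun ψ := ⟨fun N => if x < (N i : ℝ) then ψ N else 0, by
    refine (lp.memℓp ψ).mono' fun N => ?_
    dsimp only
    split_ifs <;> simp⟩
  map_add' ψ χ := by
    ext N
    simp only [lp.coeFn_add, Pi.add_apply]
    split_ifs <;> simp
  map_smul' c ψ := by
    ext N
    simp only [lp.coeFn_smul, Pi.smul_apply, RingHom.id_apply]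
    split_ifs <;> simp

/-- `μ̄ = max_i μ_i`. -/
def muBar (μ : Λ → ℝ) : ℝ := ⨆ i, μ i

/-- `f̄ = max_i ∑_{1 ≤ r ≤ k/2} ∑_{(i_1,…,i_{2r}) with i ∈ {i_1,…,i_{2r}}} |f_{i_1,…,i_{2r}}|`. -/
def fBar [Fintype Λ] [DecidableEq Λ] (k : ℕ) (f : (r : ℕ) → (Fin (2 * r) → Λ) → ℝ) : ℝ :=
  ⨆ i : Λ, ∑ r ∈ Finset.Icc 1 (k / 2), ∑ t : Fin (2 * r) → Λ with ∃ j, t j = i, |f r t|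

/-- `C̃ = k² (f̄' / μ̄)^{1/k} (4 (μ̄ / Δ)^{1/2} + 1)` with `f̄' = max (f̄, μ̄ / 2)`. -/
def Ctilde [Fintype Λ] [DecidableEq Λ] (k : ℕ) (μ : Λ → ℝ) (f : (r : ℕ) → (Fin (2 * r) → Λ) → ℝ) (Δ : ℝ) : ℝ :=
  (k : ℝ) ^ 2 * (max (fBar k f) (muBar μ / 2) / muBar μ) ^ (1 / (k : ℝ)) *
    (4 * Real.sqrt (muBar μ / Δ) + 1)

end Phi4

end

noncomputable section

namespace Phi4

/-! ### Finite vectors in coordinates. -/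

variable {Λ : Type*}

/-! Put `∂ᵢ = i πᵢ`, so that `H = -∑ μⱼ ∂ⱼ² + F(φ)`. For a product `g` of fields and a power `D` of
one derivative, the equation `HΩ = eΩ` gives the excess energy of `g D Ω` as `∑ μⱼ ‖(∂ⱼ g) D Ω‖² +
Re⟨g² D Ω, [F, D] Ω⟩`. The gap bounds `Δ` times the variance of `g D` by this quantity
(`GapRep.gap_mul`). Both terms contain fewer fields or fewer derivatives than `‖g D Ω‖²`, so the
moments of `Ω` can be bounded recursively.

With `h = k/2`, `P = √(f̄'/μ̄)`, `s = √(μ̄/Δ)` and `κ = 8w(4s+1)`, the outcome is `‖φ^l ∂ᵢ^a Ω‖ ≤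
P^a κ^(|l| + h a)` whenever `|l| + h a ≤ w` (`norm_fieldProd_mul_pow_le`): one derivative weighs as
much as `h` fields, since `π²` balances a field polynomial of degree `2h`. The commutator `[F,
∂ᵢ^a]` expands into iterated commutators, which see only the monomials containing the site `i`;
hence `f̄` suffices and the size of the lattice never enters (`commutator_le`). The mean `⟨Ω, g D
Ω⟩` is split by Cauchy–Schwarz into two smaller moments, and for a single field or derivative it
vanishes by parity (`mean_le`).

Expanding `bᵢ^p = 2^(-p/2) (φᵢ + ∂ᵢ)^p` in normal order bounds `‖bᵢ^p Ω‖²`, which is the `p`-th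
factorial moment of `nᵢ`. Markov's inequality with `p` proportional to `x^(1/k)` finishes the proof
(`tail_le_of_moments`).

This computation applies unbounded operators to `Ω`, which is only known to lie in the domain of a
closure, while neither positivity of `μ` nor a lower bound on `F` is assumed. Everything needed is
extracted from the gap. In the Schrödinger representation the gap gives a Poincaré inequality for
`|Ω|²`, in which the potential has cancelled (`poincare`). Applied to bounded versions of the powers
of a coordinate, it yields `μⱼ > 0` and all position moments (`mu_pos`, `integrable_moment`). The
eigenvalue equation then acts as an elliptic equation in momentum space and gives decay there
(`memLp_momentum`). Together these show that the occupation-number coefficients of `Ω` decay faster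
than any power (`rapid_ground`), so that every polynomial in the fields and derivatives can be
applied to `Ω`. -/

theorem toFock_single (N : Config Λ) (c : ℂ) :
    toFock (Finsupp.single N c) = c • mott N := by
  simp [toFock, Finsupp.linearCombination_single]

theorem mott_eq [DecidableEq (Config Λ)] (N : Config Λ) : mott N = lp.single 2 N (1 : ℂ) := by
  unfold mott
  congr!

theorem inner_mott_left (N : Config Λ) (ψ : Fock Λ) : inner ℂ (mott N) ψ = ψ N := by
  classical
  rw [mott, lp.inner_single_left]
  simp

theorem inner_mott_right (N : Config Λ) (ψ : Fock Λ) :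
    inner ℂ ψ (mott N) = (starRingEnd ℂ) (ψ N) := by
  rw [← inner_mott_left, inner_conj_symm]

theorem inner_toFock_left (u : FinVec Λ) (ψ : Fock Λ) :
    inner ℂ (toFock u) ψ = u.sum fun N c => (starRingEnd ℂ) c * ψ N := by
  rw [toFock, Finsupp.linearCombination_apply, Finsupp.sum, sum_inner]
  refine Finset.sum_congr rfl fun N _ => ?_
  rw [inner_smul_left, inner_mott_left]

theorem finVec_induction {p : FinVec Λ → Prop} (u : FinVec Λ) (h0 : p 0)
    (hadd : ∀ u v, p u → p v → p (u + v)) (hs : ∀ (c : ℂ) u, p u → p (c • u))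
    (h1 : ∀ N, p (Finsupp.single N 1)) : p u := by
  induction u using Finsupp.induction_linear with
  | zero => exact h0
  | add u v hu hv => exact hadd u v hu hv
  | single N c => simpa using hs c _ (h1 N)

theorem ext_single {A B : Module.End ℂ (FinVec Λ)}
    (h : ∀ N, A (Finsupp.single N 1) = B (Finsupp.single N 1)) : A = B := by
  refine LinearMap.ext fun u => ?_
  exact finVec_induction (p := fun u => A u = B u) u (by simp)
    (fun u v hu hv => by simp [hu, hv]) (fun c u hu => by simp [hu]) h

theorem eq_of_inner_toFock {ψ χ : Fock Λ}
    (h : ∀ u : FinVec Λ, inner ℂ ψ (toFock u) = inner ℂ χ (toFock u)) : ψ = χ := by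
  ext N
  have := h (Finsupp.single N 1)
  rw [toFock_single, one_smul, inner_mott_right, inner_mott_right] at this
  exact (starRingEnd ℂ).injective this

theorem norm_toFock_sq (u : FinVec Λ) (s : Finset (Config Λ)) (hs : u.support ⊆ s) :
    ‖toFock u‖ ^ 2 = ∑ N ∈ s, ‖u N‖ ^ 2 := by
  have h := inner_self_eq_norm_sq_to_K (𝕜 := ℂ) (toFock u)
  rw [inner_toFock_left, Finsupp.sum_of_support_subset _ hs _ (by simp)] at h
  have h2 : ∀ N ∈ s, (starRingEnd ℂ) (u N) * toFock u N = ((‖u N‖ ^ 2 : ℝ) : ℂ) := by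
    intro N _
    rw [toFock_apply, ← Complex.normSq_eq_conj_mul_self, Complex.normSq_eq_norm_sq]
  rw [Finset.sum_congr rfl h2] at h
  have h3 : ((∑ N ∈ s, ‖u N‖ ^ 2 : ℝ) : ℂ) = ((‖toFock u‖ ^ 2 : ℝ) : ℂ) := by
    push_cast
    push_cast at h
    exact h
  exact (Complex.ofReal_injective h3).symm

theorem norm_toFock_mono {u v : FinVec Λ} (h : ∀ N, ‖u N‖ ≤ ‖v N‖) :
    ‖toFock u‖ ≤ ‖toFock v‖ := by
  classical
  refine le_of_sq_le_sq ?_ (norm_nonneg _) |> fun h => h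
  rw [norm_toFock_sq u (u.support ∪ v.support) Finset.subset_union_left,
    norm_toFock_sq v (u.support ∪ v.support) Finset.subset_union_right]
  gcongr with N _
  exact h N

/-- The diagonal operator with entries `c N`. -/
def diag (c : Config Λ → ℂ) : Module.End ℂ (FinVec Λ) :=
  Finsupp.linearCombination ℂ fun N => Finsupp.single N (c N)

theorem diag_single (c : Config Λ → ℂ) (N : Config Λ) (a : ℂ) :
    diag c (Finsupp.single N a) = Finsupp.single N (c N * a) := by
  simp [diag, Finsupp.linearCombination_single, mul_comm]

theorem diag_apply (c : Config Λ → ℂ) (u : FinVec Λ) (N : Config Λ) :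
    diag c u N = c N * u N := by
  classical
  induction u using Finsupp.induction_linear with
  | zero => simp
  | add u v hu hv => simp [hu, hv, mul_add]
  | single M a =>
    rw [diag_single, Finsupp.single_apply, Finsupp.single_apply]
    split_ifs with h
    · rw [h]
    · simp

/-! ### Ladder operators and the canonical commutation relations. -/

section ops
variable [DecidableEq Λ]

theorem ann_single (i : Λ) (N : Config Λ) (c : ℂ) :
    ann i (Finsupp.single N c) =
      Finsupp.single (Function.update N i (N i - 1)) (c * ((Real.sqrt (N i) : ℝ) : ℂ)) := by
  simp [ann, Finsupp.linearCombination_single]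

theorem cre_single (i : Λ) (N : Config Λ) (c : ℂ) :
    cre i (Finsupp.single N c) =
      Finsupp.single (Function.update N i (N i + 1)) (c * ((Real.sqrt (N i + 1) : ℝ) : ℂ)) := by
  simp [cre, Finsupp.linearCombination_single]

theorem ann_apply (i : Λ) (u : FinVec Λ) (N : Config Λ) :
    ann i u N = ((Real.sqrt (N i + 1) : ℝ) : ℂ) * u (Function.update N i (N i + 1)) := by
  induction u using Finsupp.induction_linear with
  | zero => simp
  | add u v hu hv => simp [hu, hv, mul_add]
  | single M a =>
    classical
    rw [ann_single, Finsupp.single_apply, Finsupp.single_apply]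
    by_cases h : M = Function.update N i (N i + 1)
    · subst h
      simp [mul_comm]
    · rw [if_neg h]
      split_ifs with h2
      -- When `M i = 0` truncated subtraction leaves the label unchanged, so the labels can
      -- coincide; the coefficient `√0` then makes both sides vanish.
      · rcases Nat.eq_zero_or_pos (M i) with h3 | h3
        · simp [h3]
        · exfalso
          apply h
          rw [← h2]
          simp [Nat.sub_add_cancel h3]
      · simp

theorem inner_cre_left (i : Λ) (u v : FinVec Λ) :
    inner ℂ (toFock (cre i u)) (toFock v) = inner ℂ (toFock u) (toFock (ann i v)) := by
  refine finVec_induction (p := fun u => inner ℂ (toFock (cre i u)) (toFock v) =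
    inner ℂ (toFock u) (toFock (ann i v))) u (by simp) (fun u v hu hv => by
    rw [map_add, map_add, map_add, inner_add_left, inner_add_left, hu, hv])
    (fun c u hu => by
      rw [map_smul, map_smul, map_smul, inner_smul_left, inner_smul_left, hu]) fun N => ?_
  rw [cre_single, toFock_single, toFock_single, inner_smul_left, inner_smul_left,
    inner_mott_left, inner_mott_left, toFock_apply, toFock_apply, ann_apply]
  simp

theorem inner_ann_left (i : Λ) (u v : FinVec Λ) :
    inner ℂ (toFock (ann i u)) (toFock v) = inner ℂ (toFock u) (toFock (cre i v)) := by
  rw [← inner_conj_symm, ← inner_cre_left, inner_conj_symm]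

theorem ann_mul_ann_comm (i j : Λ) : ann i * ann j = ann j * ann i := by
  refine LinearMap.ext fun u => Finsupp.ext fun N => ?_
  rw [Module.End.mul_apply, Module.End.mul_apply, ann_apply, ann_apply, ann_apply, ann_apply]
  by_cases h : i = j
  · subst h; rfl
  · simp [Function.update_of_ne h, Function.update_of_ne (Ne.symm h), Function.update_comm h]
    ring

theorem cre_mul_cre_comm (i j : Λ) : cre i * cre j = cre j * cre i := by
  refine ext_single fun N => ?_
  rw [Module.End.mul_apply, Module.End.mul_apply, cre_single, cre_single, cre_single, cre_single]
  by_cases h : i = j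
  · subst h; rfl
  · simp [Function.update_of_ne h, Function.update_of_ne (Ne.symm h), Function.update_comm h,
      mul_comm]

theorem ann_mul_cre_self (i : Λ) : ann i * cre i = diag fun N => (N i : ℂ) + 1 := by
  refine ext_single fun N => ?_
  rw [Module.End.mul_apply, cre_single, ann_single, diag_single]
  simp only [Function.update_self, Function.update_idem, Nat.add_sub_cancel,
    Function.update_eq_self]
  congr 1
  push_cast
  rw [one_mul, mul_one, ← Complex.ofReal_mul, Real.mul_self_sqrt (by positivity)]
  simp

theorem cre_mul_ann_self (i : Λ) : cre i * ann i = diag fun N => (N i : ℂ) := by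
  refine ext_single fun N => ?_
  rw [Module.End.mul_apply, ann_single, cre_single, diag_single]
  rcases Nat.eq_zero_or_pos (N i) with h | h
  · simp [h]
  · simp only [Function.update_self, Function.update_idem, Nat.sub_add_cancel h,
      Function.update_eq_self]
    congr 1
    have : ((N i - 1 : ℕ) : ℝ) + 1 = N i := by
      rw [Nat.cast_sub h]; simp
    rw [this, one_mul, mul_one, ← Complex.ofReal_mul, Real.mul_self_sqrt (by positivity)]
    simp

theorem ann_mul_cre (i j : Λ) :
    ann i * cre j = cre j * ann i + if i = j then 1 else 0 := by
  by_cases h : i = j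
  · subst h
    rw [ann_mul_cre_self, cre_mul_ann_self]
    refine ext_single fun N => ?_
    simp [diag_single, Finsupp.single_add]
  · refine ext_single fun N => ?_
    rw [if_neg h, add_zero, Module.End.mul_apply, Module.End.mul_apply, cre_single, ann_single,
      ann_single, cre_single]
    simp [Function.update_of_ne h, Function.update_of_ne (Ne.symm h), Function.update_comm h,
      mul_comm]

/-- The derivative `∂_i = i π_i = (b_i - b_i†) / √2`. -/
def der (i : Λ) : Module.End ℂ (FinVec Λ) := ((Real.sqrt 2 : ℝ) : ℂ)⁻¹ • (ann i - cre i)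

theorem mom_eq (i : Λ) : mom i = -Complex.I • der i := by
  rw [mom, der, smul_smul]

theorem mom_sq (i : Λ) : mom i ^ 2 = -(der i ^ 2) := by
  rw [mom_eq, sq, sq, smul_mul_smul_comm]
  refine LinearMap.ext fun u => ?_
  simp

theorem sqrt_two_inv_mul_self :
    ((Real.sqrt 2 : ℝ) : ℂ)⁻¹ * ((Real.sqrt 2 : ℝ) : ℂ)⁻¹ = 1 / 2 := by
  rw [← mul_inv, ← Complex.ofReal_mul, Real.mul_self_sqrt (by norm_num)]
  norm_num

section ring
variable {R : Type*} [Ring R] [Algebra ℂ R] {a b c e z : R} (t : ℂ)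

/-- The two mixed commutators contribute `z` with opposite signs and cancel. Here `a`, `b` stand for
annihilation and `c`, `e` for creation operators. -/
theorem smul_add_comm_of_ccr (h1 : a * e = e * a + z) (h2 : b * c = c * b + z)
    (hab : a * b = b * a) (hce : c * e = e * c) :
    (t • (a + c)) * (t • (b + e)) = (t • (b + e)) * (t • (a + c)) := by
  rw [smul_mul_smul_comm, smul_mul_smul_comm]
  congr 1
  simp only [add_mul, mul_add, h1, h2, hab, hce]
  abel

theorem smul_sub_comm_of_ccr (h1 : a * e = e * a + z) (h2 : b * c = c * b + z)
    (hab : a * b = b * a) (hce : c * e = e * c) :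
    (t • (a - c)) * (t • (b - e)) = (t • (b - e)) * (t • (a - c)) := by
  rw [smul_mul_smul_comm, smul_mul_smul_comm]
  congr 1
  simp only [sub_mul, mul_sub, h1, h2, hab, hce]
  abel

/-- With these signs the two mixed commutators add up to `2 z`, which `t * t = 1 / 2` turns into
`z`. -/
theorem smul_sub_mul_smul_add_of_ccr (ht : t * t = 1 / 2) (h1 : a * e = e * a + z)
    (h2 : b * c = c * b + z) (hab : a * b = b * a) (hce : c * e = e * c) :
    (t • (a - c)) * (t • (b + e)) = (t • (b + e)) * (t • (a - c)) + z := by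
  have hz : z = (t * t) • (z + z) := by
    rw [ht, ← two_smul ℂ, smul_smul]; norm_num
  conv_rhs => rw [hz]
  rw [smul_mul_smul_comm, smul_mul_smul_comm, ← smul_add]
  congr 1
  simp only [sub_mul, mul_sub, add_mul, mul_add, h1, h2, hab, hce]
  abel

theorem eq_smul_add_of_sq (ht : t * t = 1 / 2) : a = t • (t • (a + c) + t • (a - c)) := by
  rw [← smul_add, smul_smul, ht]
  have : a + c + (a - c) = (2 : ℂ) • a := by rw [two_smul]; abel
  rw [this, smul_smul]; norm_num

theorem eq_smul_sub_of_sq (ht : t * t = 1 / 2) : c = t • (t • (a + c) - t • (a - c)) := by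
  rw [← smul_sub, smul_smul, ht]
  have : a + c - (a - c) = (2 : ℂ) • c := by rw [two_smul]; abel
  rw [this, smul_smul]; norm_num

end ring

theorem ann_mul_cre' (i j : Λ) :
    ann j * cre i = cre i * ann j + if i = j then 1 else 0 := by
  rw [ann_mul_cre j i]
  simp [eq_comm]

theorem phi_mul_phi_comm (i j : Λ) : phi i * phi j = phi j * phi i :=
  smul_add_comm_of_ccr (R := Module.End ℂ (FinVec Λ)) _ (ann_mul_cre i j) (ann_mul_cre' i j) (ann_mul_ann_comm i j)
    (cre_mul_cre_comm i j)

theorem der_mul_der_comm (i j : Λ) : der i * der j = der j * der i :=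
  smul_sub_comm_of_ccr (R := Module.End ℂ (FinVec Λ)) _ (ann_mul_cre i j) (ann_mul_cre' i j) (ann_mul_ann_comm i j)
    (cre_mul_cre_comm i j)

theorem der_mul_phi (i j : Λ) :
    der i * phi j = phi j * der i + if i = j then 1 else 0 :=
  smul_sub_mul_smul_add_of_ccr (R := Module.End ℂ (FinVec Λ)) _ sqrt_two_inv_mul_self (ann_mul_cre i j) (ann_mul_cre' i j)
    (ann_mul_ann_comm i j) (cre_mul_cre_comm i j)

theorem ann_eq (i : Λ) : ann i = ((Real.sqrt 2 : ℝ) : ℂ)⁻¹ • (phi i + der i) :=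
  eq_smul_add_of_sq (R := Module.End ℂ (FinVec Λ)) _ sqrt_two_inv_mul_self

theorem cre_eq (i : Λ) : cre i = ((Real.sqrt 2 : ℝ) : ℂ)⁻¹ • (phi i - der i) :=
  eq_smul_sub_of_sq (R := Module.End ℂ (FinVec Λ)) _ sqrt_two_inv_mul_self

theorem inner_phi_left (i : Λ) (u v : FinVec Λ) :
    inner ℂ (toFock (phi i u)) (toFock v) = inner ℂ (toFock u) (toFock (phi i v)) := by
  simp only [phi, LinearMap.smul_apply, LinearMap.add_apply, map_smul, map_add, inner_smul_left,
    inner_smul_right, inner_add_left, inner_add_right, inner_ann_left, inner_cre_left]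
  simp [add_comm]

theorem inner_der_left (i : Λ) (u v : FinVec Λ) :
    inner ℂ (toFock (der i u)) (toFock v) = -inner ℂ (toFock u) (toFock (der i v)) := by
  simp only [der, LinearMap.smul_apply, LinearMap.sub_apply, map_smul, map_sub, inner_smul_left,
    inner_smul_right, inner_sub_left, inner_sub_right, inner_ann_left, inner_cre_left]
  simp
  ring

/-- The product of the fields along a list of sites. -/
def phiList (l : List Λ) : Module.End ℂ (FinVec Λ) := (l.map phi).prod

theorem phiProd_eq {n : ℕ} (t : Fin n → Λ) : phiProd t = phiList (List.ofFn t) := by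
  rw [phiProd, phiList, List.map_ofFn]; rfl

end ops

/-! ### Weighted norms and tame operators. -/

section weight
variable [Fintype Λ]

/-- The weight `1 + ∑ N_i` of a configuration. -/
def wt (N : Config Λ) : ℝ := 1 + ∑ i, (N i : ℝ)

theorem one_le_wt (N : Config Λ) : 1 ≤ wt N := by
  have : 0 ≤ ∑ i, (N i : ℝ) := Finset.sum_nonneg fun i _ => by positivity
  unfold wt; linarith

theorem wt_nonneg (N : Config Λ) : 0 ≤ wt N := zero_le_one.trans (one_le_wt N)

theorem add_one_le_wt (N : Config Λ) (i : Λ) : (N i : ℝ) + 1 ≤ wt N := by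
  have := Finset.single_le_sum (f := fun i => (N i : ℝ)) (fun i _ => by positivity)
    (Finset.mem_univ i)
  unfold wt; linarith

/-- Multiplication by the `m`-th power of the weight. -/
def wtOp (m : ℕ) : Module.End ℂ (FinVec Λ) := diag fun N => ((wt N ^ m : ℝ) : ℂ)

theorem wtOp_apply (m : ℕ) (u : FinVec Λ) (N : Config Λ) :
    wtOp m u N = ((wt N ^ m : ℝ) : ℂ) * u N := diag_apply _ _ _

/-- The weighted norms. -/
def wnorm (m : ℕ) (u : FinVec Λ) : ℝ := ‖toFock (wtOp m u)‖

theorem wnorm_zero_left (u : FinVec Λ) : wnorm 0 u = ‖toFock u‖ := by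
  rw [wnorm]
  congr 2
  ext N
  simp [wtOp_apply]

theorem wnorm_nonneg (m : ℕ) (u : FinVec Λ) : 0 ≤ wnorm m u := norm_nonneg _

theorem wnorm_mono {m m' : ℕ} (h : m ≤ m') (u : FinVec Λ) : wnorm m u ≤ wnorm m' u := by
  refine norm_toFock_mono fun N => ?_
  rw [wtOp_apply, wtOp_apply, norm_mul, norm_mul, Complex.norm_real, Complex.norm_real,
    Real.norm_of_nonneg (pow_nonneg (wt_nonneg N) _),
    Real.norm_of_nonneg (pow_nonneg (wt_nonneg N) _)]
  gcongr
  exact one_le_wt N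

theorem wnorm_sq (m : ℕ) (u : FinVec Λ) (s : Finset (Config Λ)) (hs : u.support ⊆ s) :
    wnorm m u ^ 2 = ∑ N ∈ s, (wt N ^ m * ‖u N‖) ^ 2 := by
  rw [wnorm, norm_toFock_sq _ s]
  · refine Finset.sum_congr rfl fun N _ => ?_
    rw [wtOp_apply, norm_mul, Complex.norm_real,
      Real.norm_of_nonneg (pow_nonneg (wt_nonneg N) _)]
  · intro N hN
    apply hs
    rw [Finsupp.mem_support_iff, wtOp_apply] at hN
    exact Finsupp.mem_support_iff.2 fun h => hN (by simp [h])

variable (Λ) in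
/-- The operators that are bounded between weighted norms. -/
def tame : Subalgebra ℂ (Module.End ℂ (FinVec Λ)) where
  carrier := {A | ∀ m, ∃ m' C, 0 ≤ C ∧ ∀ u, wnorm m (A u) ≤ C * wnorm m' u}
  mul_mem' {A B} hA hB m := by
    obtain ⟨m', C, hC, h⟩ := hA m
    obtain ⟨m'', C', hC', h'⟩ := hB m'
    refine ⟨m'', C * C', by positivity, fun u => ?_⟩
    calc wnorm m (A (B u)) ≤ C * wnorm m' (B u) := h _
      _ ≤ C * (C' * wnorm m'' u) := by gcongr; exact h' u
      _ = _ := by ring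
  add_mem' {A B} hA hB m := by
    obtain ⟨m', C, hC, h⟩ := hA m
    obtain ⟨m'', C', hC', h'⟩ := hB m
    refine ⟨max m' m'', C + C', by positivity, fun u => ?_⟩
    calc wnorm m (A u + B u) ≤ wnorm m (A u) + wnorm m (B u) := by
          rw [wnorm, map_add, map_add]; exact norm_add_le _ _
      _ ≤ C * wnorm (max m' m'') u + C' * wnorm (max m' m'') u := by
          gcongr
          · exact (h u).trans (by gcongr; exact wnorm_mono (le_max_left _ _) u)
          · exact (h' u).trans (by gcongr; exact wnorm_mono (le_max_right _ _) u)
      _ = _ := by ring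
  algebraMap_mem' c m := by
    refine ⟨m, ‖c‖, norm_nonneg _, fun u => ?_⟩
    rw [Module.algebraMap_end_apply, wnorm, map_smul, map_smul, norm_smul, wnorm]

end weight

section ladder
variable [Fintype Λ] [DecidableEq Λ]

theorem wt_update (N : Config Λ) (i : Λ) (n : ℕ) :
    wt (Function.update N i n) = wt N - N i + n := by
  have h := Finset.sum_update_of_mem (Finset.mem_univ i) (fun i => (N i : ℝ)) (n : ℝ)
  have h2 : ∀ j, ((Function.update N i n j : ℕ) : ℝ) =
      Function.update (fun i => (N i : ℝ)) i (n : ℝ) j := fun j => by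
    by_cases hj : j = i
    · subst hj; simp
    · simp [hj]
  have h3 := Finset.sum_sdiff (Finset.singleton_subset_iff.2 (Finset.mem_univ i))
    (f := fun i => (N i : ℝ))
  rw [Finset.sum_singleton] at h3
  unfold wt
  rw [Finset.sum_congr rfl fun j _ => h2 j, h]
  linarith

theorem norm_cre_le (i : Λ) (v : FinVec Λ) : ‖toFock (cre i v)‖ ≤ wnorm 1 v := by
  have h : ‖toFock (cre i v)‖ ^ 2 ≤ wnorm 1 v ^ 2 := by
    rw [@norm_sq_eq_re_inner ℂ, inner_cre_left, ← Module.End.mul_apply, ann_mul_cre_self]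
    refine (re_inner_le_norm _ _).trans ?_
    rw [sq]
    refine mul_le_mul ?_ ?_ (norm_nonneg _) (norm_nonneg _)
    · rw [← wnorm_zero_left]; exact wnorm_mono zero_le_one v
    · refine norm_toFock_mono fun N => ?_
      rw [diag_apply, wtOp_apply, norm_mul, norm_mul]
      gcongr
      rw [Complex.norm_real, pow_one, Real.norm_of_nonneg (wt_nonneg N)]
      refine le_trans (le_of_eq ?_) (add_one_le_wt N i)
      rw [← Complex.ofReal_natCast, ← Complex.ofReal_one, ← Complex.ofReal_add, Complex.norm_real,
        Real.norm_of_nonneg (by positivity)]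
  exact le_of_sq_le_sq h (norm_nonneg _)

theorem norm_ann_le (i : Λ) (v : FinVec Λ) : ‖toFock (ann i v)‖ ≤ wnorm 1 v := by
  have h : ‖toFock (ann i v)‖ ^ 2 ≤ wnorm 1 v ^ 2 := by
    rw [@norm_sq_eq_re_inner ℂ, inner_ann_left, ← Module.End.mul_apply, cre_mul_ann_self]
    refine (re_inner_le_norm _ _).trans ?_
    rw [sq]
    refine mul_le_mul ?_ ?_ (norm_nonneg _) (norm_nonneg _)
    · rw [← wnorm_zero_left]; exact wnorm_mono zero_le_one v
    · refine norm_toFock_mono fun N => ?_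
      rw [diag_apply, wtOp_apply, norm_mul, norm_mul]
      gcongr
      rw [Complex.norm_real, pow_one, Real.norm_of_nonneg (wt_nonneg N), Complex.norm_natCast]
      have := add_one_le_wt N i
      linarith
  exact le_of_sq_le_sq h (norm_nonneg _)

theorem cre_mem_tame (i : Λ) : cre i ∈ tame Λ := by
  intro m
  refine ⟨m + 1, 2 ^ m, by positivity, fun u => ?_⟩
  -- Creation raises the weight by one; `wt N + 1 ≤ 2 * wt N` is the origin of the constant `2 ^ m`.
  have h : wtOp m * cre i = cre i * diag fun N => (((wt N + 1) ^ m : ℝ) : ℂ) := by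
    refine ext_single fun N => ?_
    rw [Module.End.mul_apply, Module.End.mul_apply, wtOp, diag_single, cre_single, diag_single,
      cre_single, wt_update]
    congr 1
    push_cast
    ring
  rw [wnorm, ← Module.End.mul_apply, h]
  refine (norm_cre_le i _).trans ?_
  rw [wnorm, wnorm]
  have h2 : (2 : ℝ) ^ m * ‖toFock (wtOp (m + 1) u)‖ =
      ‖toFock (((2 ^ m : ℝ) : ℂ) • wtOp (m + 1) u)‖ := by
    rw [map_smul, norm_smul, Complex.norm_real, Real.norm_of_nonneg (by positivity)]
  rw [h2]
  refine norm_toFock_mono fun N => ?_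
  rw [wtOp_apply, diag_apply, Finsupp.smul_apply, wtOp_apply, smul_eq_mul, ← mul_assoc,
    ← mul_assoc, norm_mul, norm_mul _ (u N), ← Complex.ofReal_mul, ← Complex.ofReal_mul,
    Complex.norm_real, Complex.norm_real]
  have h1 := one_le_wt N
  rw [Real.norm_of_nonneg (by positivity), Real.norm_of_nonneg (by positivity), pow_one, pow_succ,
    mul_comm (wt N), ← mul_assoc, ← mul_pow]
  gcongr
  linarith

theorem ann_mem_tame (i : Λ) : ann i ∈ tame Λ := by
  intro m
  refine ⟨m + 1, 1, by positivity, fun u => ?_⟩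
  have h : wtOp m * ann i = ann i * diag fun N => (((wt N - 1) ^ m : ℝ) : ℂ) := by
    refine ext_single fun N => ?_
    rw [Module.End.mul_apply, Module.End.mul_apply, wtOp, diag_single, ann_single, diag_single,
      ann_single, wt_update]
    rcases Nat.eq_zero_or_pos (N i) with h | h
    · simp [h]
    · congr 1
      rw [Nat.cast_sub h]
      push_cast
      ring
  rw [wnorm, ← Module.End.mul_apply, h]
  refine (norm_ann_le i _).trans ?_
  rw [wnorm, wnorm, one_mul]
  refine norm_toFock_mono fun N => ?_
  rw [wtOp_apply, diag_apply, wtOp_apply, ← mul_assoc,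
    norm_mul, norm_mul _ (u N), ← Complex.ofReal_mul,
    Complex.norm_real, Complex.norm_real]
  have h1 := one_le_wt N
  have h2 : 0 ≤ wt N - 1 := by linarith
  rw [Real.norm_of_nonneg (by positivity), Real.norm_of_nonneg (by positivity), pow_one, pow_succ,
    mul_comm (wt N)]
  gcongr
  linarith

theorem phi_mem_tame (i : Λ) : phi i ∈ tame Λ :=
  (tame Λ).smul_mem ((tame Λ).add_mem (ann_mem_tame i) (cre_mem_tame i)) _

theorem der_mem_tame (i : Λ) : der i ∈ tame Λ := by
  have h : der i = ((Real.sqrt 2 : ℝ) : ℂ)⁻¹ • (ann i + (-1 : ℂ) • cre i) :=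
    LinearMap.ext fun u => by simp [der, sub_eq_add_neg]
  rw [h]
  exact (tame Λ).smul_mem ((tame Λ).add_mem (ann_mem_tame i)
    ((tame Λ).smul_mem (cre_mem_tame i) _)) _

theorem phiList_mem_tame (l : List Λ) : phiList l ∈ tame Λ :=
  (tame Λ).list_prod_mem fun A hA => by
    obtain ⟨i, _, rfl⟩ := List.mem_map.1 hA
    exact phi_mem_tame i

theorem evenPoly_mem_tame (k : ℕ) (f : (r : ℕ) → (Fin (2 * r) → Λ) → ℝ) :
    evenPoly k f ∈ tame Λ :=
  (tame Λ).sum_mem fun r _ => (tame Λ).sum_mem fun t _ => by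
    rw [phiProd_eq]
    exact (tame Λ).smul_mem (phiList_mem_tame _) _

theorem hamEnd_mem_tame (k : ℕ) (μ : Λ → ℝ) (f : (r : ℕ) → (Fin (2 * r) → Λ) → ℝ) :
    hamEnd k μ f ∈ tame Λ := by
  refine (tame Λ).add_mem ((tame Λ).sum_mem fun i _ => (tame Λ).smul_mem ?_ _)
    (evenPoly_mem_tame k f)
  rw [mom_eq]
  exact (tame Λ).pow_mem ((tame Λ).smul_mem (der_mem_tame i) _) 2

end ladder

/-! ### Rapidly decaying states and the action of tame operators on them. -/

section rapid

/-- The part of a state supported on a finite set of configurations. -/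
def trunc (ψ : Fock Λ) (s : Finset (Config Λ)) : FinVec Λ := ∑ N ∈ s, Finsupp.single N (ψ N)

theorem trunc_apply_of_mem (ψ : Fock Λ) {s : Finset (Config Λ)} {N : Config Λ} (h : N ∈ s) :
    trunc ψ s N = ψ N := by
  classical
  simp [trunc, Finsupp.finsetSum_apply, Finsupp.single_apply, h]

theorem support_trunc_subset (ψ : Fock Λ) (s : Finset (Config Λ)) : (trunc ψ s).support ⊆ s := by
  classical
  intro N hN
  by_contra h
  refine Finsupp.mem_support_iff.1 hN ?_
  simp [trunc, Finsupp.finsetSum_apply, Finsupp.single_apply, h]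

theorem toFock_trunc (ψ : Fock Λ) (A : Module.End ℂ (FinVec Λ)) (s : Finset (Config Λ)) :
    toFock (A (trunc ψ s)) = ∑ N ∈ s, ψ N • toFock (A (Finsupp.single N 1)) := by
  rw [trunc, map_sum, map_sum]
  refine Finset.sum_congr rfl fun N _ => ?_
  rw [← map_smul, ← map_smul, Finsupp.smul_single, smul_eq_mul, mul_one]

variable [Fintype Λ]

/-- States with rapidly decaying coefficients. -/
def Rapid (ψ : Fock Λ) : Prop := ∀ m : ℕ, Summable fun N : Config Λ => (wt N ^ m * ‖ψ N‖) ^ 2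

theorem wnorm_trunc_sq (ψ : Fock Λ) (m : ℕ) (s : Finset (Config Λ)) :
    wnorm m (trunc ψ s) ^ 2 = ∑ N ∈ s, (wt N ^ m * ‖ψ N‖) ^ 2 := by
  rw [wnorm_sq m _ s (support_trunc_subset ψ s)]
  exact Finset.sum_congr rfl fun N hN => by rw [trunc_apply_of_mem ψ hN]

/-- The partial sums are `A` applied to truncations of `ψ`, so tameness reduces the Cauchy criterion
to that of a single weighted norm of `ψ`. -/
theorem Rapid.summable {ψ : Fock Λ} (h : Rapid ψ) {A : Module.End ℂ (FinVec Λ)}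
    (hA : A ∈ tame Λ) : Summable fun N => ψ N • toFock (A (Finsupp.single N 1)) := by
  rw [summable_iff_vanishing_norm]
  intro ε hε
  obtain ⟨m, C, hC, hb⟩ := hA 0
  obtain ⟨s, hs⟩ := summable_iff_vanishing_norm.1 (h m) ((ε / (C + 1)) ^ 2) (by positivity)
  refine ⟨s, fun t ht => ?_⟩
  have h1 := hs t ht
  rw [← wnorm_trunc_sq, Real.norm_of_nonneg (sq_nonneg _)] at h1
  have h2 := lt_of_pow_lt_pow_left₀ 2 (by positivity) h1
  rw [← toFock_trunc, ← wnorm_zero_left]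
  calc wnorm 0 (A (trunc ψ t)) ≤ C * wnorm m (trunc ψ t) := hb _
    _ ≤ (C + 1) * wnorm m (trunc ψ t) := by
        gcongr
        · exact wnorm_nonneg _ _
        · linarith
    _ < (C + 1) * (ε / (C + 1)) := by gcongr
    _ = ε := by field_simp

/-- The action of the tame operators on a rapidly decaying state. -/
def vec (ψ : Fock Λ) (h : Rapid ψ) : tame Λ →ₗ[ℂ] Fock Λ where
  toFun A := ∑' N, ψ N • toFock ((A : Module.End ℂ (FinVec Λ)) (Finsupp.single N 1))
  map_add' A B := by
    rw [← (h.summable A.2).tsum_add (h.summable B.2)]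
    simp
  map_smul' c A := by
    rw [RingHom.id_apply, ← (h.summable A.2).tsum_const_smul]
    refine tsum_congr fun N => ?_
    rw [smul_comm c]
    simp

theorem tendsto_vec {ψ : Fock Λ} (h : Rapid ψ) (A : tame Λ) :
    Filter.Tendsto (fun s => toFock ((A : Module.End ℂ (FinVec Λ)) (trunc ψ s))) Filter.atTop
      (nhds (vec ψ h A)) := by
  simp_rw [toFock_trunc]
  exact (h.summable A.2).hasSum

/-- Adjoint relations on finite vectors survive the limit of truncations. This is what makes formal
manipulations with operators acting on `Ω` legitimate. -/
theorem inner_vec {ψ : Fock Λ} (h : Rapid ψ) {S T : tame Λ}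
    (hS : ∀ u v : FinVec Λ, inner ℂ (toFock (S.1 u)) (toFock v) = inner ℂ (toFock u) (toFock (T.1 v)))
    (A B : tame Λ) : inner ℂ (vec ψ h (S * A)) (vec ψ h B) = inner ℂ (vec ψ h A) (vec ψ h (T * B)) := by
  have h1 := (tendsto_vec h (S * A)).inner (𝕜 := ℂ) (tendsto_vec h B)
  have h2 := (tendsto_vec h A).inner (𝕜 := ℂ) (tendsto_vec h (T * B))
  refine tendsto_nhds_unique h1 (h2.congr fun s => ?_)
  exact (hS _ _).symm

theorem vec_one {ψ : Fock Λ} (h : Rapid ψ) : vec ψ h 1 = ψ := by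
  classical
  have h1 : (fun N => ψ N • toFock ((1 : Module.End ℂ (FinVec Λ)) (Finsupp.single N 1))) =
      fun N => lp.single 2 N (ψ N) := by
    funext N
    rw [Module.End.one_apply, toFock_single, one_smul, mott_eq, ← lp.single_smul, smul_eq_mul,
      mul_one]
  change ∑' N, ψ N • toFock ((1 : Module.End ℂ (FinVec Λ)) (Finsupp.single N 1)) = ψ
  rw [h1]
  exact (lp.hasSum_single (by norm_num) ψ).tsum_eq

/-- Testing on basis vectors shows that the coefficients of `χ` have modulus `wt N ^ m * ‖ψ N‖`, and
`χ` is square summable. So it is enough that the powers of the weight have a weak action on `ψ`. -/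
theorem rapid_of_inner {ψ : Fock Λ}
    (h : ∀ m, ∃ χ : Fock Λ, ∀ u, inner ℂ χ (toFock u) = inner ℂ ψ (toFock (wtOp m u))) :
    Rapid ψ := by
  intro m
  obtain ⟨χ, hχ⟩ := h m
  have h1 : ∀ N, ‖χ N‖ = wt N ^ m * ‖ψ N‖ := fun N => by
    have := congrArg norm (hχ (Finsupp.single N 1))
    rw [wtOp, diag_single, toFock_single, toFock_single, one_smul, mul_one, inner_smul_right,
      inner_mott_right, inner_mott_right, norm_mul, RCLike.norm_conj, RCLike.norm_conj,
      Complex.norm_real, Real.norm_of_nonneg (pow_nonneg (wt_nonneg N) _)] at this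
    exact this
  have h2 := (lp.memℓp χ).summable (by norm_num)
  simpa [h1] using h2

end rapid

/-! ### Closure of a symmetric operator. -/

section symmetric
open Filter Topology

theorem dense_range_toFock : Dense (LinearMap.range (toFock (Λ := Λ)) : Set (Fock Λ)) := by
  rw [Submodule.dense_iff_topologicalClosure_eq_top,
    Submodule.topologicalClosure_eq_top_iff, Submodule.eq_bot_iff]
  intro ψ hψ
  refine eq_of_inner_toFock fun u => ?_
  rw [inner_zero_left]
  exact Submodule.inner_left_of_mem_orthogonal (LinearMap.mem_range_self toFock u) hψ

variable {A : Module.End ℂ (FinVec Λ)}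

theorem onFock_apply (u : FinVec Λ) (h : toFock u ∈ (onFock A).domain) :
    onFock A ⟨toFock u, h⟩ = toFock (A u) := by
  change toFock (A ((LinearEquiv.ofInjective toFock toFock_injective).symm ⟨toFock u, h⟩)) = _
  congr 2
  rw [LinearEquiv.symm_apply_eq]
  rfl

theorem mem_graph_onFock {x : Fock Λ × Fock Λ} :
    x ∈ (onFock A).graph ↔ ∃ u, x = (toFock u, toFock (A u)) := by
  rw [LinearPMap.mem_graph_iff]
  constructor
  · rintro ⟨⟨y, u, rfl⟩, h1, h2⟩
    refine ⟨u, Prod.ext h1.symm ?_⟩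
    rw [← h2]
    exact onFock_apply u _
  · rintro ⟨u, rfl⟩
    exact ⟨⟨toFock u, ⟨u, rfl⟩⟩, rfl, onFock_apply u _⟩

variable (hA : ∀ u v, inner ℂ (toFock (A u)) (toFock v) = inner ℂ (toFock u) (toFock (A v)))
include hA

/-- A densely defined symmetric operator is contained in its adjoint, which is closed. -/
theorem isClosable_onFock : (onFock A).IsClosable := by
  have hd : Dense ((onFock A).domain : Set (Fock Λ)) := dense_range_toFock
  have hf : (onFock A).IsFormalAdjoint (onFock A) := by
    rintro ⟨_, u, rfl⟩ ⟨_, v, rfl⟩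
    have h1 := onFock_apply (A := A) u ⟨u, rfl⟩
    have h2 := onFock_apply (A := A) v ⟨v, rfl⟩
    exact (congrArg (fun x => inner ℂ x (toFock v)) h1).trans
      ((hA u v).trans (congrArg (fun x => inner ℂ (toFock u) x) h2).symm)
  exact (LinearPMap.adjoint_isClosed hd).isClosable.leIsClosable (hf.le_adjoint hd)

theorem mem_graph_closure_iff {x : Fock Λ × Fock Λ} :
    x ∈ (onFock A).closure.graph ↔ ∃ u : ℕ → FinVec Λ,
      Tendsto (fun n => toFock (u n)) atTop (𝓝 x.1) ∧
      Tendsto (fun n => toFock (A (u n))) atTop (𝓝 x.2) := by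
  rw [← (isClosable_onFock hA).graph_closure_eq_closure_graph, ← SetLike.mem_coe,
    Submodule.topologicalClosure_coe, mem_closure_iff_seq_limit]
  constructor
  · rintro ⟨y, hy, hlim⟩
    choose u hu using fun n => mem_graph_onFock.1 (hy n)
    refine ⟨u, ?_, ?_⟩
    · have := (continuous_fst.tendsto x).comp hlim
      refine this.congr fun n => ?_
      simp [hu n]
    · have := (continuous_snd.tendsto x).comp hlim
      refine this.congr fun n => ?_
      simp [hu n]
  · rintro ⟨u, h1, h2⟩
    exact ⟨fun n => (toFock (u n), toFock (A (u n))), fun n => mem_graph_onFock.2 ⟨u n, rfl⟩,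
      h1.prodMk_nhds h2⟩

theorem exists_seq_of_mem_domain (ψ : (onFock A).closure.domain) : ∃ u : ℕ → FinVec Λ,
      Tendsto (fun n => toFock (u n)) atTop (𝓝 (ψ : Fock Λ)) ∧
      Tendsto (fun n => toFock (A (u n))) atTop (𝓝 ((onFock A).closure ψ)) :=
  (mem_graph_closure_iff hA).1 ((onFock A).closure.mem_graph ψ)

theorem closure_symmetric (ψ χ : (onFock A).closure.domain) :
    inner ℂ ((onFock A).closure ψ) (χ : Fock Λ) = inner ℂ (ψ : Fock Λ) ((onFock A).closure χ) := by
  obtain ⟨u, hu1, hu2⟩ := exists_seq_of_mem_domain hA ψ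
  obtain ⟨v, hv1, hv2⟩ := exists_seq_of_mem_domain hA χ
  refine tendsto_nhds_unique (hu2.inner hv1) ((hu1.inner hv2).congr fun n => ?_)
  exact (hA _ _).symm

end symmetric

/-! ### Minimal energy and the spectral gap. -/

section ground
variable {E : Type*} [NormedAddCommGroup E] [InnerProductSpace ℂ E] {T : E →ₗ.[ℂ] E}
  (hT : ∀ ψ χ : T.domain, inner ℂ (T ψ) (χ : E) = inner ℂ (ψ : E) (T χ)) {Ω : T.domain}
  (hΩ : IsGroundState T Ω)

theorem energy_le_of_unit {e : ℝ} {P : T.domain → Prop} (hP : ∀ (c : ℂ) ψ, P ψ → P (c • ψ))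
    (h : ∀ ψ : T.domain, ‖(ψ : E)‖ = 1 → P ψ → e ≤ expect T ψ) (ψ : T.domain) (hψ : P ψ) :
    e * ‖(ψ : E)‖ ^ 2 ≤ expect T ψ := by
  by_cases h0 : (ψ : E) = 0
  · have : ψ = 0 := Subtype.ext h0
    subst this
    simp [expect]
  · have hn : ‖(ψ : E)‖ ≠ 0 := norm_ne_zero_iff.2 h0
    have h1 := h (((‖(ψ : E)‖⁻¹ : ℝ) : ℂ) • ψ) (by
      rw [SetLike.val_smul, norm_smul, Complex.norm_real, norm_inv, norm_norm,
        inv_mul_cancel₀ hn]) (hP _ _ hψ)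
    have h2 : expect T (((‖(ψ : E)‖⁻¹ : ℝ) : ℂ) • ψ) = (‖(ψ : E)‖⁻¹) ^ 2 * expect T ψ := by
      rw [expect, expect, LinearPMap.map_smul, SetLike.val_smul, inner_smul_left,
        inner_smul_right, Complex.conj_ofReal, ← mul_assoc, ← Complex.ofReal_mul,
        Complex.re_ofReal_mul, sq]
    rw [h2] at h1
    have h3 : 0 < ‖(ψ : E)‖ ^ 2 := by positivity
    calc e * ‖(ψ : E)‖ ^ 2 ≤ (‖(ψ : E)‖⁻¹ ^ 2 * expect T ψ) * ‖(ψ : E)‖ ^ 2 := by gcongr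
      _ = _ := by field_simp

include hT hΩ

/-- First variation: the excess energy of `Ω + t ψ` is a nonnegative quadratic in the real variable
`t` without constant term, so its linear coefficient vanishes. Using `i ψ` as well gives the
imaginary part. -/
theorem inner_ground_apply (ψ : T.domain) :
    inner ℂ (T Ω) (ψ : E) = (expect T Ω : ℂ) * inner ℂ (Ω : E) (ψ : E) := by
  set e := expect T Ω with he
  have hmin : ∀ ψ : T.domain, e * ‖(ψ : E)‖ ^ 2 ≤ expect T ψ := fun ψ =>
    energy_le_of_unit (P := fun _ => True) (fun _ _ _ => trivial) (fun ψ h _ => hΩ.2 ψ h) ψ trivial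
  have hre : ∀ ψ : T.domain, (inner ℂ (T Ω - (e : ℂ) • (Ω : E)) (ψ : E)).re = 0 := by
    intro ψ
    set a := (inner ℂ (T Ω - (e : ℂ) • (Ω : E)) (ψ : E)).re with ha
    have ha' : a = (inner ℂ (T Ω) (ψ : E)).re - e * (inner ℂ (Ω : E) (ψ : E)).re := by
      rw [ha, inner_sub_left, inner_smul_left, Complex.sub_re, Complex.conj_ofReal,
        Complex.re_ofReal_mul]
    have hq : ∀ t : ℝ, 0 ≤ 2 * t * a + t ^ 2 * (expect T ψ - e * ‖(ψ : E)‖ ^ 2) := by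
      intro t
      have h1 := hmin (Ω + (t : ℂ) • ψ)
      have h2 : expect T (Ω + (t : ℂ) • ψ) =
          e + 2 * t * (inner ℂ (T Ω) (ψ : E)).re + t ^ 2 * expect T ψ := by
        have h3 : (inner ℂ (ψ : E) (T Ω)).re = (inner ℂ (T Ω) (ψ : E)).re := by
          rw [← inner_conj_symm, Complex.conj_re]
        rw [he, expect, expect, expect, LinearPMap.map_add, LinearPMap.map_smul,
          Submodule.coe_add, SetLike.val_smul, inner_add_left, inner_add_right, inner_add_right,
          inner_smul_left, inner_smul_right, inner_smul_left, inner_smul_right,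
          Complex.conj_ofReal, ← hT Ω ψ, Complex.add_re, Complex.add_re, Complex.add_re,
          Complex.re_ofReal_mul, Complex.re_ofReal_mul, Complex.re_ofReal_mul,
          Complex.re_ofReal_mul, h3]
        ring
      have h4 : ‖((Ω + (t : ℂ) • ψ : T.domain) : E)‖ ^ 2 =
          1 + 2 * t * (inner ℂ (Ω : E) (ψ : E)).re + t ^ 2 * ‖(ψ : E)‖ ^ 2 := by
        rw [Submodule.coe_add, SetLike.val_smul, @norm_add_sq ℂ, hΩ.1, inner_smul_right, norm_smul,
          mul_pow, Complex.norm_real, Real.norm_eq_abs, sq_abs]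
        simp
        ring
      rw [h2, h4] at h1
      rw [ha']
      nlinarith
    by_contra hne
    set b := expect T ψ - e * ‖(ψ : E)‖ ^ 2 with hb
    have hb0 : 0 ≤ b := sub_nonneg.2 (hmin ψ)
    -- The minimiser would be `t = -a / b`; the `+ 1` avoids the case `b = 0`.
    have h5 := hq (-a / (b + 1))
    have h6 : 2 * (-a / (b + 1)) * a + (-a / (b + 1)) ^ 2 * b =
        -(a ^ 2 * (b + 2)) / (b + 1) ^ 2 := by
      field_simp
      ring
    rw [h6] at h5
    have h7 : 0 < a ^ 2 * (b + 2) := by positivity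
    have h8 : -(a ^ 2 * (b + 2)) / (b + 1) ^ 2 < 0 := div_neg_of_neg_of_pos (by linarith) (by positivity)
    linarith
  have him : (inner ℂ (T Ω - (e : ℂ) • (Ω : E)) (ψ : E)).im = 0 := by
    have := hre (Complex.I • ψ)
    rw [SetLike.val_smul, inner_smul_right, Complex.I_mul_re, neg_eq_zero] at this
    exact this
  have h0 : inner ℂ (T Ω - (e : ℂ) • (Ω : E)) (ψ : E) = 0 := Complex.ext (hre ψ) him
  rwa [inner_sub_left, inner_smul_left, Complex.conj_ofReal, sub_eq_zero] at h0

/-- The gap is applied to the component of `ψ` orthogonal to `Ω`. Since `Ω` is an eigenvector,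
removing the other component lowers the energy by exactly `e * ‖c‖ ^ 2`. -/
theorem gap_le {Δ : ℝ} (hgap : IsSpectralGap T Ω Δ) (ψ : T.domain) :
    Δ * (‖(ψ : E)‖ ^ 2 - ‖inner ℂ (Ω : E) (ψ : E)‖ ^ 2) ≤
      expect T ψ - expect T Ω * ‖(ψ : E)‖ ^ 2 := by
  set e := expect T Ω with he
  set c := inner ℂ (Ω : E) (ψ : E) with hc
  have hmain := energy_le_of_unit (T := T) (e := Δ + e)
    (P := fun χ => inner ℂ (Ω : E) (χ : E) = 0)
    (fun c χ h => by rw [SetLike.val_smul, inner_smul_right, h, mul_zero])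
    (fun χ h1 h2 => by
      have := hgap.1 ⟨χ, h1, h2, rfl⟩
      linarith) (ψ + (-c) • Ω) (by
        rw [Submodule.coe_add, SetLike.val_smul, inner_add_right, inner_smul_right,
          inner_self_eq_norm_sq_to_K, hΩ.1]
        simp [hc])
  have hcc : c * (starRingEnd ℂ) c = ((‖c‖ ^ 2 : ℝ) : ℂ) := by
    rw [Complex.mul_conj, Complex.normSq_eq_norm_sq]
  have h1 : ‖((ψ + (-c) • Ω : T.domain) : E)‖ ^ 2 = ‖(ψ : E)‖ ^ 2 - ‖c‖ ^ 2 := by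
    rw [Submodule.coe_add, SetLike.val_smul, @norm_add_sq ℂ, inner_smul_right, norm_smul, hΩ.1,
      ← inner_conj_symm, ← hc, neg_mul, hcc, norm_neg]
    simp only [← Complex.ofReal_neg, RCLike.re_to_complex, Complex.ofReal_re]
    ring
  have h2 : expect T (ψ + (-c) • Ω) = expect T ψ - e * ‖c‖ ^ 2 := by
    have i1 : inner ℂ (ψ : E) (T Ω) = e * (starRingEnd ℂ) c := by
      rw [← inner_conj_symm, inner_ground_apply hT hΩ, map_mul, Complex.conj_ofReal]
    have i2 : inner ℂ (Ω : E) (T ψ) = e * c := by rw [← hT, inner_ground_apply hT hΩ]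
    have i3 : inner ℂ (Ω : E) (T Ω) = e := by
      rw [← hT, inner_ground_apply hT hΩ, inner_self_eq_norm_sq_to_K, hΩ.1]
      simp [he]
    rw [expect, LinearPMap.map_add, LinearPMap.map_smul, Submodule.coe_add, SetLike.val_smul,
      inner_add_left, inner_add_right, inner_add_right, inner_smul_left, inner_smul_right,
      inner_smul_left, inner_smul_right, i1, i2, i3, Complex.add_re]
    have j1 : -c * (↑e * (starRingEnd ℂ) c) = ((-(e * ‖c‖ ^ 2) : ℝ) : ℂ) := by
      rw [show -c * (↑e * (starRingEnd ℂ) c) = -(e * (c * (starRingEnd ℂ) c)) by ring, hcc]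
      push_cast; ring
    have j2 : (starRingEnd ℂ) (-c) * (↑e * c) = ((-(e * ‖c‖ ^ 2) : ℝ) : ℂ) := by
      rw [map_neg, show -(starRingEnd ℂ) c * (↑e * c) = -(e * (c * (starRingEnd ℂ) c)) by ring,
        hcc]
      push_cast; ring
    have j3 : (starRingEnd ℂ) (-c) * (-c * ↑e) = (((e * ‖c‖ ^ 2) : ℝ) : ℂ) := by
      rw [map_neg, show -(starRingEnd ℂ) c * (-c * ↑e) = (e * (c * (starRingEnd ℂ) c)) by ring,
        hcc]
      push_cast; ring
    rw [j1, j2, j3, Complex.add_re, Complex.add_re, Complex.ofReal_re, Complex.ofReal_re,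
      expect]
    ring
  rw [h1, h2] at hmain
  linarith

end ground

/-! ### Symmetry of the Hamiltonian on finite vectors. -/

section ham
variable [DecidableEq Λ]

theorem inner_mom_left (i : Λ) (u v : FinVec Λ) :
    inner ℂ (toFock (mom i u)) (toFock v) = inner ℂ (toFock u) (toFock (mom i v)) := by
  rw [mom_eq]
  simp only [LinearMap.smul_apply, map_smul, inner_smul_left, inner_smul_right, inner_der_left]
  simp

theorem inner_phiList_left (l : List Λ) (u v : FinVec Λ) :
    inner ℂ (toFock (phiList l u)) (toFock v) =
      inner ℂ (toFock u) (toFock (phiList l.reverse v)) := by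
  induction l generalizing u v with
  | nil => rfl
  | cons i l ih =>
    rw [List.reverse_cons]
    have h : phiList (l.reverse ++ [i]) v = phiList l.reverse (phi i v) := by
      simp [phiList, Module.End.mul_apply]
    rw [h, ← ih, ← inner_phi_left]
    rfl

theorem phiList_perm {l l' : List Λ} (h : l.Perm l') : phiList l = phiList l' := by
  rw [phiList, phiList]
  refine (h.map phi).prod_eq' ?_
  refine List.Pairwise.imp_mem.2 (List.pairwise_of_forall fun a b ha hb => ?_)
  obtain ⟨i, _, rfl⟩ := List.mem_map.1 ha
  obtain ⟨j, _, rfl⟩ := List.mem_map.1 hb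
  exact phi_mul_phi_comm i j

theorem inner_phiList_left' (l : List Λ) (u v : FinVec Λ) :
    inner ℂ (toFock (phiList l u)) (toFock v) =
      inner ℂ (toFock u) (toFock (phiList l v)) := by
  rw [inner_phiList_left, phiList_perm l.reverse_perm]

variable [Fintype Λ]

theorem inner_evenPoly_left (k : ℕ) (f : (r : ℕ) → (Fin (2 * r) → Λ) → ℝ) (u v : FinVec Λ) :
    inner ℂ (toFock (evenPoly k f u)) (toFock v) =
      inner ℂ (toFock u) (toFock (evenPoly k f v)) := by
  simp only [evenPoly, LinearMap.sum_apply, map_sum, sum_inner, inner_sum]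
  refine Finset.sum_congr rfl fun r _ => Finset.sum_congr rfl fun t _ => ?_
  rw [phiProd_eq, LinearMap.smul_apply, LinearMap.smul_apply, map_smul, map_smul, inner_smul_left,
    inner_smul_right, inner_phiList_left', Complex.conj_ofReal]

theorem inner_hamEnd_left (k : ℕ) (μ : Λ → ℝ) (f : (r : ℕ) → (Fin (2 * r) → Λ) → ℝ)
    (u v : FinVec Λ) :
    inner ℂ (toFock (hamEnd k μ f u)) (toFock v) =
      inner ℂ (toFock u) (toFock (hamEnd k μ f v)) := by
  rw [hamEnd, LinearMap.add_apply, LinearMap.add_apply, map_add, map_add, inner_add_left,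
    inner_add_right, inner_evenPoly_left]
  congr 1
  simp only [LinearMap.sum_apply, map_sum, sum_inner, inner_sum]
  refine Finset.sum_congr rfl fun i _ => ?_
  rw [LinearMap.smul_apply, LinearMap.smul_apply, map_smul, map_smul, inner_smul_left,
    inner_smul_right, Complex.conj_ofReal, sq, Module.End.mul_apply, Module.End.mul_apply,
    inner_mom_left, inner_mom_left]

theorem hamEnd_apply (k : ℕ) (μ : Λ → ℝ) (f : (r : ℕ) → (Fin (2 * r) → Λ) → ℝ) (u : FinVec Λ) :
    hamEnd k μ f u = ∑ i, (-(μ i : ℂ)) • der i (der i u) + evenPoly k f u := by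
  rw [hamEnd, LinearMap.add_apply, LinearMap.sum_apply]
  congr 1
  refine Finset.sum_congr rfl fun i _ => ?_
  rw [mom_sq, LinearMap.smul_apply, LinearMap.neg_apply, smul_neg, neg_smul, sq]
  rfl

end ham

/-! ### The parity operator. -/

section parity
variable [Fintype Λ]

/-- The sign `(-1) ^ ∑ N_i`. -/
def sgn (N : Config Λ) : ℂ := (-1) ^ ∑ i, N i

theorem sgn_mul_self (N : Config Λ) : sgn N * sgn N = 1 := by
  rw [sgn, ← mul_pow]; simp

theorem norm_sgn (N : Config Λ) : ‖sgn N‖ = 1 := by simp [sgn]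

variable (Λ) in
/-- The parity operator. -/
def par : Module.End ℂ (FinVec Λ) := diag sgn

theorem norm_toFock_par (u : FinVec Λ) : ‖toFock (par Λ u)‖ = ‖toFock u‖ := by
  apply le_antisymm <;> refine norm_toFock_mono fun N => le_of_eq ?_ <;>
  simp [par, diag_apply, norm_sgn]

theorem par_par (u : FinVec Λ) : par Λ (par Λ u) = u := by
  ext N
  rw [par, diag_apply, diag_apply, ← mul_assoc, sgn_mul_self, one_mul]

theorem inner_par_par (u v : FinVec Λ) :
    inner ℂ (toFock (par Λ u)) (toFock (par Λ v)) = inner ℂ (toFock u) (toFock v) := by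
  rw [inner_toFock_left, inner_toFock_left]
  have : (par Λ u).support ⊆ u.support := fun N hN => by
    rw [Finsupp.mem_support_iff, par, diag_apply] at hN
    exact Finsupp.mem_support_iff.2 fun h => hN (by simp [h])
  rw [Finsupp.sum_of_support_subset _ this _ (by simp), Finsupp.sum]
  refine Finset.sum_congr rfl fun N _ => ?_
  have h : (starRingEnd ℂ) (sgn N) = sgn N := by simp [sgn]
  rw [toFock_apply, toFock_apply, par, diag_apply, diag_apply, map_mul, h,
    mul_mul_mul_comm, sgn_mul_self, one_mul]

variable [DecidableEq Λ]

theorem sum_update_add (N : Config Λ) (i : Λ) (n : ℕ) :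
    ∑ j, Function.update N i n j + N i = ∑ j, N j + n := by
  rw [Finset.sum_update_of_mem (Finset.mem_univ i)]
  have h3 := Finset.sum_sdiff (Finset.singleton_subset_iff.2 (Finset.mem_univ i)) (f := N)
  rw [Finset.sum_singleton] at h3
  omega

theorem par_cre (i : Λ) (u : FinVec Λ) : par Λ (cre i u) = -cre i (par Λ u) := by
  refine finVec_induction (p := fun u => par Λ (cre i u) = -cre i (par Λ u)) u (by simp)
    (fun u v hu hv => by simp [hu, hv, add_comm]) (fun c u hu => by simp [hu]) fun N => ?_
  rw [cre_single, par, diag_single, diag_single, cre_single, ← Finsupp.single_neg]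
  congr 1
  have h : ∑ j, Function.update N i (N i + 1) j = ∑ j, N j + 1 := by
    have := sum_update_add N i (N i + 1); omega
  rw [sgn, sgn, h, pow_succ]
  ring

theorem par_ann (i : Λ) (u : FinVec Λ) : par Λ (ann i u) = -ann i (par Λ u) := by
  refine finVec_induction (p := fun u => par Λ (ann i u) = -ann i (par Λ u)) u (by simp)
    (fun u v hu hv => by simp [hu, hv, add_comm]) (fun c u hu => by simp [hu]) fun N => ?_
  rw [ann_single, par, diag_single, diag_single, ann_single, ← Finsupp.single_neg]
  rcases Nat.eq_zero_or_pos (N i) with h0 | h0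
  · simp [h0]
  congr 1
  have h : ∑ j, N j = ∑ j, Function.update N i (N i - 1) j + 1 := by
    have := sum_update_add N i (N i - 1); omega
  rw [sgn, sgn, h, pow_succ]
  ring

theorem par_phi (i : Λ) (u : FinVec Λ) : par Λ (phi i u) = -phi i (par Λ u) := by
  simp [phi, par_ann, par_cre, add_comm]

theorem par_der (i : Λ) (u : FinVec Λ) : par Λ (der i u) = -der i (par Λ u) := by
  simp [der, par_ann, par_cre, neg_add_eq_sub, smul_sub]

theorem par_phiList (l : List Λ) (u : FinVec Λ) :
    par Λ (phiList l u) = (-1 : ℂ) ^ l.length • phiList l (par Λ u) := by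
  induction l with
  | nil => simp [phiList]
  | cons i l ih =>
    change par Λ (phi i (phiList l u)) = (-1 : ℂ) ^ (l.length + 1) • phi i (phiList l (par Λ u))
    rw [par_phi, ih, map_smul, pow_succ]
    simp

theorem par_hamEnd (k : ℕ) (μ : Λ → ℝ) (f : (r : ℕ) → (Fin (2 * r) → Λ) → ℝ) (u : FinVec Λ) :
    par Λ (hamEnd k μ f u) = hamEnd k μ f (par Λ u) := by
  rw [hamEnd_apply, hamEnd_apply, map_add, map_sum, evenPoly]
  congr 1
  · refine Finset.sum_congr rfl fun i _ => ?_
    rw [map_smul, par_der, par_der, map_neg, neg_neg]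
  · simp only [LinearMap.sum_apply, map_sum]
    refine Finset.sum_congr rfl fun r _ => Finset.sum_congr rfl fun t _ => ?_
    rw [LinearMap.smul_apply, LinearMap.smul_apply, map_smul, phiProd_eq, par_phiList,
      List.length_ofFn, pow_mul]
    simp

end parity

/-! ### The ground state has definite parity. -/

section gapped
open Filter Topology
variable [Fintype Λ] [DecidableEq Λ]

/-- A gapped ground state of definite parity `σ`, described through the finite vectors. -/
structure GappedState (H : Module.End ℂ (FinVec Λ)) (Ω : Fock Λ) (e Δ : ℝ) (σ : ℂ) : Prop where
  norm_eq : ‖Ω‖ = 1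
  eigen : ∀ u, inner ℂ Ω (toFock (H u)) = (e : ℂ) * inner ℂ Ω (toFock u)
  gap : ∀ u, Δ * (‖toFock u‖ ^ 2 - ‖inner ℂ Ω (toFock u)‖ ^ 2) ≤
    (inner ℂ (toFock u) (toFock (H u))).re - e * ‖toFock u‖ ^ 2
  sq_eq_one : σ * σ = 1
  parity : ∀ N, sgn N * Ω N = σ * Ω N
  approx : ∃ u : ℕ → FinVec Λ, Tendsto (fun n => toFock (u n)) atTop (𝓝 Ω) ∧
    Tendsto (fun n => toFock (H (u n))) atTop (𝓝 ((e : ℂ) • Ω)) ∧ ∀ n, par Λ (u n) = σ • u n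

/-- The parity image `Ω'` of `Ω` has the same energy because `H` is even. Inserting it into the gap
inequality gives `Δ (1 - |⟨Ω, Ω'⟩|²) ≤ 0`, so `Ω'` is a multiple `c` of `Ω`, and `c² = 1` since
parity is an involution. -/
theorem exists_gappedState (k : ℕ) (μ : Λ → ℝ) (f : (r : ℕ) → (Fin (2 * r) → Λ) → ℝ)
    (Ω : (hamiltonian k μ f).domain) (hΩ : IsGroundState (hamiltonian k μ f) Ω)
    (Δ : ℝ) (hΔ : 0 < Δ) (hgap : IsSpectralGap (hamiltonian k μ f) Ω Δ) :
    ∃ e σ, GappedState (hamEnd k μ f) (Ω : Fock Λ) e Δ σ := by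
  set H := hamEnd k μ f with hH
  have hsym := inner_hamEnd_left k μ f
  have hT : ∀ ψ χ : (hamiltonian k μ f).domain, inner ℂ (hamiltonian k μ f ψ) (χ : Fock Λ) =
      inner ℂ (ψ : Fock Λ) (hamiltonian k μ f χ) := closure_symmetric hsym
  set e := expect (hamiltonian k μ f) Ω with he
  have hle : onFock H ≤ hamiltonian k μ f := (onFock H).le_closure
  have hdom : ∀ u, toFock u ∈ (hamiltonian k μ f).domain := fun u => hle.1 ⟨u, rfl⟩
  have happ : ∀ u, hamiltonian k μ f ⟨toFock u, hdom u⟩ = toFock (H u) := fun u => by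
    rw [← onFock_apply u ⟨u, rfl⟩]
    exact (hle.2 rfl).symm
  have hground := inner_ground_apply hT hΩ
  have heigen : hamiltonian k μ f Ω = (e : ℂ) • (Ω : Fock Λ) := eq_of_inner_toFock fun u => by
    have := hground ⟨toFock u, hdom u⟩
    rw [inner_smul_left, Complex.conj_ofReal]
    exact this
  have h_eig : ∀ u, inner ℂ (Ω : Fock Λ) (toFock (H u)) = (e : ℂ) * inner ℂ (Ω : Fock Λ) (toFock u) := by
    intro u
    rw [← happ, ← hground ⟨toFock u, hdom u⟩]
    exact (hT Ω ⟨toFock u, hdom u⟩).symm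
  have h_gap : ∀ u, Δ * (‖toFock u‖ ^ 2 - ‖inner ℂ (Ω : Fock Λ) (toFock u)‖ ^ 2) ≤
      (inner ℂ (toFock u) (toFock (H u))).re - e * ‖toFock u‖ ^ 2 := fun u => by
    have := gap_le hT hΩ hgap ⟨toFock u, hdom u⟩
    rw [expect, happ] at this
    exact this
  obtain ⟨u, hu1, hu2⟩ := exists_seq_of_mem_domain hsym Ω
  have hu2' : Tendsto (fun n => toFock (H (u n))) atTop (𝓝 ((e : ℂ) • (Ω : Fock Λ))) := by
    rw [← heigen]; exact hu2
  have hcoord : ∀ {χ : ℕ → FinVec Λ} {ψ : Fock Λ}, Tendsto (fun n => toFock (χ n)) atTop (𝓝 ψ) →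
      ∀ N, Tendsto (fun n => χ n N) atTop (𝓝 (ψ N)) := by
    intro χ ψ h N
    have := (tendsto_const_nhds (x := mott N)).inner (𝕜 := ℂ) h
    simpa only [inner_mott_left, toFock_apply] using this
  have hlim : ∀ {χ : ℕ → FinVec Λ} {ψ : Fock Λ}, Tendsto (fun n => toFock (χ n)) atTop (𝓝 ψ) →
      ∃ ψ', Tendsto (fun n => toFock (par Λ (χ n))) atTop (𝓝 ψ') ∧ ∀ N, ψ' N = sgn N * ψ N := by
    intro χ ψ h
    have hc : CauchySeq fun n => toFock (par Λ (χ n)) := by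
      have := h.cauchySeq
      rw [Metric.cauchySeq_iff] at this ⊢
      intro ε hε
      obtain ⟨n, hn⟩ := this ε hε
      refine ⟨n, fun a ha b hb => ?_⟩
      have h1 := hn a ha b hb
      rw [dist_eq_norm, ← map_sub] at h1 ⊢
      rw [← map_sub, norm_toFock_par]
      exact h1
    obtain ⟨ψ', hψ'⟩ := cauchySeq_tendsto_of_complete hc
    refine ⟨ψ', hψ', fun N => ?_⟩
    refine tendsto_nhds_unique (hcoord hψ' N) (((hcoord h N).const_mul (sgn N)).congr fun n => ?_)
    rw [par, diag_apply]
  obtain ⟨Ω', hΩ', hΩN⟩ := hlim hu1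
  obtain ⟨χ', hχ', hχN⟩ := hlim hu2'
  have hχ : χ' = (e : ℂ) • Ω' := by
    ext N
    rw [hχN, lp.coeFn_smul, lp.coeFn_smul, Pi.smul_apply, Pi.smul_apply, hΩN, smul_eq_mul,
      smul_eq_mul]
    ring
  have hn' : ‖Ω'‖ = 1 := by
    have h1 := hΩ'.norm
    simp_rw [norm_toFock_par] at h1
    exact (tendsto_nhds_unique h1 hu1.norm).trans hΩ.1
  have hbound : Δ * (1 - ‖inner ℂ (Ω : Fock Λ) Ω'‖ ^ 2) ≤ 0 := by
    have h1 := (((hΩ'.norm.pow 2).sub (((tendsto_const_nhds (x := (Ω : Fock Λ))).inner (𝕜 := ℂ)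
      hΩ').norm.pow 2)).const_mul Δ)
    have h2 := ((Complex.continuous_re.tendsto _).comp (hΩ'.inner (𝕜 := ℂ) hχ')).sub
      ((hΩ'.norm.pow 2).const_mul e)
    have h3 := le_of_tendsto_of_tendsto' h1 h2 fun n => by
      have := h_gap (par Λ (u n))
      rw [hH, ← par_hamEnd] at this
      exact this
    rw [hn', hχ, inner_smul_right, inner_self_eq_norm_sq_to_K, hn'] at h3
    simpa using h3
  set c := inner ℂ (Ω : Fock Λ) Ω' with hc
  have hc1 : 1 ≤ ‖c‖ ^ 2 := by
    by_contra h
    have : 0 < Δ * (1 - ‖c‖ ^ 2) := mul_pos hΔ (by linarith)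
    linarith
  have hΩc : Ω' = c • (Ω : Fock Λ) := by
    rw [← sub_eq_zero, ← norm_eq_zero]
    have h1 : ‖Ω' - c • (Ω : Fock Λ)‖ ^ 2 = 1 - ‖c‖ ^ 2 := by
      rw [@norm_sub_sq ℂ, hn', norm_smul, hΩ.1, inner_smul_right, ← inner_conj_symm, ← hc,
        Complex.mul_conj, Complex.normSq_eq_norm_sq]
      simp only [RCLike.re_to_complex, Complex.ofReal_re]
      ring
    have h2 : ‖Ω' - c • (Ω : Fock Λ)‖ ^ 2 = 0 := le_antisymm (by linarith) (sq_nonneg _)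
    exact pow_eq_zero_iff two_ne_zero |>.1 h2
  have hpar : ∀ N, sgn N * (Ω : Fock Λ) N = c * (Ω : Fock Λ) N := fun N => by
    rw [← hΩN, hΩc]; rfl
  have hcc : c * c = 1 := by
    obtain ⟨N, hN⟩ : ∃ N, (Ω : Fock Λ) N ≠ 0 := by
      by_contra! h
      have h0 : (Ω : Fock Λ) = 0 := by ext N; simpa using h N
      have := hΩ.1
      rw [h0, norm_zero] at this
      exact zero_ne_one this
    rw [← mul_right_cancel₀ hN (hpar N), sgn_mul_self]
  -- The approximants are projected onto the parity sector of `Ω`, so that parity arguments are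
  -- exact before the limit is taken.
  refine ⟨e, c, hΩ.1, h_eig, h_gap, hcc, hpar,
    fun n => (1 / 2 : ℂ) • (u n + c • par Λ (u n)), ?_, ?_, fun n => ?_⟩
  · have h1 := (hu1.add (hΩ'.const_smul c)).const_smul (1 / 2 : ℂ)
    have h2 : (1 / 2 : ℂ) • ((Ω : Fock Λ) + c • Ω') = Ω := by
      rw [hΩc, smul_smul, hcc, one_smul, ← two_smul ℂ, smul_smul]; norm_num
    rw [h2] at h1
    simpa only [map_smul, map_add] using h1
  · have h1 := (hu2'.add (hχ'.const_smul c)).const_smul (1 / 2 : ℂ)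
    have h2 : (1 / 2 : ℂ) • ((e : ℂ) • (Ω : Fock Λ) + c • χ') = (e : ℂ) • (Ω : Fock Λ) := by
      rw [hχ, hΩc, smul_comm c, smul_smul c c, hcc, one_smul, ← two_smul ℂ, smul_smul]; norm_num
    rw [h2] at h1
    refine h1.congr fun n => ?_
    rw [hH, map_smul, map_add, map_smul, map_smul, map_add, map_smul, ← par_hamEnd]
  · rw [map_smul, map_add, map_smul, par_par, smul_comm c, smul_add c, smul_smul c c, hcc,
      one_smul, add_comm]

end gapped

/-! ### Coordinates and derivatives on Schwartz functions. -/

section schwartz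
open MeasureTheory SchwartzMap LineDeriv
open scoped ContDiff
variable [Fintype Λ] [DecidableEq Λ]

/-- The space of field values. -/
abbrev Pos (Λ : Type*) : Type _ := EuclideanSpace ℝ Λ

/-- Schwartz functions of the field. -/
abbrev Sch (Λ : Type*) [Fintype Λ] : Type _ := 𝓢(Pos Λ, ℂ)

/-- Multiplication by a real function of temperate growth. -/
def mulS (g : Pos Λ → ℝ) : Sch Λ →ₗ[ℂ] Sch Λ :=
  (smulLeftCLM ℂ fun x => (g x : ℂ)).toLinearMap

omit [DecidableEq Λ] in
theorem mulS_apply {g : Pos Λ → ℝ} (hg : g.HasTemperateGrowth) (f : Sch Λ) (x : Pos Λ) :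
    mulS g f x = g x * f x := by
  have h : (fun x => (g x : ℂ)).HasTemperateGrowth := by fun_prop
  change smulLeftCLM ℂ (fun x => (g x : ℂ)) f x = _
  rw [smulLeftCLM_apply_apply h, smul_eq_mul]

/-- The unit vector of a site. -/
def ev (i : Λ) : Pos Λ := EuclideanSpace.single i (1 : ℝ)

/-- The partial derivatives. -/
def dS (i : Λ) : Sch Λ →ₗ[ℂ] Sch Λ := (lineDerivOpCLM ℂ (Sch Λ) (ev i)).toLinearMap

theorem dS_apply (i : Λ) (f : Sch Λ) (x : Pos Λ) : dS i f x = fderiv ℝ f x (ev i) := rfl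

omit [DecidableEq Λ] in
theorem hasTemperateGrowth_coord (i : Λ) : (fun x : Pos Λ => x i).HasTemperateGrowth :=
  (EuclideanSpace.proj (𝕜 := ℝ) i).hasTemperateGrowth

/-- Multiplication by a coordinate. -/
def xS (i : Λ) : Sch Λ →ₗ[ℂ] Sch Λ := mulS fun x => x i

omit [DecidableEq Λ] in
theorem xS_apply (i : Λ) (f : Sch Λ) (x : Pos Λ) : xS i f x = x i * f x :=
  mulS_apply (hasTemperateGrowth_coord i) f x

theorem dS_mulS {g g' : Pos Λ → ℝ} (hg : g.HasTemperateGrowth) (hg' : g'.HasTemperateGrowth)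
    (i : Λ) (h : ∀ x, fderiv ℝ g x (ev i) = g' x) (f : Sch Λ) :
    dS i (mulS g f) = mulS g (dS i f) + mulS g' f := by
  ext x
  have h0 : (mulS g f : Pos Λ → ℂ) = fun x => g x • f x := by
    funext y; rw [mulS_apply hg]; simp
  have hd : DifferentiableAt ℝ g x := (hg.1.differentiable (by simp)) x
  rw [dS_apply, h0, fderiv_fun_smul hd f.differentiableAt]
  change _ = mulS g (dS i f) x + mulS g' f x
  rw [mulS_apply hg, mulS_apply hg', dS_apply, ← h]
  simp

theorem fderiv_coord (i j : Λ) (x : Pos Λ) :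
    fderiv ℝ (fun x : Pos Λ => x j) x (ev i) = if i = j then 1 else 0 := by
  have : (fun x : Pos Λ => x j) = (EuclideanSpace.proj (𝕜 := ℝ) j : Pos Λ → ℝ) := rfl
  rw [this, ContinuousLinearMap.fderiv]
  simp [ev, eq_comm]

theorem dS_xS (i j : Λ) (f : Sch Λ) :
    dS i (xS j f) = xS j (dS i f) + if i = j then f else 0 := by
  rw [xS, dS_mulS (hasTemperateGrowth_coord j) (.const (if i = j then 1 else 0)) i
    (fderiv_coord i j)]
  congr 1
  ext x
  rw [mulS_apply (.const _)]
  split_ifs <;> simp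

omit [DecidableEq Λ] in
theorem xS_comm (i j : Λ) (f : Sch Λ) : xS i (xS j f) = xS j (xS i f) := by
  ext x
  simp only [xS_apply]
  ring

theorem dS_comm (i j : Λ) (f : Sch Λ) : dS i (dS j f) = dS j (dS i f) := by
  ext x
  have key : ∀ i j : Λ, dS i (dS j f) x = fderiv ℝ (fderiv ℝ f) x (ev i) (ev j) := by
    intro i j
    have h0 : (dS j f : Pos Λ → ℂ) = fun y => fderiv ℝ f y (ev j) := rfl
    have hd : DifferentiableAt ℝ (fderiv ℝ f) x :=
      ((f.smooth 2).fderiv_right (m := 1) le_rfl).differentiable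
        (by simp) x
    rw [dS_apply, h0, fderiv_clm_apply hd (differentiableAt_const _)]
    simp
  rw [key, key]
  exact second_derivative_symmetric (f := f) (f' := fderiv ℝ f)
    (fun y => f.differentiableAt.hasFDerivAt)
    (((f.smooth 2).fderiv_right (m := 1) le_rfl).differentiable
        (by simp) x).hasFDerivAt _ _

/-- The embedding of the Schwartz space into `L²`. -/
def toL2 : Sch Λ →ₗ[ℂ] Lp ℂ 2 (volume : Measure (Pos Λ)) :=
  (toLpCLM ℂ ℂ 2 (volume : Measure (Pos Λ))).toLinearMap

omit [DecidableEq Λ] in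
theorem toL2_ae (f : Sch Λ) : toL2 f =ᵐ[volume] f := f.coeFn_toLp 2 volume

omit [DecidableEq Λ] in
theorem inner_toL2 (f g : Sch Λ) :
    inner ℂ (toL2 f) (toL2 g) = ∫ x, (starRingEnd ℂ) (f x) * g x := by
  refine (inner_toL2_toL2_eq f g volume).trans (integral_congr_ae (.of_forall fun x => ?_))
  simp [mul_comm]

omit [DecidableEq Λ] in
theorem inner_mulS_left {g : Pos Λ → ℝ} (hg : g.HasTemperateGrowth) (f f' : Sch Λ) :
    inner ℂ (toL2 (mulS g f)) (toL2 f') = inner ℂ (toL2 f) (toL2 (mulS g f')) := by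
  rw [inner_toL2, inner_toL2]
  refine integral_congr_ae (.of_forall fun x => ?_)
  simp only [mulS_apply hg, map_mul, Complex.conj_ofReal]
  ring

theorem inner_dS_left (i : Λ) (f f' : Sch Λ) :
    inner ℂ (toL2 (dS i f)) (toL2 f') = -inner ℂ (toL2 f) (toL2 (dS i f')) := by
  rw [inner_toL2, inner_toL2]
  have := integral_bilinear_lineDerivOp_right_eq_neg_left (μ := volume) f f'
    ((ContinuousLinearMap.mul ℝ ℂ).comp Complex.conjCLE.toContinuousLinearMap) (ev i)
  simp only [ContinuousLinearMap.comp_apply, ContinuousLinearMap.mul_apply'] at this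
  rw [eq_neg_iff_add_eq_zero, add_comm, ← eq_neg_iff_add_eq_zero]
  exact this

end schwartz

/-! ### The Gaussian vacuum. -/

section gauss
open MeasureTheory SchwartzMap
open scoped ContDiff
variable [Fintype Λ]

/-- The derivatives of the exponent grow polynomially, so the composition bound gives a polynomial
times the Gaussian itself, which beats any power of the norm. -/
theorem iteratedFDeriv_gauss_le {F : Type*} [NormedAddCommGroup F] [InnerProductSpace ℝ F]
    (k n : ℕ) : ∃ C : ℝ, ∀ x : F,
      ‖x‖ ^ k * ‖iteratedFDeriv ℝ n (fun y : F => Real.exp (-(‖y‖ ^ 2 / 2))) x‖ ≤ C := by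
  have hT : (fun x : F => -(‖x‖ ^ 2 / 2)).HasTemperateGrowth := by
    have h1 := (Function.HasTemperateGrowth.const (E := F) (-(1 / 2 : ℝ))).mul
      (Function.hasTemperateGrowth_norm_sq F)
    have h2 : (fun x : F => -(‖x‖ ^ 2 / 2)) = fun x : F => -(1 / 2 : ℝ) * ‖x‖ ^ 2 := by
      funext x; ring
    rw [h2]; exact h1
  obtain ⟨p, B, hB, hb⟩ := hT.norm_iteratedFDeriv_le_uniform n
  have hlim : Filter.Tendsto (fun r : ℝ => r ^ (k + p * n) * Real.exp (-r)) Filter.atTop (nhds 0) :=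
    Real.tendsto_pow_mul_exp_neg_atTop_nhds_zero _
  obtain ⟨M, hM⟩ : ∃ M : ℝ, ∀ r : ℝ, 0 ≤ r →
      (1 + r) ^ (k + p * n) * Real.exp (-(r ^ 2 / 2)) ≤ M := by
    obtain ⟨R, hR⟩ := Filter.eventually_atTop.1 (hlim.eventually (ge_mem_nhds zero_lt_one))
    refine ⟨max ((1 + |R|) ^ (k + p * n)) (Real.exp 2), fun r hr => ?_⟩
    rcases le_total (1 + r) (1 + |R|) with h | h
    · refine le_max_of_le_left ?_
      calc _ ≤ (1 + |R|) ^ (k + p * n) * 1 := by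
            gcongr
            rw [Real.exp_le_one_iff]; nlinarith
        _ = _ := mul_one _
    · refine le_max_of_le_right ?_
      have h1 := hR (1 + r) (by have := le_abs_self R; linarith)
      have h2 : Real.exp (-(r ^ 2 / 2)) ≤ Real.exp 2 * Real.exp (-(1 + r)) := by
        rw [← Real.exp_add, Real.exp_le_exp]
        nlinarith [sq_nonneg (r - 1)]
      calc _ ≤ (1 + r) ^ (k + p * n) * (Real.exp 2 * Real.exp (-(1 + r))) := by gcongr
        _ = Real.exp 2 * ((1 + r) ^ (k + p * n) * Real.exp (-(1 + r))) := by ring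
        _ ≤ Real.exp 2 * 1 := by gcongr
        _ = _ := mul_one _
  refine ⟨n.factorial * (1 + B) ^ n * M, fun x => ?_⟩
  have hc := norm_iteratedFDeriv_comp_le (n := n) (N := ∞) Real.contDiff_exp
    (f := fun x : F => -(‖x‖ ^ 2 / 2)) hT.1 (by exact_mod_cast le_top) x
    (C := Real.exp (-(‖x‖ ^ 2 / 2))) (D := (1 + B) * (1 + ‖x‖) ^ p) (fun i _ => by
      rw [norm_iteratedFDeriv_eq_norm_iteratedDeriv, iteratedDeriv_eq_iterate, Real.iter_deriv_exp,
        Real.norm_of_nonneg (Real.exp_pos _).le]) (fun i hi hin => by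
      refine (hb i hin x).trans ?_
      have h1 : 1 ≤ (1 + B) * (1 + ‖x‖) ^ p := by
        have : 1 ≤ (1 + ‖x‖) ^ p := one_le_pow₀ (by linarith [norm_nonneg x])
        nlinarith
      calc B * (1 + ‖x‖) ^ p ≤ (1 + B) * (1 + ‖x‖) ^ p := by gcongr; linarith
        _ ≤ _ := le_self_pow₀ h1 (by omega))
  have hx : ‖x‖ ^ k ≤ (1 + ‖x‖) ^ k := by gcongr; linarith
  calc _ ≤ (1 + ‖x‖) ^ k * (n.factorial * Real.exp (-(‖x‖ ^ 2 / 2)) *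
        ((1 + B) * (1 + ‖x‖) ^ p) ^ n) := mul_le_mul hx hc (norm_nonneg _) (by positivity)
    _ = n.factorial * (1 + B) ^ n * ((1 + ‖x‖) ^ (k + p * n) * Real.exp (-(‖x‖ ^ 2 / 2))) := by
        rw [mul_pow, ← pow_mul, pow_add]; ring
    _ ≤ _ := by gcongr; exact hM _ (norm_nonneg x)

/-- The real Gaussian as a Schwartz function. -/
def gaussR (Λ : Type*) [Fintype Λ] : 𝓢(Pos Λ, ℝ) where
  toFun x := Real.exp (-(‖x‖ ^ 2 / 2))
  smooth' := by
    have : ContDiff ℝ ∞ fun x : Pos Λ => ‖x‖ ^ 2 := contDiff_norm_sq ℝ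
    fun_prop
  decay' := iteratedFDeriv_gauss_le

/-- The normalising constant of the vacuum. -/
def gaussC (Λ : Type*) [Fintype Λ] : ℝ := (Real.pi ^ ((Fintype.card Λ : ℝ) / 2)) ^ (-(1 / 2) : ℝ)

/-- The vacuum wave function. -/
def gauss (Λ : Type*) [Fintype Λ] : Sch Λ :=
  (gaussC Λ : ℂ) • postcompCLM (𝕜 := ℝ) Complex.ofRealCLM (gaussR Λ)

theorem gaussC_pos : 0 < gaussC Λ := by unfold gaussC; positivity

theorem gauss_apply (x : Pos Λ) : gauss Λ x = ((gaussC Λ * Real.exp (-(‖x‖ ^ 2 / 2)) : ℝ) : ℂ) := by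
  change (gaussC Λ : ℂ) • ((Real.exp (-(‖x‖ ^ 2 / 2)) : ℝ) : ℂ) = _
  rw [smul_eq_mul, Complex.ofReal_mul]

theorem norm_toL2_gauss : inner ℂ (toL2 (gauss Λ)) (toL2 (gauss Λ)) = 1 := by
  rw [inner_toL2]
  have h : ∀ x : Pos Λ, (starRingEnd ℂ) (gauss Λ x) * gauss Λ x =
      ((gaussC Λ ^ 2 * Real.exp (-1 * ‖x‖ ^ 2) : ℝ) : ℂ) := fun x => by
    rw [gauss_apply, Complex.conj_ofReal, ← Complex.ofReal_mul]
    congr 1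
    rw [mul_mul_mul_comm, ← Real.exp_add]
    ring_nf
  simp_rw [h]
  rw [integral_complex_ofReal, integral_const_mul,
    GaussianFourier.integral_rexp_neg_mul_sq_norm (by norm_num)]
  have h2 : (0 : ℝ) < Real.pi ^ ((Fintype.card Λ : ℝ) / 2) := by positivity
  rw [gaussC, finrank_euclideanSpace, div_one, ← Real.rpow_natCast, ← Real.rpow_mul h2.le]
  norm_num
  rw [Real.rpow_neg_one]
  exact_mod_cast inv_mul_cancel₀ h2.ne'

variable [DecidableEq Λ]

theorem dS_gauss (i : Λ) : dS i (gauss Λ) = -xS i (gauss Λ) := by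
  ext x
  have h0 : (gauss Λ : Pos Λ → ℂ) = fun x => ((gaussC Λ * Real.exp (-(‖x‖ ^ 2 / 2)) : ℝ) : ℂ) :=
    funext gauss_apply
  have h2 := (hasStrictFDerivAt_norm_sq x).hasFDerivAt
  have h1 := Complex.ofRealCLM.hasFDerivAt.comp x
    ((h2.const_mul (1 / 2 : ℝ)).neg.exp.const_mul (gaussC Λ))
  have h4 : ∀ y : Pos Λ, -(1 / 2 * ‖y‖ ^ 2) = -(‖y‖ ^ 2 / 2) := fun y => by ring
  simp only [Pi.neg_apply, h4, Function.comp_def, Complex.ofRealCLM_apply] at h1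
  change _ = -xS i (gauss Λ) x
  rw [dS_apply, xS_apply, gauss_apply, h0, h1.fderiv]
  simp [ev, EuclideanSpace.inner_single_right]
  ring

end gauss

/-! ### Hermite functions and the Schrödinger representation. -/

section rep
open MeasureTheory SchwartzMap
variable [Fintype Λ] [DecidableEq Λ]

theorem mul_pow_of_ccr {R : Type*} [Ring R] {a c : R} (h : a * c = c * a + 1) (n : ℕ) :
    a * c ^ n = c ^ n * a + n * c ^ (n - 1) := by
  induction n with
  | zero => simp
  | succ n ih =>
    rw [pow_succ', ← mul_assoc, h, add_mul, one_mul, mul_assoc, ih, mul_add, ← mul_assoc,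
      Nat.add_sub_cancel, (Nat.cast_commute n c).symm.left_comm]
    rcases n with _ | n
    · simp
    · simp only [Nat.add_sub_cancel, ← pow_succ']
      push_cast
      noncomm_ring

/-- The creation operator on Schwartz functions. -/
def crS (i : Λ) : Module.End ℂ (Sch Λ) := ((Real.sqrt 2 : ℝ) : ℂ)⁻¹ • (xS i - dS i)

/-- The annihilation operator on Schwartz functions. -/
def anS (i : Λ) : Module.End ℂ (Sch Λ) := ((Real.sqrt 2 : ℝ) : ℂ)⁻¹ • (xS i + dS i)

theorem dS_mul_xS (i j : Λ) :
    (dS i : Module.End ℂ (Sch Λ)) * xS j = xS j * dS i + if i = j then 1 else 0 := by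
  refine LinearMap.ext fun f => ?_
  change dS i (xS j f) = xS j (dS i f) + (if i = j then 1 else 0 : Module.End ℂ (Sch Λ)) f
  rw [dS_xS]
  split_ifs <;> rfl

omit [DecidableEq Λ] in
theorem xS_mul_comm (i j : Λ) : (xS i : Module.End ℂ (Sch Λ)) * xS j = xS j * xS i :=
  LinearMap.ext fun f => xS_comm i j f

theorem dS_mul_comm (i j : Λ) : (dS i : Module.End ℂ (Sch Λ)) * dS j = dS j * dS i :=
  LinearMap.ext fun f => dS_comm i j f

section ring
variable {R : Type*} [Ring R] [Algebra ℂ R] {x d y e z : R} (t : ℂ)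

theorem smul_sub_comm_of_ccr' (h1 : d * y = y * d + z) (h2 : e * x = x * e + z)
    (hx : x * y = y * x) (hd : d * e = e * d) :
    (t • (x - d)) * (t • (y - e)) = (t • (y - e)) * (t • (x - d)) := by
  rw [smul_mul_smul_comm, smul_mul_smul_comm]
  congr 1
  simp only [sub_mul, mul_sub, h1, h2, hx, hd]
  abel

theorem smul_add_mul_smul_sub_of_ccr (ht : t * t = 1 / 2) (h1 : d * y = y * d + z)
    (h2 : e * x = x * e + z) (hx : x * y = y * x) (hd : d * e = e * d) :
    (t • (x + d)) * (t • (y - e)) = (t • (y - e)) * (t • (x + d)) + z := by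
  have hz : z = (t * t) • (z + z) := by
    rw [ht, ← two_smul ℂ, smul_smul]; norm_num
  conv_rhs => rw [hz]
  rw [smul_mul_smul_comm, smul_mul_smul_comm, ← smul_add]
  congr 1
  simp only [sub_mul, mul_sub, add_mul, mul_add, h1, h2, hx, hd]
  abel

end ring

theorem dS_mul_xS' (i j : Λ) :
    (dS j : Module.End ℂ (Sch Λ)) * xS i = xS i * dS j + if i = j then 1 else 0 := by
  rw [dS_mul_xS]
  simp [eq_comm]

theorem crS_mul_comm (i j : Λ) : crS i * crS j = crS j * crS i :=
  smul_sub_comm_of_ccr' (R := Module.End ℂ (Sch Λ)) _ (dS_mul_xS i j) (dS_mul_xS' i j)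
    (xS_mul_comm i j) (dS_mul_comm i j)

theorem anS_mul_crS (i j : Λ) : anS i * crS j = crS j * anS i + if i = j then 1 else 0 :=
  smul_add_mul_smul_sub_of_ccr (R := Module.End ℂ (Sch Λ)) _ sqrt_two_inv_mul_self (dS_mul_xS i j)
    (dS_mul_xS' i j) (xS_mul_comm i j) (dS_mul_comm i j)

theorem xS_eq (i : Λ) : xS i = ((Real.sqrt 2 : ℝ) : ℂ)⁻¹ • (anS i + crS i) :=
  eq_smul_add_of_sq (R := Module.End ℂ (Sch Λ)) _ sqrt_two_inv_mul_self

theorem dS_eq (i : Λ) : dS i = ((Real.sqrt 2 : ℝ) : ℂ)⁻¹ • (anS i - crS i) :=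
  eq_smul_sub_of_sq (R := Module.End ℂ (Sch Λ)) _ sqrt_two_inv_mul_self

theorem crS_apply (i : Λ) (f : Sch Λ) :
    crS i f = ((Real.sqrt 2 : ℝ) : ℂ)⁻¹ • (xS i f - dS i f) := rfl

theorem anS_apply (i : Λ) (f : Sch Λ) :
    anS i f = ((Real.sqrt 2 : ℝ) : ℂ)⁻¹ • (xS i f + dS i f) := rfl

theorem crS_apply_apply (i : Λ) (f : Sch Λ) (x : Pos Λ) :
    crS i f x = ((Real.sqrt 2 : ℝ) : ℂ)⁻¹ * (x i * f x - dS i f x) := by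
  rw [← xS_apply]; rfl

theorem anS_gauss (i : Λ) : anS i (gauss Λ) = 0 := by
  rw [anS_apply, dS_gauss, add_neg_cancel, smul_zero]

omit [DecidableEq Λ] in
theorem inner_xS_left (i : Λ) (f g : Sch Λ) :
    inner ℂ (toL2 (xS i f)) (toL2 g) = inner ℂ (toL2 f) (toL2 (xS i g)) :=
  inner_mulS_left (hasTemperateGrowth_coord i) f g

theorem inner_crS_left (i : Λ) (f g : Sch Λ) :
    inner ℂ (toL2 (crS i f)) (toL2 g) = inner ℂ (toL2 f) (toL2 (anS i g)) := by
  rw [crS_apply, anS_apply]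
  simp only [map_smul, map_add, map_sub, inner_smul_left, inner_smul_right, inner_sub_left,
    inner_add_right, inner_xS_left, inner_dS_left]
  simp

theorem crS_pow_commute (N : Config Λ) : (↑(Finset.univ : Finset Λ) : Set Λ).Pairwise
    (Function.onFun Commute fun i => crS i ^ N i) :=
  fun i _ j _ _ => Commute.pow_pow (crS_mul_comm i j) _ _

/-- The product `∏ cr_i ^ N_i`. -/
def crP (N : Config Λ) : Module.End ℂ (Sch Λ) :=
  Finset.univ.noncommProd (fun i => crS i ^ N i) (crS_pow_commute N)

theorem crP_eq (N : Config Λ) (i : Λ) (n : ℕ) : crP (Function.update N i n) = crS i ^ n *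
    (Finset.univ.erase i).noncommProd (fun i => crS i ^ N i)
      ((crS_pow_commute N).mono (by simp)) := by
  rw [crP, ← Finset.mul_noncommProd_erase _ (Finset.mem_univ i), Function.update_self]
  congr 1
  refine Finset.noncommProd_congr rfl (fun j hj => ?_) _
  rw [Function.update_of_ne (Finset.ne_of_mem_erase hj)]

theorem crS_mul_crP (i : Λ) (N : Config Λ) :
    crS i * crP N = crP (Function.update N i (N i + 1)) := by
  conv_lhs => rw [← Function.update_eq_self i N, crP_eq]
  rw [crP_eq, pow_succ', mul_assoc]

theorem anS_mul_crP (i : Λ) (N : Config Λ) :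
    anS i * crP N = crP N * anS i + (N i : Module.End ℂ (Sch Λ)) *
      crP (Function.update N i (N i - 1)) := by
  conv_lhs => rw [← Function.update_eq_self i N, crP_eq]
  conv_rhs => rw [← Function.update_eq_self i N, crP_eq]
  have h1 : anS i * crS i = crS i * anS i + 1 := by simpa using anS_mul_crS i i
  have h2 := Finset.noncommProd_commute (Finset.univ.erase i) (fun i => crS i ^ N i)
    ((crS_pow_commute N).mono (by simp)) (anS i) (fun j hj => by
      have : anS i * crS j = crS j * anS i := by
        have := anS_mul_crS i j
        rwa [if_neg (Finset.ne_of_mem_erase hj).symm, add_zero] at this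
      exact Commute.pow_right this _)
  simp only [Function.update_self, Function.update_idem, crP_eq]
  rw [← mul_assoc, mul_pow_of_ccr h1, add_mul, mul_assoc, h2.eq, mul_assoc, mul_assoc]

/-- The normalisation of the `N`-th Hermite function. -/
def herC (N : Config Λ) : ℝ := ∏ i, Real.sqrt (N i).factorial

omit [DecidableEq Λ] in
theorem herC_pos (N : Config Λ) : 0 < herC N :=
  Finset.prod_pos fun i _ => Real.sqrt_pos.2 (by exact_mod_cast Nat.factorial_pos _)

theorem herC_update (N : Config Λ) (i : Λ) :
    herC (Function.update N i (N i + 1)) = Real.sqrt (N i + 1) * herC N := by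
  rw [herC, herC, ← Finset.mul_prod_erase _ _ (Finset.mem_univ i),
    ← Finset.mul_prod_erase _ _ (Finset.mem_univ i), Function.update_self, Nat.factorial_succ,
    Nat.cast_mul, Real.sqrt_mul (by positivity), ← mul_assoc]
  push_cast
  congr 1
  refine Finset.prod_congr rfl fun j hj => ?_
  rw [Function.update_of_ne (Finset.ne_of_mem_erase hj)]

/-- The Hermite functions. -/
def her (N : Config Λ) : Sch Λ := ((herC N)⁻¹ : ℂ) • crP N (gauss Λ)

theorem her_zero : her (0 : Config Λ) = gauss Λ := by
  have : crP (0 : Config Λ) = 1 := by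
    rw [crP, Finset.noncommProd_eq_pow_card _ _ _ 1 (by simp)]; simp
  rw [her, this, herC]
  simp

theorem crS_her (i : Λ) (N : Config Λ) :
    crS i (her N) = ((Real.sqrt (N i + 1) : ℝ) : ℂ) • her (Function.update N i (N i + 1)) := by
  have h : crS i (crP N (gauss Λ)) = crP (Function.update N i (N i + 1)) (gauss Λ) :=
    LinearMap.congr_fun (crS_mul_crP i N) _
  rw [her, map_smul, h, her, smul_smul, herC_update]
  congr 1
  have h1 : ((Real.sqrt (N i + 1) : ℝ) : ℂ) ≠ 0 := by
    exact_mod_cast (Real.sqrt_pos.2 (by positivity : (0 : ℝ) < N i + 1)).ne'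
  have h2 : (herC N : ℂ) ≠ 0 := by exact_mod_cast (herC_pos N).ne'
  push_cast
  field_simp

theorem anS_her (i : Λ) (N : Config Λ) :
    anS i (her N) = ((Real.sqrt (N i) : ℝ) : ℂ) • her (Function.update N i (N i - 1)) := by
  have h : anS i (crP N (gauss Λ)) =
      (N i : ℂ) • crP (Function.update N i (N i - 1)) (gauss Λ) := by
    refine (LinearMap.congr_fun (anS_mul_crP i N) _).trans ?_
    rw [LinearMap.add_apply, Module.End.mul_apply, anS_gauss, map_zero, zero_add,
      Module.End.mul_apply, Module.End.natCast_apply, Nat.cast_smul_eq_nsmul]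
  rw [her, map_smul, h, her, smul_smul, smul_smul]
  rcases Nat.eq_zero_or_pos (N i) with h0 | h0
  · simp [h0]
  congr 1
  have h3 := herC_update (Function.update N i (N i - 1)) i
  rw [Function.update_self, Function.update_idem, Nat.sub_add_cancel h0, Function.update_eq_self,
    Nat.cast_sub h0] at h3
  have h4 : ((N i : ℝ) - (1 : ℕ)) + 1 = N i := by simp
  rw [h4] at h3
  have h1 : ((Real.sqrt (N i) : ℝ) : ℂ) ≠ 0 := by
    exact_mod_cast (Real.sqrt_pos.2 (by positivity : (0 : ℝ) < N i)).ne'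
  have h2 : (herC (Function.update N i (N i - 1)) : ℂ) ≠ 0 := by exact_mod_cast (herC_pos _).ne'
  have h5 : (N i : ℂ) = ((Real.sqrt (N i) : ℝ) : ℂ) * ((Real.sqrt (N i) : ℝ) : ℂ) := by
    rw [← Complex.ofReal_mul, Real.mul_self_sqrt (by positivity)]; simp
  rw [h3, h5]
  push_cast
  field_simp

/-- The Schrödinger representation of the finite vectors. -/
def toSch : FinVec Λ →ₗ[ℂ] Sch Λ := Finsupp.linearCombination ℂ her

theorem toSch_single (N : Config Λ) (c : ℂ) : toSch (Finsupp.single N c) = c • her N := by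
  rw [toSch, Finsupp.linearCombination_single]

theorem toSch_cre (i : Λ) (u : FinVec Λ) : toSch (cre i u) = crS i (toSch u) := by
  induction u using Finsupp.induction_linear with
  | zero => simp
  | add u v hu hv => simp [map_add, hu, hv]
  | single N c =>
    rw [cre_single, toSch_single, toSch_single, map_smul, crS_her, smul_smul]

theorem toSch_ann (i : Λ) (u : FinVec Λ) : toSch (ann i u) = anS i (toSch u) := by
  induction u using Finsupp.induction_linear with
  | zero => simp
  | add u v hu hv => simp [map_add, hu, hv]
  | single N c =>
    rw [ann_single, toSch_single, toSch_single, map_smul, anS_her, smul_smul]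

theorem toSch_phi (i : Λ) (u : FinVec Λ) : toSch (phi i u) = xS i (toSch u) := by
  rw [xS_eq, phi]
  simp only [LinearMap.smul_apply, LinearMap.add_apply, map_smul, map_add, toSch_ann, toSch_cre]

theorem toSch_der (i : Λ) (u : FinVec Λ) : toSch (der i u) = dS i (toSch u) := by
  rw [dS_eq, der]
  simp only [LinearMap.smul_apply, LinearMap.sub_apply, map_smul, map_sub, toSch_ann, toSch_cre]

/-- The vacuum is cyclic for the creation operators: a label with `N i ≠ 0` is reached from one with
a boson less, up to the nonzero factor `√(N i)`. -/
theorem cre_induction {p : FinVec Λ → Prop} (h0 : p (Finsupp.single 0 1))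
    (hadd : ∀ u v, p u → p v → p (u + v)) (hsmul : ∀ (c : ℂ) u, p u → p (c • u))
    (hcre : ∀ i u, p u → p (cre i u)) (u : FinVec Λ) : p u := by
  have key : ∀ (n : ℕ) (N : Config Λ), ∑ i, N i = n → p (Finsupp.single N 1) := by
    intro n
    induction n with
    | zero =>
      intro N hN
      have : N = 0 := funext fun i => (Finset.sum_eq_zero_iff.1 hN) i (Finset.mem_univ i)
      rwa [this]
    | succ n ih =>
      intro N hN
      obtain ⟨i, hi⟩ : ∃ i, N i ≠ 0 := by
        by_contra! h
        simp [h] at hN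
      have h1 := ih (Function.update N i (N i - 1)) (by
        have h3 := Finset.add_sum_erase Finset.univ (fun j => N j) (Finset.mem_univ i)
        rw [← Finset.add_sum_erase _ _ (Finset.mem_univ i)]
        rw [Function.update_self, Finset.sum_congr rfl (g := fun j => N j) (fun j hj => by
          rw [Function.update_of_ne (Finset.ne_of_mem_erase hj)])]
        omega)
      have h2 := hsmul (((Real.sqrt (N i) : ℝ) : ℂ)⁻¹) _ (hcre i _ h1)
      have h4 : (((N i - 1 : ℕ) : ℝ)) + 1 = N i := by
        rw [Nat.cast_sub (by omega)]; simp
      have h5 : ((Real.sqrt (N i) : ℝ) : ℂ) ≠ 0 := by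
        exact_mod_cast (Real.sqrt_pos.2 (by positivity : (0 : ℝ) < N i)).ne'
      rw [cre_single, Function.update_self, Function.update_idem, Nat.sub_add_cancel (by omega),
        Function.update_eq_self, h4, one_mul, Finsupp.smul_single, smul_eq_mul,
        inv_mul_cancel₀ h5] at h2
      exact h2
  induction u using Finsupp.induction_linear with
  | zero => simpa using hsmul 0 _ h0
  | add u v hu hv => exact hadd _ _ hu hv
  | single N c =>
    have := hsmul c _ (key _ N rfl)
    rwa [Finsupp.smul_single, smul_eq_mul, mul_one] at this

/-- Creation operators are moved across the inner product as annihilation operators until these kill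
the vacuum. The only integral needed is the normalisation of the Gaussian. -/
theorem inner_toSch (u v : FinVec Λ) :
    inner ℂ (toL2 (toSch u)) (toL2 (toSch v)) = inner ℂ (toFock u) (toFock v) := by
  have h0 : toSch (Finsupp.single (0 : Config Λ) 1) = gauss Λ := by
    rw [toSch_single, her_zero, one_smul]
  induction u using cre_induction generalizing v with
  | h0 =>
    induction v using cre_induction with
    | h0 => rw [h0, norm_toL2_gauss, inner_toFock_left]; simp [toFock_apply]
    | hadd u v hu hv => simp only [map_add, inner_add_right, hu, hv]
    | hsmul c u hu => simp only [map_smul, inner_smul_right, hu]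
    | hcre i u hu =>
      rw [← inner_conj_symm, toSch_cre, inner_crS_left, h0, anS_gauss, map_zero, inner_zero_right,
        ← inner_conj_symm, inner_cre_left, ann_single]
      simp
  | hadd u u' hu hu' => simp only [map_add, inner_add_left, hu, hu']
  | hsmul c u hu => simp only [map_smul, inner_smul_left, hu]
  | hcre i u hu => rw [toSch_cre, inner_crS_left, ← toSch_ann, hu, inner_cre_left]

/-- The vacuum is even, and each creation operator anticommutes with the parity of labels as well as
with reflection. -/
theorem toSch_par (u : FinVec Λ) (x : Pos Λ) : toSch (par Λ u) x = toSch u (-x) := by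
  induction u using cre_induction generalizing x with
  | h0 =>
    have : par Λ (Finsupp.single 0 1) = Finsupp.single 0 1 := by
      rw [par, diag_single]; simp [sgn]
    rw [this, toSch_single, her_zero, one_smul, gauss_apply, gauss_apply, norm_neg]
  | hadd u v hu hv =>
    rw [map_add, map_add, map_add]
    exact congrArg₂ (· + ·) (hu x) (hv x)
  | hsmul c u hu =>
    rw [map_smul, map_smul, map_smul]
    exact congrArg (c • ·) (hu x)
  | hcre i u hu =>
    have h1 : (toSch (par Λ u) : Pos Λ → ℂ) = fun x => toSch u (-x) := funext hu
    have h2 : dS i (toSch (par Λ u)) x = -dS i (toSch u) (-x) := by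
      have h3 := (toSch u).differentiableAt (x := -x) |>.hasFDerivAt.comp x
        ((hasFDerivAt_id (𝕜 := ℝ) x).neg)
      rw [dS_apply, dS_apply, h1]
      have h4 := congrArg (fun T => T (ev i)) h3.fderiv
      simp only [ContinuousLinearMap.comp_apply, _root_.neg_apply, map_neg] at h4
      exact h4
    rw [par_cre, map_neg, toSch_cre, toSch_cre]
    change -(crS i (toSch (par Λ u)) x) = _
    rw [crS_apply_apply, crS_apply_apply, h2, hu, ← mul_neg]
    congr 1
    simp
    ring

end rep

/-! ### Uniqueness from moments via the Fourier transform. -/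

section moments
open MeasureTheory FourierTransform
variable {E : Type*} [NormedAddCommGroup E] [InnerProductSpace ℝ E] [FiniteDimensional ℝ E]
  [MeasurableSpace E] [BorelSpace E]

theorem hasSum_integral_exp_mul {X : Type*} [MeasurableSpace X] {ν : Measure X} {z y : X → ℂ}
    {b : X → ℝ} (hz : AEStronglyMeasurable z ν) (hy : AEStronglyMeasurable y ν)
    (hb : ∀ x, ‖z x‖ ≤ b x) (hi : Integrable (fun x => Real.exp (b x) * ‖y x‖) ν) :
    HasSum (fun n : ℕ => ∫ x, z x ^ n / (n.factorial : ℂ) * y x ∂ν)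
      (∫ x, Complex.exp (z x) * y x ∂ν) := by
  have hs : ∀ r c : ℝ, HasSum (fun n : ℕ => r ^ n / (n.factorial : ℝ) * c) (Real.exp r * c) := by
    intro r c
    have := NormedSpace.expSeries_div_hasSum_exp r
    rw [← Real.exp_eq_exp_ℝ] at this
    exact this.mul_right c
  have hsc : ∀ r c : ℂ, HasSum (fun n : ℕ => r ^ n / (n.factorial : ℂ) * c)
      (Complex.exp r * c) := by
    intro r c
    have := NormedSpace.expSeries_div_hasSum_exp r
    rw [← Complex.exp_eq_exp_ℂ] at this
    exact this.mul_right c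
  refine hasSum_integral_of_dominated_convergence
    (fun (n : ℕ) x => b x ^ n / (n.factorial : ℝ) * ‖y x‖) (fun n => ?_) (fun n => ?_) ?_ ?_ ?_
  · exact ((hz.pow n).mul_const _).mul hy
  · refine .of_forall fun x => ?_
    rw [norm_mul, norm_div, norm_pow, Complex.norm_natCast]
    have := hb x
    gcongr
  · exact .of_forall fun x => (hs (b x) ‖y x‖).summable
  · refine hi.congr (.of_forall fun x => ?_)
    exact (hs (b x) ‖y x‖).tsum_eq.symm
  · exact .of_forall fun x => hsc (z x) (y x)

/-- Integrability against every `exp (c ‖x‖)` permits expanding the Fourier kernel under the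
integral, and every term of the series is a vanishing moment. -/
theorem fourier_eq_zero_of_moments {w : E → ℂ} (hmeas : AEStronglyMeasurable w volume)
    (hw : ∀ c : ℝ, Integrable fun x => Real.exp (c * ‖x‖) * ‖w x‖)
    (hm : ∀ (t : E) (n : ℕ), ∫ x, ((inner ℝ x t : ℝ) : ℂ) ^ n * w x = 0) (t : E) :
    𝓕 w t = 0 := by
  have key := hasSum_integral_exp_mul (ν := (volume : Measure E))
    (z := fun x => ((-2 * Real.pi * inner ℝ x t : ℝ) : ℂ) * Complex.I) (y := w)
    (b := fun x => 2 * Real.pi * ‖t‖ * ‖x‖)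
    (Continuous.aestronglyMeasurable (by fun_prop)) hmeas (fun x => by
      rw [norm_mul, Complex.norm_I, mul_one, Complex.norm_real, norm_mul]
      have h1 := norm_inner_le_norm (𝕜 := ℝ) x t
      have h2 : ‖-2 * Real.pi‖ = 2 * Real.pi := by simp [abs_of_pos Real.pi_pos]
      rw [h2]
      calc _ ≤ 2 * Real.pi * (‖x‖ * ‖t‖) := by gcongr
        _ = _ := by ring) (hw _)
  have h0 : ∀ n : ℕ, ∫ x, (((-2 * Real.pi * inner ℝ x t : ℝ) : ℂ) * Complex.I) ^ n /
      (n.factorial : ℂ) * w x = 0 := fun n => by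
    have h1 : ∀ x, (((-2 * Real.pi * inner ℝ x t : ℝ) : ℂ) * Complex.I) ^ n /
        (n.factorial : ℂ) * w x = (((-2 * Real.pi : ℝ) : ℂ) * Complex.I) ^ n / (n.factorial : ℂ) *
        (((inner ℝ x t : ℝ) : ℂ) ^ n * w x) := fun x => by
      rw [Complex.ofReal_mul (-2 * Real.pi), mul_pow, mul_pow, mul_pow]
      ring
    simp_rw [h1]
    rw [integral_const_mul, hm, mul_zero]
  simp only [h0] at key
  rw [Real.fourier_eq']
  exact key.unique hasSum_zero

/-- A test function is the Fourier transform of some Schwartz `χ`; moving the transform from `χ` to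
`w` shows that `w` integrates to zero against it. -/
theorem ae_eq_zero_of_fourier_eq_zero {w : E → ℂ} (hw : Integrable w) (h : ∀ t, 𝓕 w t = 0) :
    w =ᵐ[volume] 0 := by
  refine ae_eq_zero_of_integral_contDiff_smul_eq_zero hw.locallyIntegrable fun g hg hc => ?_
  have hg' : ContDiff ℝ (⊤ : ℕ∞) fun x => (g x : ℂ) := Complex.ofRealCLM.contDiff.comp hg
  have hc' : HasCompactSupport fun x => (g x : ℂ) := hc.comp_left (g := Complex.ofReal) (by simp)
  set ψ : SchwartzMap E ℂ := hc'.toSchwartzMap hg'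
  set χ : SchwartzMap E ℂ := 𝓕⁻ ψ
  have h1 := VectorFourier.integral_fourierIntegral_smul_eq_flip (L := innerₗ E)
    Real.continuous_fourierChar continuous_inner hw χ.integrable (μ := volume) (ν := volume)
  have h2 : VectorFourier.fourierIntegral Real.fourierChar volume (innerₗ E) w = 0 :=
    funext h
  have h3 : VectorFourier.fourierIntegral Real.fourierChar volume (innerₗ E).flip χ = ψ := by
    have h4 : 𝓕 χ = ψ := FourierTransform.fourier_fourierInv_eq ψ
    rw [flip_innerₗ]
    have h5 := SchwartzMap.fourier_coe χ
    rw [h4] at h5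
    exact h5.symm
  rw [h2, h3] at h1
  simp only [Pi.zero_apply, zero_smul, integral_zero] at h1
  rw [h1]
  refine integral_congr_ae (.of_forall fun x => ?_)
  change g x • w x = w x * (g x : ℂ)
  rw [Complex.real_smul, mul_comm]

end moments

/-! ### Completeness of the Hermite functions. -/

section complete
open MeasureTheory SchwartzMap
variable [Fintype Λ] [DecidableEq Λ]

theorem exp_mul_gauss_le (c : ℝ) (m : ℕ) : ∃ C : ℝ, ∀ r : ℝ, 0 ≤ r →
    Real.exp (c * r) * (1 + r ^ 2) ^ m * Real.exp (-(r ^ 2 / 2)) ≤ C * Real.exp (-(r ^ 2 / 4)) := by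
  refine ⟨(2 * m).factorial * Real.exp (1 + (c + 1) ^ 2), fun r hr => ?_⟩
  have h1 : (1 + r ^ 2) ^ m ≤ (2 * m).factorial * Real.exp (1 + r) := by
    have h2 := Real.pow_div_factorial_le_exp (1 + r) (by positivity) (2 * m)
    rw [div_le_iff₀ (by positivity)] at h2
    calc (1 + r ^ 2) ^ m ≤ ((1 + r) ^ 2) ^ m := by gcongr; nlinarith
      _ = (1 + r) ^ (2 * m) := by rw [pow_mul]
      _ ≤ _ := by linarith
  calc _ ≤ Real.exp (c * r) * ((2 * m).factorial * Real.exp (1 + r)) *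
        Real.exp (-(r ^ 2 / 2)) := by gcongr
    _ = (2 * m).factorial * Real.exp (c * r + (1 + r) + -(r ^ 2 / 2)) := by
        rw [Real.exp_add (c * r + (1 + r)), Real.exp_add (c * r)]; ring
    _ ≤ (2 * m).factorial * Real.exp (1 + (c + 1) ^ 2 + -(r ^ 2 / 4)) := by
        refine mul_le_mul_of_nonneg_left (Real.exp_le_exp.2 ?_) (by positivity)
        nlinarith [sq_nonneg (r / 2 - (c + 1))]
    _ = _ := by rw [Real.exp_add]; ring

omit [DecidableEq Λ] in
theorem integrable_exp_mul_gauss {θ : Pos Λ → ℂ} (hθ : MemLp θ 2 volume) (c : ℝ) (m : ℕ) :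
    Integrable fun x => Real.exp (c * ‖x‖) * ‖((1 + ‖x‖ ^ 2) ^ m : ℝ) * θ x * gauss Λ x‖ := by
  obtain ⟨C, hC⟩ := exp_mul_gauss_le c m
  have h1 : MemLp (fun x : Pos Λ => Real.exp (-(‖x‖ ^ 2 / 4))) 2 volume := by
    rw [memLp_two_iff_integrable_sq (Continuous.aestronglyMeasurable (by fun_prop))]
    have := GaussianFourier.integrable_cexp_neg_mul_sq_norm_add (V := Pos Λ) (b := 1 / 2)
      (by norm_num) 0 0
    refine this.norm.congr (.of_forall fun x => ?_)
    simp only [Complex.norm_exp]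
    rw [← Real.exp_nat_mul]
    congr 1
    simp [← Complex.ofReal_pow]
    ring
  have h2 : Integrable fun x => gaussC Λ * C * (Real.exp (-(‖x‖ ^ 2 / 4)) * ‖θ x‖) :=
    (h1.integrable_mul hθ.norm).const_mul _
  refine h2.mono' ?_ (.of_forall fun x => ?_)
  · have h3 : Continuous fun x : Pos Λ => (((1 + ‖x‖ ^ 2) ^ m : ℝ) : ℂ) := by fun_prop
    have h4 : Continuous fun x : Pos Λ => Real.exp (c * ‖x‖) := by fun_prop
    exact h4.aestronglyMeasurable.mul ((h3.aestronglyMeasurable.mul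
      hθ.1).mul (gauss Λ).continuous.aestronglyMeasurable).norm
  · have := hC ‖x‖ (norm_nonneg x)
    rw [gauss_apply, norm_mul, norm_norm, norm_mul, norm_mul, Complex.norm_real, Complex.norm_real,
      norm_mul, Real.norm_of_nonneg (Real.exp_pos _).le,
      Real.norm_of_nonneg (by positivity : (0 : ℝ) ≤ (1 + ‖x‖ ^ 2) ^ m),
      Real.norm_of_nonneg (gaussC_pos (Λ := Λ)).le, Real.norm_of_nonneg (Real.exp_pos _).le]
    calc _ = gaussC Λ * (Real.exp (c * ‖x‖) * (1 + ‖x‖ ^ 2) ^ m * Real.exp (-(‖x‖ ^ 2 / 2))) *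
          ‖θ x‖ := by ring
      _ ≤ gaussC Λ * (C * Real.exp (-(‖x‖ ^ 2 / 4))) * ‖θ x‖ := by
          gcongr; exact gaussC_pos.le
      _ = _ := by ring

/-- Each factor `⟨x, t⟩` is produced by the combination `∑ t j φ_j` of fields. Orthogonality to
Hermite functions thereby becomes the vanishing of the moments of a function times the Gaussian. -/
theorem exists_toSch_eq_inner_pow (t : Pos Λ) (n : ℕ) : ∃ u : FinVec Λ, ∀ x : Pos Λ,
    toSch u x = ((inner ℝ x t : ℝ) : ℂ) ^ n * gauss Λ x := by
  induction n with
  | zero => exact ⟨Finsupp.single 0 1, fun x => by rw [toSch_single, her_zero]; simp⟩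
  | succ n ih =>
    obtain ⟨u, hu⟩ := ih
    refine ⟨∑ j, (t j : ℂ) • phi j u, fun x => ?_⟩
    have h1 : ∀ j, ((t j : ℂ) • xS j (toSch u)) x = (t j : ℂ) * (x j * toSch u x) := fun j => by
      rw [← xS_apply]; rfl
    rw [map_sum, _root_.sum_apply]
    simp only [map_smul, toSch_phi, h1, hu]
    rw [pow_succ', PiLp.inner_apply, Complex.ofReal_sum, Finset.sum_mul, Finset.sum_mul]
    refine Finset.sum_congr rfl fun j _ => ?_
    simp
    ring

/-- A function of polynomial growth relative to `L²` that is orthogonal to all Hermite functions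
vanishes. -/
theorem ae_eq_zero_of_orthogonal {θ : Pos Λ → ℂ} (hθ : MemLp θ 2 volume) (m : ℕ)
    (h : ∀ u : FinVec Λ, ∫ x, ((1 + ‖x‖ ^ 2) ^ m : ℝ) * θ x * toSch u x = 0) :
    θ =ᵐ[volume] 0 := by
  have hmeas : AEStronglyMeasurable
      (fun x => (((1 + ‖x‖ ^ 2) ^ m : ℝ) : ℂ) * θ x * gauss Λ x) volume := by
    have h3 : Continuous fun x : Pos Λ => (((1 + ‖x‖ ^ 2) ^ m : ℝ) : ℂ) := by fun_prop
    exact (h3.aestronglyMeasurable.mul hθ.1).mul (gauss Λ).continuous.aestronglyMeasurable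
  have hi := integrable_exp_mul_gauss hθ 0 m
  -- The Gaussian absorbs the weight `(1 + ‖x‖²)^m` along with the exponentials. The case `m = 0`
  -- gives completeness; `m = 1` is used for the momentum-space equation.
  have hF := fourier_eq_zero_of_moments hmeas (fun c => integrable_exp_mul_gauss hθ c m)
    fun t n => by
      obtain ⟨u, hu⟩ := exists_toSch_eq_inner_pow t n
      rw [← h u]
      refine integral_congr_ae (.of_forall fun x => ?_)
      simp only [hu]
      ring
  have hz := ae_eq_zero_of_fourier_eq_zero (by
    rw [← integrable_norm_iff hmeas]
    simpa using hi) hF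
  filter_upwards [hz] with x hx
  have h1 : gauss Λ x ≠ 0 := by
    rw [gauss_apply]
    exact_mod_cast (mul_pos gaussC_pos (Real.exp_pos _)).ne'
  have h2 : (((1 + ‖x‖ ^ 2) ^ m : ℝ) : ℂ) ≠ 0 := by
    exact_mod_cast (by positivity : (0 : ℝ) < (1 + ‖x‖ ^ 2) ^ m).ne'
  rcases mul_eq_zero.1 hx with hx | hx
  · exact (mul_eq_zero.1 hx).resolve_left h2
  · exact absurd hx h1

end complete

/-! ### Unitary equivalence of Fock space and the square-integrable functions. -/

section unitary
open MeasureTheory SchwartzMap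
variable [Fintype Λ] [DecidableEq Λ]

/-- The square-integrable wave functions. -/
abbrev L2 (Λ : Type*) [Fintype Λ] : Type _ := Lp ℂ 2 (volume : Measure (Pos Λ))

theorem orthonormal_her : Orthonormal ℂ fun N : Config Λ => toL2 (her N) := by
  classical
  rw [orthonormal_iff_ite]
  intro N M
  have h : ∀ N : Config Λ, her N = toSch (Finsupp.single N 1) := fun N => by
    rw [toSch_single, one_smul]
  rw [h, h, inner_toSch, toFock_single, one_smul, inner_mott_left, toFock_apply,
    Finsupp.single_apply]
  simp [eq_comm]

theorem span_her_orthogonal :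
    (Submodule.span ℂ (Set.range fun N : Config Λ => toL2 (her N)))ᗮ = ⊥ := by
  rw [Submodule.eq_bot_iff]
  intro ψ hψ
  have h1 : ∀ u : FinVec Λ, inner ℂ ψ (toL2 (toSch u)) = 0 := by
    intro u
    induction u using Finsupp.induction_linear with
    | zero => simp
    | add u v hu hv => simp only [map_add, inner_add_right, hu, hv, add_zero]
    | single N c =>
      rw [toSch_single, map_smul, inner_smul_right, ← inner_conj_symm,
        (Submodule.mem_orthogonal _ _).1 hψ _ (Submodule.subset_span ⟨N, rfl⟩)]
      simp
  have h2 : MemLp (fun x => (starRingEnd ℂ) (ψ x)) 2 volume := (Lp.memLp ψ).star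
  have h3 := ae_eq_zero_of_orthogonal h2 0 fun u => by
    rw [← h1 u, L2.inner_def]
    refine integral_congr_ae ?_
    filter_upwards [toL2_ae (toSch u)] with x hx
    rw [hx]
    simp [mul_comm]
  refine Lp.ext ?_
  filter_upwards [h3, Lp.coeFn_zero ℂ 2 (volume : Measure (Pos Λ))] with x hx h0
  rw [h0]
  simpa using hx

/-- The Schrödinger representation of the Fock space. -/
def schr : Fock Λ ≃ₗᵢ[ℂ] L2 Λ :=
  (HilbertBasis.mkOfOrthogonalEqBot orthonormal_her span_her_orthogonal).repr.symm

theorem schr_toFock (u : FinVec Λ) : schr (toFock u) = toL2 (toSch u) := by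
  classical
  induction u using Finsupp.induction_linear with
  | zero => simp
  | add u v hu hv => simp only [map_add, hu, hv]
  | single N c =>
    rw [toFock_single, toSch_single, map_smul, map_smul, mott_eq, schr,
      HilbertBasis.repr_symm_single, HilbertBasis.coe_mkOfOrthogonalEqBot]

theorem inner_schr_symm (ψ : L2 Λ) (u : FinVec Λ) :
    inner ℂ (schr.symm ψ) (toFock u) = inner ℂ ψ (toL2 (toSch u)) := by
  rw [← schr_toFock, ← LinearIsometryEquiv.inner_map_map schr, LinearIsometryEquiv.apply_symm_apply]

theorem wtOp_one (u : FinVec Λ) : wtOp 1 u = u + ∑ i, cre i (ann i u) := by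
  ext N
  have h : ∀ i, cre i (ann i u) N = (N i : ℂ) * u N := fun i => by
    rw [← Module.End.mul_apply, cre_mul_ann_self, diag_apply]
  rw [wtOp_apply, Finsupp.add_apply, Finsupp.finsetSum_apply]
  simp only [h, wt]
  rw [← Finset.sum_mul]
  push_cast
  ring

omit [DecidableEq Λ] in
theorem wtOp_succ (m : ℕ) (u : FinVec Λ) : wtOp (m + 1) u = wtOp m (wtOp 1 u) := by
  ext N
  rw [wtOp_apply, wtOp_apply, wtOp_apply]
  push_cast
  ring

theorem inner_anS_left (i : Λ) (f g : Sch Λ) :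
    inner ℂ (toL2 (anS i f)) (toL2 g) = inner ℂ (toL2 f) (toL2 (crS i g)) := by
  rw [← inner_conj_symm, ← inner_crS_left, inner_conj_symm]

/-- The weight is `1 + ∑ cre i * ann i`, and its counterpart `1 + ∑ crS i * anS i` preserves
Schwartz functions, so every power of it can be transferred to `F`. -/
theorem rapid_toL2 (F : Sch Λ) : Rapid (schr.symm (toL2 F)) := by
  refine rapid_of_inner fun m => ?_
  have key : ∀ m : ℕ, ∀ F : Sch Λ, ∃ G : Sch Λ, ∀ u : FinVec Λ,
      inner ℂ (toL2 G) (toL2 (toSch u)) = inner ℂ (toL2 F) (toL2 (toSch (wtOp m u))) := by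
    intro m
    induction m with
    | zero =>
      refine fun F => ⟨F, fun u => ?_⟩
      have : wtOp 0 u = u := by ext N; simp [wtOp_apply]
      rw [this]
    | succ m ih =>
      intro F
      obtain ⟨G, hG⟩ := ih F
      refine ⟨G + ∑ i, crS i (anS i G), fun u => ?_⟩
      rw [wtOp_succ, ← hG, wtOp_one]
      simp only [map_add, map_sum, inner_add_left, inner_add_right, sum_inner, inner_sum,
        inner_crS_left, inner_anS_left, toSch_cre, toSch_ann]
  obtain ⟨G, hG⟩ := key m F
  exact ⟨schr.symm (toL2 G), fun u => by rw [inner_schr_symm, inner_schr_symm, hG]⟩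

/-- The vectors of the finite approximations of a Schwartz function converge under every operator
that has an adjoint on Schwartz functions. -/
theorem tendsto_trunc_schr (F G : Sch Λ) {A B : Module.End ℂ (FinVec Λ)} (hA : A ∈ tame Λ)
    (hAB : ∀ u v, inner ℂ (toFock (A u)) (toFock v) = inner ℂ (toFock u) (toFock (B v)))
    (hG : ∀ u, inner ℂ (toL2 G) (toL2 (toSch u)) = inner ℂ (toL2 F) (toL2 (toSch (B u)))) :
    Filter.Tendsto (fun s => schr (toFock (A (trunc (schr.symm (toL2 F)) s)))) Filter.atTop
      (nhds (toL2 G)) := by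
  set ψ := schr.symm (toL2 F)
  have h1 := tendsto_vec (rapid_toL2 F) ⟨A, hA⟩
  have h0 := tendsto_vec (rapid_toL2 F) 1
  rw [vec_one] at h0
  have h2 : vec ψ (rapid_toL2 F) ⟨A, hA⟩ = schr.symm (toL2 G) := by
    refine eq_of_inner_toFock fun u => ?_
    rw [inner_schr_symm, hG, ← inner_schr_symm]
    have h3 := h1.inner (𝕜 := ℂ) (tendsto_const_nhds (x := toFock u))
    have h4 := h0.inner (𝕜 := ℂ) (tendsto_const_nhds (x := toFock (B u)))
    refine tendsto_nhds_unique h3 (h4.congr fun s => ?_)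
    exact (hAB _ _).symm
  rw [h2] at h1
  have := (schr.continuous.tendsto _).comp h1
  rwa [LinearIsometryEquiv.apply_symm_apply] at this

end unitary

/-! ### The Poincaré inequality of the ground state. -/

section hamS
open MeasureTheory SchwartzMap
variable [Fintype Λ]

/-- The interaction as a function of the field. -/
def fieldPoly (k : ℕ) (f : (r : ℕ) → (Fin (2 * r) → Λ) → ℝ) (x : Pos Λ) : ℝ :=
  ∑ r ∈ Finset.Icc 1 (k / 2), ∑ t : Fin (2 * r) → Λ, f r t * ((List.ofFn t).map fun i => x i).prod

theorem hasTemperateGrowth_listProd (l : List Λ) :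
    (fun x : Pos Λ => (l.map fun i => x i).prod).HasTemperateGrowth := by
  induction l with
  | nil => exact Function.HasTemperateGrowth.const (1 : ℝ)
  | cons i l ih => simpa using! (hasTemperateGrowth_coord i).mul ih

theorem hasTemperateGrowth_fieldPoly (k : ℕ) (f : (r : ℕ) → (Fin (2 * r) → Λ) → ℝ) :
    (fieldPoly k f).HasTemperateGrowth := by
  have := fun (r : ℕ) (t : Fin (2 * r) → Λ) =>
    (Function.HasTemperateGrowth.const (E := Pos Λ) (f r t)).mul
      (hasTemperateGrowth_listProd (List.ofFn t))
  exact Function.HasTemperateGrowth.sum fun r _ => Function.HasTemperateGrowth.sum fun t _ =>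
    this r t

theorem sum_apply' {ι : Type*} (s : Finset ι) (F : ι → Sch Λ) (x : Pos Λ) :
    (∑ i ∈ s, F i) x = ∑ i ∈ s, F i x := by
  rw [_root_.sum_apply]

theorem mulS_mulS {g g' : Pos Λ → ℝ} (hg : g.HasTemperateGrowth) (hg' : g'.HasTemperateGrowth)
    (F : Sch Λ) : mulS g (mulS g' F) = mulS g' (mulS g F) := by
  ext x
  rw [mulS_apply hg, mulS_apply hg', mulS_apply hg', mulS_apply hg]
  ring

theorem memLp_mul {g : Pos Λ → ℝ} (hc : Continuous g) {C : ℝ} (hC : ∀ x, |g x| ≤ C) {p : ENNReal}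
    {ψ : Pos Λ → ℂ} (hψ : MemLp ψ p volume) : MemLp (fun x => (g x : ℂ) * ψ x) p volume :=
  hψ.of_le_mul (c := C) ((Complex.continuous_ofReal.comp hc).aestronglyMeasurable.mul hψ.1)
    (.of_forall fun x => by
      rw [norm_mul, Complex.norm_real]
      exact mul_le_mul_of_nonneg_right (hC x) (norm_nonneg _))

/-- Multiplication of wave functions by a bounded continuous function. -/
def mulL {g : Pos Λ → ℝ} (hc : Continuous g) {C : ℝ} (hC : ∀ x, |g x| ≤ C) : L2 Λ →L[ℂ] L2 Λ :=
  LinearMap.mkContinuous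
    { toFun := fun ψ => (memLp_mul hc hC (Lp.memLp ψ)).toLp _
      map_add' := fun ψ χ => by
        rw [← MemLp.toLp_add]
        refine MemLp.toLp_congr _ _ ?_
        filter_upwards [Lp.coeFn_add ψ χ] with x hx
        exact (congrArg ((g x : ℂ) * ·) hx).trans (mul_add _ _ _)
      map_smul' := fun c ψ => by
        rw [RingHom.id_apply, ← MemLp.toLp_const_smul]
        refine MemLp.toLp_congr _ _ ?_
        filter_upwards [Lp.coeFn_smul c ψ] with x hx
        exact (congrArg ((g x : ℂ) * ·) hx).trans (mul_left_comm _ _ _) } C fun ψ => by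
    refine Lp.norm_le_mul_norm_of_ae_le_mul ?_
    filter_upwards [(memLp_mul hc hC (Lp.memLp ψ)).coeFn_toLp] with x hx
    simp only [LinearMap.coe_mk, AddHom.coe_mk]
    rw [hx, norm_mul, Complex.norm_real]
    exact mul_le_mul_of_nonneg_right (hC x) (norm_nonneg _)

theorem mulL_ae {g : Pos Λ → ℝ} (hc : Continuous g) {C : ℝ} (hC : ∀ x, |g x| ≤ C) (ψ : L2 Λ) :
    mulL hc hC ψ =ᵐ[volume] fun x => (g x : ℂ) * ψ x :=
  (memLp_mul hc hC (Lp.memLp ψ)).coeFn_toLp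

theorem mulL_toL2 {g : Pos Λ → ℝ} (hg : g.HasTemperateGrowth) {C : ℝ} (hC : ∀ x, |g x| ≤ C)
    (F : Sch Λ) : mulL hg.1.continuous hC (toL2 F) = toL2 (mulS g F) := by
  refine Lp.ext ?_
  filter_upwards [mulL_ae hg.1.continuous hC (toL2 F), toL2_ae F, toL2_ae (mulS g F)] with x h1 h2 h3
  rw [h1, h2, h3, mulS_apply hg]

theorem inner_mulL_left {g : Pos Λ → ℝ} (hc : Continuous g) {C : ℝ} (hC : ∀ x, |g x| ≤ C)
    (ψ χ : L2 Λ) : inner ℂ (mulL hc hC ψ) χ = inner ℂ ψ (mulL hc hC χ) := by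
  rw [L2.inner_def, L2.inner_def]
  refine integral_congr_ae ?_
  filter_upwards [mulL_ae hc hC ψ, mulL_ae hc hC χ] with x h1 h2
  rw [h1, h2]
  simp
  ring

theorem norm_mulL_sq {g : Pos Λ → ℝ} (hc : Continuous g) {C : ℝ} (hC : ∀ x, |g x| ≤ C)
    (ψ : L2 Λ) : ‖mulL hc hC ψ‖ ^ 2 = ∫ x, g x ^ 2 * ‖ψ x‖ ^ 2 := by
  have h1 : ((‖mulL hc hC ψ‖ ^ 2 : ℝ) : ℂ) = inner ℂ (mulL hc hC ψ) (mulL hc hC ψ) := by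
    rw [inner_self_eq_norm_sq_to_K]; norm_cast
  have h2 : inner ℂ (mulL hc hC ψ) (mulL hc hC ψ) =
      ∫ x, ((g x ^ 2 * ‖ψ x‖ ^ 2 : ℝ) : ℂ) := by
    rw [L2.inner_def]
    refine integral_congr_ae ?_
    filter_upwards [mulL_ae hc hC ψ] with x hx
    rw [inner_self_eq_norm_sq_to_K, hx, norm_mul, Complex.norm_real, ← sq_abs (g x), ← mul_pow,
      Real.norm_eq_abs]
    exact (Complex.ofReal_pow _ _).symm
  rw [h2, integral_complex_ofReal] at h1
  exact_mod_cast h1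

theorem inner_mulL_self {g : Pos Λ → ℝ} (hc : Continuous g) {C : ℝ} (hC : ∀ x, |g x| ≤ C)
    (ψ : L2 Λ) : inner ℂ ψ (mulL hc hC ψ) = ((∫ x, g x * ‖ψ x‖ ^ 2 : ℝ) : ℂ) := by
  rw [← integral_complex_ofReal, L2.inner_def]
  refine integral_congr_ae ?_
  filter_upwards [mulL_ae hc hC ψ] with x hx
  have := inner_self_eq_norm_sq_to_K (𝕜 := ℂ) (ψ x)
  rw [hx, ← smul_eq_mul, inner_smul_right, this, Complex.ofReal_mul, Complex.ofReal_pow]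
  rfl

variable [DecidableEq Λ]

theorem toSch_phiList (l : List Λ) (u : FinVec Λ) (x : Pos Λ) :
    toSch (phiList l u) x = ((l.map fun i => x i).prod : ℝ) * toSch u x := by
  induction l with
  | nil => simp [phiList]
  | cons i l ih =>
    change toSch (phi i (phiList l u)) x = _
    rw [toSch_phi, xS_apply, ih, List.map_cons, List.prod_cons]
    push_cast
    ring

theorem toSch_evenPoly (k : ℕ) (f : (r : ℕ) → (Fin (2 * r) → Λ) → ℝ) (u : FinVec Λ) :
    toSch (evenPoly k f u) = mulS (fieldPoly k f) (toSch u) := by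
  ext x
  rw [mulS_apply (hasTemperateGrowth_fieldPoly k f), evenPoly, fieldPoly]
  simp only [LinearMap.sum_apply, map_sum, sum_apply', LinearMap.smul_apply, map_smul]
  rw [Complex.ofReal_sum, Finset.sum_mul]
  refine Finset.sum_congr rfl fun r _ => ?_
  rw [Complex.ofReal_sum, Finset.sum_mul]
  refine Finset.sum_congr rfl fun t _ => ?_
  rw [phiProd_eq]
  change (f r t : ℂ) * toSch (phiList _ u) x = _
  rw [toSch_phiList]
  push_cast
  ring

/-- The Hamiltonian on Schwartz functions. -/
def hamS (k : ℕ) (μ : Λ → ℝ) (f : (r : ℕ) → (Fin (2 * r) → Λ) → ℝ) (F : Sch Λ) : Sch Λ :=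
  ∑ i, (-(μ i : ℂ)) • dS i (dS i F) + mulS (fieldPoly k f) F

theorem toSch_hamEnd (k : ℕ) (μ : Λ → ℝ) (f : (r : ℕ) → (Fin (2 * r) → Λ) → ℝ) (u : FinVec Λ) :
    toSch (hamEnd k μ f u) = hamS k μ f (toSch u) := by
  rw [hamEnd_apply, map_add, toSch_evenPoly, map_sum, hamS]
  simp only [map_smul, toSch_der]

theorem inner_hamS_left (k : ℕ) (μ : Λ → ℝ) (f : (r : ℕ) → (Fin (2 * r) → Λ) → ℝ) (F G : Sch Λ) :
    inner ℂ (toL2 (hamS k μ f F)) (toL2 G) = inner ℂ (toL2 F) (toL2 (hamS k μ f G)) := by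
  rw [hamS, hamS]
  simp only [map_add, map_sum, map_smul, inner_add_left, inner_add_right, sum_inner, inner_sum,
    inner_smul_left, inner_smul_right, inner_dS_left,
    inner_mulS_left (hasTemperateGrowth_fieldPoly k f)]
  simp

/-- Truncated Hermite expansions of `F` converge together with their images under the Hamiltonian.
The extension is needed because multiplication by a bounded function leads out of the finite vectors
but not out of the Schwartz space. -/
theorem gap_toL2 {k : ℕ} {μ : Λ → ℝ} {f : (r : ℕ) → (Fin (2 * r) → Λ) → ℝ} {Ω : Fock Λ}
    {e Δ : ℝ} {σ : ℂ} (hΩ : GappedState (hamEnd k μ f) Ω e Δ σ) (F : Sch Λ) :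
    Δ * (‖toL2 F‖ ^ 2 - ‖inner ℂ (schr Ω) (toL2 F)‖ ^ 2) ≤
      (inner ℂ (toL2 F) (toL2 (hamS k μ f F))).re - e * ‖toL2 F‖ ^ 2 := by
  have h1 := tendsto_trunc_schr F (hamS k μ f F) (A := hamEnd k μ f) (B := hamEnd k μ f)
    (hamEnd_mem_tame k μ f) (inner_hamEnd_left k μ f) fun u => by
      rw [inner_hamS_left, toSch_hamEnd]
  have h0 := tendsto_trunc_schr F F (A := 1) (B := 1) (one_mem _) (fun _ _ => rfl) fun _ => rfl
  simp only [Module.End.one_apply] at h0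
  have h2 := ((tendsto_const_nhds (x := schr Ω)).inner (𝕜 := ℂ) h0).norm
  have h3 := ((h0.norm.pow 2).sub (h2.pow 2)).const_mul Δ
  have h4 := (Complex.continuous_re.tendsto _).comp (h0.inner (𝕜 := ℂ) h1)
  refine le_of_tendsto_of_tendsto h3 (h4.sub ((h0.norm.pow 2).const_mul e)) (.of_forall fun s => ?_)
  simpa only [LinearIsometryEquiv.norm_map, LinearIsometryEquiv.inner_map_map, Function.comp]
    using hΩ.gap (trunc (schr.symm (toL2 F)) s)

theorem re_inner_dS_dS_mulS {g g' : Pos Λ → ℝ} (hg : g.HasTemperateGrowth)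
    (hg' : g'.HasTemperateGrowth) (i : Λ) (h : ∀ x, fderiv ℝ g x (ev i) = g' x) (F : Sch Λ) :
    (inner ℂ (toL2 (mulS g F)) (toL2 (dS i (dS i (mulS g F))))).re =
      (inner ℂ (toL2 (mulS g (mulS g F))) (toL2 (dS i (dS i F)))).re - ‖toL2 (mulS g' F)‖ ^ 2 := by
  have e1 : ∀ A B : Sch Λ, (inner ℂ (toL2 A) (toL2 (dS i B))).re =
      -(inner ℂ (toL2 (dS i A)) (toL2 B)).re := fun A B => by
    rw [inner_dS_left, Complex.neg_re, neg_neg]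
  have e2 : ∀ A B : Sch Λ, (inner ℂ (toL2 A) (toL2 B)).re = (inner ℂ (toL2 B) (toL2 A)).re :=
    fun A B => by rw [← inner_conj_symm, Complex.conj_re]
  have e3 : ‖toL2 (mulS g' F)‖ ^ 2 = (inner ℂ (toL2 (mulS g' F)) (toL2 (mulS g' F))).re := by
    rw [inner_self_eq_norm_sq_to_K]; norm_cast
  rw [e1 (mulS g F), e1 (mulS g (mulS g F)), dS_mulS hg hg' i h (mulS g F), dS_mulS hg hg' i h F,
    mulS_mulS hg' hg, e3]
  simp only [map_add, inner_add_left, inner_add_right, Complex.add_re, inner_mulS_left hg]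
  rw [e2 (dS i F) (mulS g (mulS g' F)), inner_mulS_left hg]
  ring

/-- The localisation identity for a Schrödinger operator: terms of first order in `∂g` cancel in the
real part, and the potential commutes with `g`. -/
theorem re_inner_hamS_mulS {g : Pos Λ → ℝ} {g' : Λ → Pos Λ → ℝ} (hg : g.HasTemperateGrowth)
    (hg' : ∀ i, (g' i).HasTemperateGrowth) (h : ∀ i x, fderiv ℝ g x (ev i) = g' i x)
    (k : ℕ) (μ : Λ → ℝ) (f : (r : ℕ) → (Fin (2 * r) → Λ) → ℝ) (F : Sch Λ) :
    (inner ℂ (toL2 (mulS g F)) (toL2 (hamS k μ f (mulS g F)))).re =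
      (inner ℂ (toL2 (mulS g (mulS g F))) (toL2 (hamS k μ f F))).re +
        ∑ i, μ i * ‖toL2 (mulS (g' i) F)‖ ^ 2 := by
  have hμ : ∀ (i : Λ) (z : ℂ), (-(μ i : ℂ) * z).re = -(μ i * z.re) := fun i z => by
    rw [← Complex.ofReal_neg, Complex.re_ofReal_mul]; ring
  rw [hamS, hamS]
  simp only [map_add, map_sum, map_smul, inner_add_right, inner_sum, inner_smul_right,
    Complex.add_re, Complex.re_sum, hμ, re_inner_dS_dS_mulS hg (hg' _) _ (h _)]
  rw [mulS_mulS (hasTemperateGrowth_fieldPoly k f) hg, ← inner_mulS_left hg (mulS g F),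
    add_right_comm, ← Finset.sum_add_distrib]
  congr 1
  refine Finset.sum_congr rfl fun i _ => ?_
  ring

/-- The gap inequality for `g Ω`: by `re_inner_hamS_mulS` and `HΩ = eΩ` its excess energy is the
gradient term alone, so nothing about the growth of the potential is needed. The estimate is made on
the approximants of `Ω`, and boundedness of `g` and `g'` carries it to the limit. -/
theorem poincare {k : ℕ} {μ : Λ → ℝ} {f : (r : ℕ) → (Fin (2 * r) → Λ) → ℝ} {Ω : Fock Λ}
    {e Δ : ℝ} {σ : ℂ} (hΩ : GappedState (hamEnd k μ f) Ω e Δ σ)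
    {g : Pos Λ → ℝ} {g' : Λ → Pos Λ → ℝ} (hg : g.HasTemperateGrowth)
    (hg' : ∀ i, (g' i).HasTemperateGrowth) (h : ∀ i x, fderiv ℝ g x (ev i) = g' i x)
    {C : ℝ} (hC : ∀ x, |g x| ≤ C) {C' : Λ → ℝ} (hC' : ∀ i x, |g' i x| ≤ C' i) :
    Δ * ((∫ x, g x ^ 2 * ‖schr Ω x‖ ^ 2) - (∫ x, g x * ‖schr Ω x‖ ^ 2) ^ 2) ≤
      ∑ i, μ i * ∫ x, g' i x ^ 2 * ‖schr Ω x‖ ^ 2 := by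
  obtain ⟨u, hu, hHu, -⟩ := hΩ.approx
  have h0 := (schr.continuous.tendsto _).comp hu
  have h1 := (schr.continuous.tendsto _).comp hHu
  simp only [Function.comp_def, schr_toFock, toSch_hamEnd, map_smul] at h0 h1
  set M := mulL hg.1.continuous hC
  set M' := fun i => mulL (hg' i).1.continuous (hC' i)
  have hM := (M.continuous.tendsto _).comp h0
  have hMM := (M.continuous.tendsto _).comp hM
  have hM' := fun i => ((M' i).continuous.tendsto _).comp h0
  have h2 := ((tendsto_const_nhds (x := schr Ω)).inner (𝕜 := ℂ) hM).norm
  have h3 := ((hM.norm.pow 2).sub (h2.pow 2)).const_mul Δ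
  have h4 := (Complex.continuous_re.tendsto _).comp (hMM.inner (𝕜 := ℂ) h1)
  have h5 := tendsto_finsetSum Finset.univ fun i _ => ((hM' i).norm.pow 2).const_mul (μ i)
  have key := le_of_tendsto_of_tendsto h3 ((h4.add h5).sub ((hM.norm.pow 2).const_mul e))
    (.of_forall fun n => by
      have := gap_toL2 hΩ (mulS g (toSch (u n)))
      rw [re_inner_hamS_mulS hg hg' h] at this
      simpa only [Function.comp, M, M', mulL_toL2 hg, mulL_toL2 (hg' _)] using this)
  have h6 : (inner ℂ (M (M (schr Ω))) ((e : ℂ) • schr Ω)).re = e * ‖M (schr Ω)‖ ^ 2 := by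
    rw [inner_mulL_left, map_smul, inner_smul_right, inner_self_eq_norm_sq_to_K,
      Complex.re_ofReal_mul]
    norm_cast
  rw [h6, add_sub_cancel_left, norm_mulL_sq, inner_mulL_self, Complex.norm_real, Real.norm_eq_abs,
    sq_abs] at key
  simpa only [M', norm_mulL_sq] using key

end hamS

/-! ### Bounded odd approximations of a coordinate. -/

section reg

/-- The regularised coordinate `s / (1 + t s²)`. -/
def reg (t s : ℝ) : ℝ := s / (1 + t * s ^ 2)

/-- The derivative of the regularised coordinate. -/
def reg' (t s : ℝ) : ℝ := (1 - t * s ^ 2) / (1 + t * s ^ 2) ^ 2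

theorem hasDerivAt_reg {t : ℝ} (ht : 0 < t) (s : ℝ) : HasDerivAt (reg t) (reg' t s) s := by
  have h0 : 1 + t * s ^ 2 ≠ 0 := by positivity
  have h1 : HasDerivAt (fun s : ℝ => 1 + t * s ^ 2) (t * (2 * s)) s := by
    simpa using ((hasDerivAt_pow 2 s).const_mul t).const_add 1
  refine ((hasDerivAt_id s).div h1 h0).congr_deriv ?_
  rw [reg']
  simp only [id]
  congr 1
  ring

theorem abs_reg_le {t : ℝ} (ht : 0 < t) (s : ℝ) : |reg t s| ≤ |s| := by
  rw [reg, abs_div, abs_of_pos (by positivity : 0 < 1 + t * s ^ 2)]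
  refine div_le_self (abs_nonneg s) ?_
  have : 0 ≤ t * s ^ 2 := by positivity
  linarith

theorem abs_reg_le_inv {t : ℝ} (ht : 0 < t) (ht1 : t ≤ 1) (s : ℝ) : |reg t s| ≤ t⁻¹ := by
  rw [reg, abs_div, abs_of_pos (by positivity : 0 < 1 + t * s ^ 2),
    div_le_iff₀ (by positivity), inv_mul_eq_div, le_div_iff₀ ht, ← sq_abs s]
  nlinarith [sq_nonneg (|s| * t - 1), abs_nonneg s, mul_nonneg ht.le (sq_nonneg |s|)]

theorem abs_reg'_le {t : ℝ} (ht : 0 < t) (s : ℝ) : |reg' t s| ≤ 1 := by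
  have h : 0 ≤ t * s ^ 2 := by positivity
  rw [reg', abs_div, abs_of_pos (by positivity : 0 < (1 + t * s ^ 2) ^ 2),
    div_le_one (by positivity), abs_le]
  constructor <;> nlinarith

theorem hasTemperateGrowth_inv {t : ℝ} (ht : 0 < t) :
    (fun s : ℝ => (1 + t * s ^ 2)⁻¹).HasTemperateGrowth := by
  have h1 := (Function.hasTemperateGrowth_one_add_norm_sq_rpow (H := ℝ) (-1)).comp
    ((Function.HasTemperateGrowth.const (E := ℝ) (Real.sqrt t)).mul
      (Function.HasTemperateGrowth.id (E := ℝ)))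
  have h2 : (fun s : ℝ => (1 + t * s ^ 2)⁻¹) =
      (fun x : ℝ => (1 + ‖x‖ ^ 2) ^ (-1 : ℝ)) ∘ ((fun _ => Real.sqrt t) * id) := by
    funext s
    simp [Real.rpow_neg_one, mul_pow, Real.sq_sqrt ht.le]
  rw [h2]
  exact h1

theorem hasTemperateGrowth_reg {t : ℝ} (ht : 0 < t) : (reg t).HasTemperateGrowth :=
  (Function.HasTemperateGrowth.id (E := ℝ)).mul (hasTemperateGrowth_inv ht)

theorem hasTemperateGrowth_reg' {t : ℝ} (ht : 0 < t) : (reg' t).HasTemperateGrowth := by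
  have h1 := ((Function.HasTemperateGrowth.const (E := ℝ) 1).sub
    ((Function.HasTemperateGrowth.const t).mul
      ((Function.HasTemperateGrowth.id (E := ℝ)).pow 2))).mul
    ((hasTemperateGrowth_inv ht).pow 2)
  have h2 : reg' t = ((fun _ => 1) - (fun _ => t) * id ^ 2) * (fun s : ℝ => (1 + t * s ^ 2)⁻¹) ^ 2 := by
    funext s
    simp [reg', div_eq_mul_inv]
  rw [h2]
  exact h1

end reg

/-! ### Positivity of the couplings and position moments of the ground state. -/

section moments
open MeasureTheory SchwartzMap
variable [Fintype Λ] [DecidableEq Λ]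
variable {k : ℕ} {μ : Λ → ℝ} {f : (r : ℕ) → (Fin (2 * r) → Λ) → ℝ} {Ω : Fock Λ} {e Δ : ℝ} {σ : ℂ}

omit [DecidableEq Λ] in
theorem integrable_sq (ψ : L2 Λ) : Integrable fun x => ‖ψ x‖ ^ 2 := by
  have := (memLp_two_iff_integrable_sq_norm (Lp.memLp ψ).1).1 (Lp.memLp ψ)
  exact this

/-- The approximants in `GappedState` have exact parity, so their integrals against an odd function
vanish by reflection, and so does the limit. -/
theorem integral_odd (hΩ : GappedState (hamEnd k μ f) Ω e Δ σ) {g : Pos Λ → ℝ}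
    (hg : g.HasTemperateGrowth) {C : ℝ} (hC : ∀ x, |g x| ≤ C) (hodd : ∀ x, g (-x) = -g x) :
    ∫ x, g x * ‖schr Ω x‖ ^ 2 = 0 := by
  obtain ⟨u, hu, -, hp⟩ := hΩ.approx
  have h0 := (schr.continuous.tendsto _).comp hu
  simp only [Function.comp_def, schr_toFock] at h0
  set M := mulL hg.1.continuous hC
  have h1 := h0.inner (𝕜 := ℂ) ((M.continuous.tendsto _).comp h0)
  have hσ : (starRingEnd ℂ) σ * σ = 1 := by
    have h2 : ‖σ‖ * ‖σ‖ = 1 := by rw [← norm_mul, hΩ.sq_eq_one, norm_one]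
    rw [← Complex.normSq_eq_conj_mul_self, Complex.normSq_eq_norm_sq, sq, h2]
    simp
  have h2 : ∀ n, inner ℂ (toL2 (toSch (u n))) (M (toL2 (toSch (u n)))) = 0 := by
    intro n
    have h3 : ∀ x, toSch (u n) (-x) = σ * toSch (u n) x := fun x => by
      rw [← toSch_par, hp, map_smul]; rfl
    rw [mulL_toL2 hg, inner_toL2]
    have h4 := integral_neg_eq_self
      (fun x => (starRingEnd ℂ) (toSch (u n) x) * mulS g (toSch (u n)) x) volume
    have h5 : ∀ x, (starRingEnd ℂ) (toSch (u n) (-x)) * mulS g (toSch (u n)) (-x) =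
        -((starRingEnd ℂ) (toSch (u n) x) * mulS g (toSch (u n)) x) := fun x => by
      rw [mulS_apply hg, mulS_apply hg, h3, hodd, map_mul]
      push_cast
      linear_combination (-(starRingEnd ℂ) (toSch (u n) x) * g x * toSch (u n) x) * hσ
    simp_rw [h5] at h4
    rw [integral_neg] at h4
    exact self_eq_neg.1 h4.symm
  simp only [Function.comp_def, h2] at h1
  have h3 := tendsto_nhds_unique h1 tendsto_const_nhds
  rw [inner_mulL_self] at h3
  exact_mod_cast h3

theorem poincare_reg (hΩ : GappedState (hamEnd k μ f) Ω e Δ σ) (j : Λ) (m : ℕ) {t : ℝ}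
    (ht : 0 < t) (ht1 : t ≤ 1) :
    Δ * ((∫ x, reg t (x j) ^ (2 * (m + 1)) * ‖schr Ω x‖ ^ 2) -
      (∫ x, reg t (x j) ^ (m + 1) * ‖schr Ω x‖ ^ 2) ^ 2) ≤
      μ j * ∫ x, ((m + 1) * reg t (x j) ^ m * reg' t (x j)) ^ 2 * ‖schr Ω x‖ ^ 2 := by
  have hc := hasTemperateGrowth_coord (Λ := Λ) j
  have hr := (hasTemperateGrowth_reg ht).comp hc
  have hr' := (hasTemperateGrowth_reg' ht).comp hc
  have hg' := ((Function.HasTemperateGrowth.const (E := Pos Λ) ((m : ℝ) + 1)).mul (hr.pow m)).mul hr'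
  have key := poincare hΩ (g := fun x => reg t (x j) ^ (m + 1))
    (g' := fun i x => if i = j then (m + 1) * reg t (x j) ^ m * reg' t (x j) else 0)
    (hr.pow (m + 1)) (fun i => by
      split_ifs
      · exact hg'
      · exact Function.HasTemperateGrowth.const 0) (fun i x => by
      have h1 := ((hasDerivAt_reg ht (x j)).pow (m + 1)).comp_hasFDerivAt x
        (EuclideanSpace.proj (𝕜 := ℝ) j : Pos Λ →L[ℝ] ℝ).hasFDerivAt
      have h2 := congrArg (fun T => T (ev i)) h1.fderiv
      refine h2.trans ?_
      split_ifs with h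
      · simp [ev, h]
      · simp [ev, Ne.symm h]) (C := t⁻¹ ^ (m + 1)) (fun x => by
      rw [abs_pow]
      exact pow_le_pow_left₀ (abs_nonneg _) (abs_reg_le_inv ht ht1 _) _)
    (C' := fun _ => (m + 1) * t⁻¹ ^ m) (fun i x => by
      split_ifs
      · rw [abs_mul, abs_mul, abs_pow, abs_of_pos (by positivity : (0 : ℝ) < m + 1)]
        have h1 := abs_reg_le_inv ht ht1 (x j)
        have h2 := abs_reg'_le ht (x j)
        calc _ ≤ (m + 1) * t⁻¹ ^ m * 1 := by gcongr
          _ = _ := mul_one _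
      · rw [abs_zero]; positivity)
  rw [Finset.sum_eq_single j (fun i _ hi => by simp [hi]) (by simp)] at key
  simpa only [if_true, ← pow_mul, mul_comm (m + 1) 2] using key

/-- In the Poincaré inequality for `reg 1 (x j)` the mean vanishes by parity, while the second
moment is positive because a unit vector cannot live on the null set `x j = 0`. The left side is
therefore positive, which is impossible for `μ j ≤ 0`. -/
theorem mu_pos (hΩ : GappedState (hamEnd k μ f) Ω e Δ σ) (hΔ : 0 < Δ) (j : Λ) : 0 < μ j := by
  have hc := hasTemperateGrowth_coord (Λ := Λ) j
  have hr := (hasTemperateGrowth_reg one_pos).comp hc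
  have h1 := poincare_reg hΩ j 0 one_pos le_rfl
  have h2 := integral_odd hΩ hr (fun x => abs_reg_le_inv one_pos le_rfl _) fun x => by
    simp [reg, neg_div]
  simp only [Function.comp_def] at h2
  simp only [zero_add, pow_one, h2, mul_one] at h1
  have h3 : 0 < ∫ x, reg 1 (x j) ^ 2 * ‖schr Ω x‖ ^ 2 := by
    have hn : ∀ x : Pos Λ, 0 ≤ reg 1 (x j) ^ 2 * ‖schr Ω x‖ ^ 2 := fun x => by positivity
    refine lt_of_le_of_ne (integral_nonneg hn) fun h0 => ?_
    have hi : Integrable fun x => reg 1 (x j) ^ 2 * ‖schr Ω x‖ ^ 2 := by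
      refine (integrable_sq (schr Ω)).bdd_mul (c := 1) ((hr.1.continuous.pow 2).aestronglyMeasurable)
        (.of_forall fun x => ?_)
      have := abs_reg_le_inv one_pos le_rfl (x j)
      rw [inv_one] at this
      rw [norm_pow]
      exact pow_le_one₀ (norm_nonneg _) this
    have h4 := (integral_eq_zero_iff_of_nonneg hn hi).1 h0.symm
    have h5 : ∀ᵐ x : Pos Λ, x j ≠ 0 := by
      have h6 := Measure.addHaar_submodule (volume : Measure (Pos Λ))
        (LinearMap.ker (EuclideanSpace.proj (𝕜 := ℝ) j : Pos Λ →L[ℝ] ℝ).toLinearMap) (by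
          intro h
          have : ev j ∈ (⊤ : Submodule ℝ (Pos Λ)) := trivial
          rw [← h] at this
          simp [ev] at this)
      exact measure_mono_null (fun x hx => by simpa using hx) h6
    have h7 : schr Ω = 0 := by
      refine Lp.ext ?_
      filter_upwards [h4, h5, Lp.coeFn_zero ℂ 2 (volume : Measure (Pos Λ))] with x hx hj h0
      rw [h0]
      have : reg 1 (x j) ≠ 0 := by
        rw [reg]
        exact div_ne_zero hj (by positivity)
      simpa [this] using hx
    have h8 : ‖schr Ω‖ = 1 := by rw [LinearIsometryEquiv.norm_map, hΩ.norm_eq]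
    rw [h7, norm_zero] at h8
    exact zero_ne_one h8
  have h4 : 0 ≤ ∫ x, (((0 : ℕ) + 1) * reg 1 (x j) ^ 0 * reg' 1 (x j)) ^ 2 * ‖schr Ω x‖ ^ 2 :=
    integral_nonneg fun x => by positivity
  by_contra! h
  have := mul_pos hΔ h3
  have := mul_nonneg (neg_nonneg.2 h) h4
  simp only [ne_eq, OfNat.ofNat_ne_zero, not_false_eq_true, zero_pow, sub_zero] at h1
  linarith

/-- Fatou's lemma. -/
theorem integrable_of_tendsto_of_bounded {X : Type*} [MeasurableSpace X] {ν : Measure X}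
    {G : ℕ → X → ℝ} {g : X → ℝ} {K : ℝ}
    (hG : ∀ x, Filter.Tendsto (fun n => G n x) Filter.atTop (nhds (g x)))
    (h0 : ∀ n x, 0 ≤ G n x) (hi : ∀ n, Integrable (G n) ν) (hK : ∀ n, ∫ x, G n x ∂ν ≤ K) :
    Integrable g ν := by
  refine ⟨aestronglyMeasurable_of_tendsto_ae _ (fun n => (hi n).1) (.of_forall hG), ?_⟩
  have h1 : ∫⁻ x, ‖g x‖ₑ ∂ν = ∫⁻ x, Filter.liminf (fun n => ‖G n x‖ₑ) Filter.atTop ∂ν :=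
    lintegral_congr fun x => (hG x).enorm.liminf_eq.symm
  rw [hasFiniteIntegral_def, h1]
  refine lt_of_le_of_lt (lintegral_liminf_le' fun n => (hi n).1.aemeasurable.enorm) ?_
  refine lt_of_le_of_lt (b := ENNReal.ofReal K) ?_ ENNReal.ofReal_lt_top
  refine Filter.liminf_le_of_le (by isBoundedDefault) fun b hb => ?_
  obtain ⟨n, hn⟩ := hb.exists
  refine hn.trans ?_
  rw [← ofReal_integral_norm_eq_lintegral_enorm (hi n)]
  refine ENNReal.ofReal_le_ofReal ((le_of_eq ?_).trans (hK n))
  exact integral_congr_ae (.of_forall fun x => Real.norm_of_nonneg (h0 n x))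

/-- The Poincaré inequality for the power `m + 1` of the regularised coordinate bounds the moment of
order `2(m+1)` by its mean and the moment of order `2m`, uniformly in the regularisation; then
`integrable_of_tendsto_of_bounded` applies. -/
theorem integrable_moment (hΩ : GappedState (hamEnd k μ f) Ω e Δ σ) (hΔ : 0 < Δ) (j : Λ) (m : ℕ) :
    Integrable fun x : Pos Λ => x j ^ (2 * m) * ‖schr Ω x‖ ^ 2 := by
  induction m with
  | zero => simpa using integrable_sq (schr Ω)
  | succ m ih =>
    set w : Pos Λ → ℝ := fun x => ‖schr Ω x‖ ^ 2 with hw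
    have hw0 : ∀ x, 0 ≤ w x := fun x => by positivity
    set t : ℕ → ℝ := fun n => 1 / ((n : ℝ) + 1) with ht
    have ht0 : ∀ n, 0 < t n := fun n => by positivity
    have ht1 : ∀ n, t n ≤ 1 := fun n => by
      rw [ht, div_le_one (by positivity)]
      linarith [(Nat.cast_nonneg n : (0 : ℝ) ≤ n)]
    have hlim : Filter.Tendsto t Filter.atTop (nhds 0) := tendsto_one_div_add_atTop_nhds_zero_nat
    have hc := hasTemperateGrowth_coord (Λ := Λ) j
    have hr := fun n => (hasTemperateGrowth_reg (ht0 n)).comp hc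
    have hr' := fun n => (hasTemperateGrowth_reg' (ht0 n)).comp hc
    have hbi : ∀ n p, Integrable fun x : Pos Λ => reg (t n) (x j) ^ p * w x := fun n p => by
      refine (integrable_sq (schr Ω)).bdd_mul (c := (t n)⁻¹ ^ p)
        (((hr n).1.continuous.pow p).aestronglyMeasurable) (.of_forall fun x => ?_)
      rw [norm_pow]
      exact pow_le_pow_left₀ (norm_nonneg _) (abs_reg_le_inv (ht0 n) (ht1 n) _) _
    set J := ∫ x : Pos Λ, x j ^ (2 * m) * w x with hJ
    set J0 := ∫ x : Pos Λ, w x with hJ0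
    -- For `m = 0` the mean vanishes by parity; for `m ≥ 1` the exponent `m + 1` is at most `2 m`,
    -- which the induction hypothesis controls.
    have hmean : ∀ n, (∫ x, reg (t n) (x j) ^ (m + 1) * w x) ^ 2 ≤ (J0 + J) ^ 2 := by
      intro n
      rcases Nat.eq_zero_or_pos m with h | h
      · subst h
        have h2 := integral_odd hΩ (hr n) (fun x => abs_reg_le_inv (ht0 n) (ht1 n) _) fun x => by
          simp [reg, neg_div]
        simp only [Function.comp_def] at h2
        simp only [zero_add, pow_one]
        rw [h2, zero_pow two_ne_zero]
        positivity
      · rw [← sq_abs]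
        refine pow_le_pow_left₀ (abs_nonneg _) ?_ 2
        rw [hJ, hJ0, ← integral_add (integrable_sq (schr Ω)) ih]
        refine (abs_integral_le_integral_abs).trans (integral_mono (hbi n _).abs
          ((integrable_sq (schr Ω)).add ih) fun x => ?_)
        rw [abs_mul, abs_pow, abs_of_nonneg (hw0 x)]
        have h3 : |reg (t n) (x j)| ^ (m + 1) ≤ 1 + x j ^ (2 * m) := by
          refine (pow_le_pow_left₀ (abs_nonneg _) (abs_reg_le (ht0 n) _) _).trans ?_
          have h5 : x j ^ (2 * m) = |x j| ^ (2 * m) := by rw [pow_mul, pow_mul, sq_abs]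
          rw [h5]
          rcases le_total |x j| 1 with h4 | h4
          · have := pow_le_one₀ (abs_nonneg _) h4 (n := m + 1)
            have : 0 ≤ |x j| ^ (2 * m) := by positivity
            linarith
          · have := pow_le_pow_right₀ h4 (by omega : m + 1 ≤ 2 * m)
            linarith
        calc _ ≤ (1 + x j ^ (2 * m)) * w x := by gcongr
          _ = _ := by ring
    have hgrad : ∀ n, ∫ x, ((m + 1) * reg (t n) (x j) ^ m * reg' (t n) (x j)) ^ 2 * w x ≤
        (m + 1) ^ 2 * J := by
      intro n
      rw [hJ, ← integral_const_mul]
      refine integral_mono_of_nonneg (.of_forall fun x => by positivity) (ih.const_mul _)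
        (.of_forall fun x => ?_)
      have h1 : (reg (t n) (x j) ^ m * reg' (t n) (x j)) ^ 2 ≤ x j ^ (2 * m) := by
        rw [mul_comm 2 m, pow_mul, ← sq_abs, ← sq_abs (x j ^ m), abs_mul, abs_pow, abs_pow]
        refine pow_le_pow_left₀ (by positivity) ?_ 2
        calc _ ≤ |x j| ^ m * 1 :=
              mul_le_mul (pow_le_pow_left₀ (abs_nonneg _) (abs_reg_le (ht0 n) _) _)
                (abs_reg'_le (ht0 n) _) (abs_nonneg _) (by positivity)
          _ = _ := mul_one _
      calc _ = (m + 1 : ℝ) ^ 2 * ((reg (t n) (x j) ^ m * reg' (t n) (x j)) ^ 2 * w x) := by ring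
        _ ≤ _ := mul_le_mul_of_nonneg_left (mul_le_mul_of_nonneg_right h1 (hw0 x)) (by positivity)
    refine integrable_of_tendsto_of_bounded (K := (μ j * ((m + 1) ^ 2 * J)) / Δ + (J0 + J) ^ 2)
      (G := fun n x => reg (t n) (x j) ^ (2 * (m + 1)) * w x) (fun x => ?_) (fun n x => ?_)
      (fun n => hbi n _) fun n => ?_
    · have h1 : Filter.Tendsto (fun n => reg (t n) (x j)) Filter.atTop (nhds (x j)) := by
        have h2 := (tendsto_const_nhds (x := x j)).div
          ((hlim.mul_const (x j ^ 2)).const_add 1) (by simp)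
        simpa [reg] using! h2
      exact (h1.pow _).mul_const _
    · rw [pow_mul]; positivity
    · have h1 := poincare_reg hΩ j m (ht0 n) (ht1 n)
      have h2 := (mul_le_mul_of_nonneg_left (hgrad n) (mu_pos hΩ hΔ j).le)
      have h3 := h1.trans h2
      rw [mul_comm, ← le_div_iff₀ hΔ] at h3
      have := hmean n
      linarith

end moments

/-! ### Normal ordering and the quarter turn of phase space. -/

section adjoin
variable {R : Type*} [Ring R] [Algebra ℂ R] {s : Set R} {d : R}

/-- The commutator with `d` is a derivation, so it maps the generated algebra into itself once it
does so on generators. -/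
theorem exists_mul_eq_of_mem_adjoin (h : ∀ a ∈ s, ∃ b ∈ Algebra.adjoin ℂ s, d * a = a * d + b)
    {Q : R} (hQ : Q ∈ Algebra.adjoin ℂ s) : ∃ b ∈ Algebra.adjoin ℂ s, d * Q = Q * d + b := by
  induction hQ using Algebra.adjoin_induction with
  | mem a ha => exact h a ha
  | algebraMap r => exact ⟨0, zero_mem _, by rw [add_zero, Algebra.commutes]⟩
  | add x y _ _ hx hy =>
    obtain ⟨b, hb, h1⟩ := hx
    obtain ⟨c, hc, h2⟩ := hy
    exact ⟨b + c, add_mem hb hc, by rw [mul_add, h1, h2]; noncomm_ring⟩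
  | mul x y hx' hy' hx hy =>
    obtain ⟨b, hb, h1⟩ := hx
    obtain ⟨c, hc, h2⟩ := hy
    refine ⟨x * c + b * y, add_mem (mul_mem hx' hc) (mul_mem hb hy'), ?_⟩
    rw [← mul_assoc, h1, add_mul, mul_assoc, h2]; noncomm_ring

theorem exists_mul_eq_of_mem_adjoin' (h : ∀ a ∈ s, ∃ b ∈ Algebra.adjoin ℂ s, a * d = d * a + b)
    {Q : R} (hQ : Q ∈ Algebra.adjoin ℂ s) : ∃ b ∈ Algebra.adjoin ℂ s, Q * d = d * Q + b := by
  induction hQ using Algebra.adjoin_induction with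
  | mem a ha => exact h a ha
  | algebraMap r => exact ⟨0, zero_mem _, by rw [add_zero, Algebra.commutes]⟩
  | add x y _ _ hx hy =>
    obtain ⟨b, hb, h1⟩ := hx
    obtain ⟨c, hc, h2⟩ := hy
    exact ⟨b + c, add_mem hb hc, by rw [add_mul, h1, h2]; noncomm_ring⟩
  | mul x y hx' hy' hx hy =>
    obtain ⟨b, hb, h1⟩ := hx
    obtain ⟨c, hc, h2⟩ := hy
    refine ⟨x * c + b * y, add_mem (mul_mem hx' hc) (mul_mem hb hy'), ?_⟩
    rw [mul_assoc, h2, mul_add, ← mul_assoc, h1]; noncomm_ring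

end adjoin

section turn
variable [DecidableEq Λ]

variable (Λ) in
/-- The polynomials in the fields. -/
def phiAlg : Subalgebra ℂ (Module.End ℂ (FinVec Λ)) := Algebra.adjoin ℂ (Set.range phi)

variable (Λ) in
/-- The polynomials in the derivatives. -/
def derAlg : Subalgebra ℂ (Module.End ℂ (FinVec Λ)) := Algebra.adjoin ℂ (Set.range der)

theorem phi_mem_phiAlg (i : Λ) : phi i ∈ phiAlg Λ := Algebra.subset_adjoin ⟨i, rfl⟩

theorem der_mem_derAlg (i : Λ) : der i ∈ derAlg Λ := Algebra.subset_adjoin ⟨i, rfl⟩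

theorem phiList_mem_phiAlg (l : List Λ) : phiList l ∈ phiAlg Λ :=
  list_prod_mem fun A hA => by
    obtain ⟨i, _, rfl⟩ := List.mem_map.1 hA
    exact phi_mem_phiAlg i

theorem exists_der_mul (j : Λ) {Q : Module.End ℂ (FinVec Λ)} (hQ : Q ∈ phiAlg Λ) :
    ∃ Q' ∈ phiAlg Λ, der j * Q = Q * der j + Q' := by
  refine exists_mul_eq_of_mem_adjoin (R := Module.End ℂ (FinVec Λ)) ?_ hQ
  rintro _ ⟨i, rfl⟩
  refine ⟨_, ?_, der_mul_phi j i⟩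
  split_ifs
  · exact one_mem _
  · exact zero_mem _

theorem exists_mul_phi (j : Λ) {D : Module.End ℂ (FinVec Λ)} (hD : D ∈ derAlg Λ) :
    ∃ D' ∈ derAlg Λ, D * phi j = phi j * D + D' := by
  refine exists_mul_eq_of_mem_adjoin' (R := Module.End ℂ (FinVec Λ)) ?_ hD
  rintro _ ⟨i, rfl⟩
  refine ⟨_, ?_, der_mul_phi i j⟩
  split_ifs
  · exact one_mem _
  · exact zero_mem _

variable (Λ) in
/-- The normally ordered polynomials in fields and derivatives. -/
def ordAlg : Submodule ℂ (Module.End ℂ (FinVec Λ)) :=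
  Subalgebra.toSubmodule (phiAlg Λ) * Subalgebra.toSubmodule (derAlg Λ)

theorem mul_phi_mem_ordAlg {A : Module.End ℂ (FinVec Λ)} (hA : A ∈ ordAlg Λ) (j : Λ) :
    A * phi j ∈ ordAlg Λ := by
  refine Submodule.mul_induction_on hA (fun Q hQ D hD => ?_) fun A B hA hB => ?_
  · obtain ⟨D', hD', h⟩ := exists_mul_phi j hD
    rw [mul_assoc, h, mul_add, ← mul_assoc]
    exact add_mem (Submodule.mul_mem_mul ((phiAlg Λ).mul_mem hQ (phi_mem_phiAlg j)) hD)
      (Submodule.mul_mem_mul hQ hD')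
  · rw [add_mul]; exact add_mem hA hB

theorem mul_der_mem_ordAlg {A : Module.End ℂ (FinVec Λ)} (hA : A ∈ ordAlg Λ) (j : Λ) :
    A * der j ∈ ordAlg Λ := by
  refine Submodule.mul_induction_on hA (fun Q hQ D hD => ?_) fun A B hA hB => ?_
  · rw [mul_assoc]
    exact Submodule.mul_mem_mul hQ ((derAlg Λ).mul_mem hD (der_mem_derAlg j))
  · rw [add_mul]; exact add_mem hA hB

theorem mul_ann_mem_ordAlg {A : Module.End ℂ (FinVec Λ)} (hA : A ∈ ordAlg Λ) (j : Λ) :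
    A * ann j ∈ ordAlg Λ := by
  rw [ann_eq, mul_smul_comm, mul_add]
  exact Submodule.smul_mem _ _ (add_mem (mul_phi_mem_ordAlg hA j) (mul_der_mem_ordAlg hA j))

theorem cre_eq' (j : Λ) : cre j = ((Real.sqrt 2 : ℝ) : ℂ)⁻¹ • (phi j + (-1 : ℂ) • der j) := by
  rw [cre_eq]
  congr 1
  refine LinearMap.ext fun u => ?_
  rw [LinearMap.sub_apply, LinearMap.add_apply, LinearMap.smul_apply, neg_one_smul, sub_eq_add_neg]

theorem mul_cre_mem_ordAlg {A : Module.End ℂ (FinVec Λ)} (hA : A ∈ ordAlg Λ) (j : Λ) :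
    A * cre j ∈ ordAlg Λ := by
  rw [cre_eq', mul_smul_comm, mul_add, mul_smul_comm]
  exact Submodule.smul_mem _ _ (add_mem (mul_phi_mem_ordAlg hA j)
    (Submodule.smul_mem _ _ (mul_der_mem_ordAlg hA j)))

variable [Fintype Λ]

theorem evenPoly_mem_phiAlg (k : ℕ) (f : (r : ℕ) → (Fin (2 * r) → Λ) → ℝ) :
    evenPoly k f ∈ phiAlg Λ :=
  sum_mem fun r _ => sum_mem fun t _ => by
    rw [phiProd_eq]
    exact Subalgebra.smul_mem _ (phiList_mem_phiAlg _) _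

/-- The order, fields to the left, is the useful one: in `⟨Ω, Q D u⟩` the field polynomial `Q` is
moved onto `Ω` by the position moments before `D` is treated in momentum space. -/
theorem wtOp_mem_ordAlg (m : ℕ) : wtOp m ∈ ordAlg Λ := by
  induction m with
  | zero =>
    have : (wtOp 0 : Module.End ℂ (FinVec Λ)) = 1 * 1 := by
      refine LinearMap.ext fun u => Finsupp.ext fun N => ?_
      simp [wtOp_apply]
    rw [this]
    exact Submodule.mul_mem_mul (one_mem (phiAlg Λ)) (one_mem (derAlg Λ))
  | succ m ih =>
    have : wtOp (m + 1) = wtOp m + ∑ i : Λ, wtOp m * cre i * ann i := by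
      refine LinearMap.ext fun u => ?_
      rw [wtOp_succ, wtOp_one, map_add, map_sum, LinearMap.add_apply, LinearMap.sum_apply]
      rfl
    rw [this]
    exact add_mem ih (sum_mem fun i _ => mul_ann_mem_ordAlg (mul_cre_mem_ordAlg ih i) i)

variable (Λ) in
/-- The quarter turn `z ^ N` of phase space, `z = ± I`. -/
def turn (z : ℂ) : Module.End ℂ (FinVec Λ) := diag fun N => z ^ ∑ i, N i

omit [DecidableEq Λ] in
theorem turn_turn {z z' : ℂ} (h : z * z' = 1) (u : FinVec Λ) : turn Λ z (turn Λ z' u) = u := by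
  ext N
  rw [turn, turn, diag_apply, diag_apply, ← mul_assoc, ← mul_pow, h, one_pow, one_mul]

theorem turn_cre (z : ℂ) (i : Λ) (u : FinVec Λ) :
    turn Λ z (cre i u) = z • cre i (turn Λ z u) := by
  induction u using Finsupp.induction_linear with
  | zero => simp
  | add u v hu hv => simp [map_add, hu, hv]
  | single N c =>
    rw [cre_single, turn, diag_single, diag_single, cre_single, Finsupp.smul_single]
    have h : ∑ j, Function.update N i (N i + 1) j = ∑ j, N j + 1 := by
      have := sum_update_add N i (N i + 1); omega
    rw [h, pow_succ, smul_eq_mul]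
    congr 1
    ring

theorem turn_ann {z z' : ℂ} (h : z * z' = 1) (i : Λ) (u : FinVec Λ) :
    turn Λ z (ann i u) = z' • ann i (turn Λ z u) := by
  induction u using Finsupp.induction_linear with
  | zero => simp
  | add u v hu hv => simp [map_add, hu, hv]
  | single N c =>
    rw [ann_single, turn, diag_single, diag_single, ann_single, Finsupp.smul_single]
    rcases Nat.eq_zero_or_pos (N i) with h0 | h0
    · simp [h0]
    have h1 : ∑ j, N j = ∑ j, Function.update N i (N i - 1) j + 1 := by
      have := sum_update_add N i (N i - 1); omega
    rw [h1, pow_succ, smul_eq_mul]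
    congr 1
    linear_combination (-(z ^ (∑ j, Function.update N i (N i - 1) j) * c * (Real.sqrt (N i) : ℂ))) * h

/-- In the Hermite basis `I ^ N` plays the role of the Fourier transform, turning derivatives into
multiplication by coordinates. -/
theorem turn_der (i : Λ) (u : FinVec Λ) :
    turn Λ Complex.I (der i u) = -Complex.I • phi i (turn Λ Complex.I u) := by
  rw [der, phi]
  simp only [LinearMap.smul_apply, LinearMap.sub_apply, LinearMap.add_apply, map_smul, map_sub,
    turn_cre, turn_ann (z := Complex.I) (z' := -Complex.I) (by simp)]
  rw [smul_comm]
  congr 1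
  rw [smul_add, neg_smul, neg_smul, sub_eq_add_neg]

omit [DecidableEq Λ] [Fintype Λ] in
theorem exists_inner_diag (ψ : Fock Λ) {c : Config Λ → ℂ} (hc : ∀ N, ‖c N‖ = 1) :
    ∃ χ : Fock Λ, ∀ u, inner ℂ χ (toFock u) = inner ℂ ψ (toFock (diag c u)) := by
  refine ⟨⟨fun N => (starRingEnd ℂ) (c N) * ψ N, (lp.memℓp ψ).mono' fun N => ?_⟩, fun u => ?_⟩
  · rw [norm_mul, RCLike.norm_conj, hc, one_mul]
  · induction u using Finsupp.induction_linear with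
    | zero => simp
    | add u v hu hv => simp only [map_add, inner_add_right, hu, hv]
    | single N z =>
      rw [diag_single, toFock_single, toFock_single, inner_smul_right, inner_smul_right,
        inner_mott_right, inner_mott_right]
      simp
      ring

omit [DecidableEq Λ] in
theorem exists_inner_turn (ψ : Fock Λ) {z : ℂ} (hz : ‖z‖ = 1) :
    ∃ χ : Fock Λ, ∀ u, inner ℂ χ (toFock u) = inner ℂ ψ (toFock (turn Λ z u)) :=
  exists_inner_diag ψ fun N => by rw [norm_pow, hz, one_pow]

end turn

/-! ### Multipliers of polynomial growth. -/

section polyBdd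
open MeasureTheory SchwartzMap
variable [Fintype Λ]

/-- Continuous functions of polynomial growth. -/
def PolyBdd (q : Pos Λ → ℂ) : Prop :=
  Continuous q ∧ ∃ (C : ℝ) (n : ℕ), 0 ≤ C ∧ ∀ x, ‖q x‖ ≤ C * (1 + ‖x‖ ^ 2) ^ n

theorem PolyBdd.const (c : ℂ) : PolyBdd fun _ : Pos Λ => c :=
  ⟨continuous_const, ‖c‖, 0, norm_nonneg _, fun x => by simp⟩

theorem PolyBdd.add {q q' : Pos Λ → ℂ} (h : PolyBdd q) (h' : PolyBdd q') :
    PolyBdd fun x => q x + q' x := by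
  obtain ⟨hc, C, n, h0, h⟩ := h
  obtain ⟨hc', C', n', h0', h'⟩ := h'
  refine ⟨hc.add hc', C + C', n + n', by positivity, fun x => (norm_add_le _ _).trans ?_⟩
  have h1 : (1 : ℝ) ≤ 1 + ‖x‖ ^ 2 := by have := sq_nonneg ‖x‖; linarith
  rw [add_mul]
  refine add_le_add ((h x).trans ?_) ((h' x).trans ?_)
  · gcongr
    omega
  · gcongr
    omega

theorem PolyBdd.mul {q q' : Pos Λ → ℂ} (h : PolyBdd q) (h' : PolyBdd q') :
    PolyBdd fun x => q x * q' x := by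
  obtain ⟨hc, C, n, h0, h⟩ := h
  obtain ⟨hc', C', n', h0', h'⟩ := h'
  refine ⟨hc.mul hc', C * C', n + n', by positivity, fun x => ?_⟩
  rw [norm_mul]
  calc _ ≤ (C * (1 + ‖x‖ ^ 2) ^ n) * (C' * (1 + ‖x‖ ^ 2) ^ n') := by
        gcongr
        · exact h x
        · exact h' x
    _ = _ := by rw [pow_add]; ring

theorem abs_coord_le (x : Pos Λ) (i : Λ) : |x i| ≤ ‖x‖ := PiLp.norm_apply_le x i

theorem PolyBdd.coord (i : Λ) : PolyBdd fun x : Pos Λ => (x i : ℂ) := by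
  refine ⟨by fun_prop, 1, 1, zero_le_one, fun x => ?_⟩
  rw [Complex.norm_real, Real.norm_eq_abs, one_mul, pow_one]
  have := abs_coord_le x i
  nlinarith [sq_nonneg (‖x‖ - 1), norm_nonneg x]

variable [DecidableEq Λ]

theorem exists_toSch_of_mem_adjoin {S : Set (Module.End ℂ (FinVec Λ))}
    (B : Module.End ℂ (FinVec Λ))
    (hS : ∀ A ∈ S, ∃ q, PolyBdd q ∧ ∀ u x, toSch (B (A u)) x = q x * toSch (B u) x)
    {A : Module.End ℂ (FinVec Λ)} (hA : A ∈ Algebra.adjoin ℂ S) :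
    ∃ q, PolyBdd q ∧ ∀ u x, toSch (B (A u)) x = q x * toSch (B u) x := by
  induction hA using Algebra.adjoin_induction with
  | mem A hA => exact hS A hA
  | algebraMap r =>
    refine ⟨_, .const r, fun u x => ?_⟩
    rw [Module.algebraMap_end_apply, map_smul, map_smul]
    rfl
  | add x y _ _ hx hy =>
    obtain ⟨p, hp, h1⟩ := hx
    obtain ⟨q, hq, h2⟩ := hy
    refine ⟨_, hp.add hq, fun u z => ?_⟩
    rw [LinearMap.add_apply, map_add, map_add, add_mul, ← h1, ← h2]
    rfl
  | mul x y _ _ hx hy =>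
    obtain ⟨p, hp, h1⟩ := hx
    obtain ⟨q, hq, h2⟩ := hy
    refine ⟨_, hp.mul hq, fun u z => ?_⟩
    rw [Module.End.mul_apply, h1, h2, mul_assoc]

theorem exists_toSch_phiAlg {Q : Module.End ℂ (FinVec Λ)} (hQ : Q ∈ phiAlg Λ) :
    ∃ q, PolyBdd q ∧ ∀ u x, toSch (Q u) x = q x * toSch u x := by
  refine exists_toSch_of_mem_adjoin 1 ?_ hQ
  rintro _ ⟨i, rfl⟩
  refine ⟨_, .coord i, fun u x => ?_⟩
  rw [Module.End.one_apply, Module.End.one_apply, toSch_phi, xS_apply]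

theorem exists_toSch_derAlg {D : Module.End ℂ (FinVec Λ)} (hD : D ∈ derAlg Λ) :
    ∃ q, PolyBdd q ∧ ∀ u x, toSch (turn Λ Complex.I (D u)) x =
      q x * toSch (turn Λ Complex.I u) x := by
  refine exists_toSch_of_mem_adjoin _ ?_ hD
  rintro _ ⟨i, rfl⟩
  refine ⟨_, (PolyBdd.const (-Complex.I)).mul (.coord i), fun u x => ?_⟩
  rw [turn_der, map_smul, toSch_phi, mul_assoc, ← xS_apply]
  rfl

end polyBdd

/-! ### Momentum-space wave functions. -/

section momentum
open MeasureTheory SchwartzMap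
variable [Fintype Λ] [DecidableEq Λ]
variable {k : ℕ} {μ : Λ → ℝ} {f : (r : ℕ) → (Fin (2 * r) → Λ) → ℝ} {Ω : Fock Λ} {e Δ : ℝ} {σ : ℂ}

omit [DecidableEq Λ] in
theorem one_add_norm_sq_pow_le (x : Pos Λ) (n : ℕ) :
    (1 + ‖x‖ ^ 2) ^ n ≤ (1 + Fintype.card Λ) ^ n * (1 + ∑ j, x j ^ (2 * n)) := by
  rcases isEmpty_or_nonempty Λ with h | h
  · have : ‖x‖ ^ 2 = 0 := by rw [EuclideanSpace.real_norm_sq_eq]; simp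
    simp [this]
  obtain ⟨j, hj⟩ := Finite.exists_max fun j => x j ^ 2
  have h1 : ‖x‖ ^ 2 ≤ Fintype.card Λ * x j ^ 2 := by
    rw [EuclideanSpace.real_norm_sq_eq]
    simpa using Finset.sum_le_card_nsmul Finset.univ (fun i => x i ^ 2) _ fun i _ => hj i
  have h2 : (x j ^ 2) ^ n ≤ ∑ i, x i ^ (2 * n) := by
    rw [← pow_mul]
    exact Finset.single_le_sum (f := fun i => x i ^ (2 * n))
      (fun i _ => by rw [pow_mul]; positivity) (Finset.mem_univ j)
  have h0 : 0 ≤ ∑ i, x i ^ (2 * n) := le_trans (by positivity) h2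
  have h3 : 1 + ‖x‖ ^ 2 ≤ (1 + Fintype.card Λ) * max 1 (x j ^ 2) := by
    have := le_max_left 1 (x j ^ 2)
    have h5 : (Fintype.card Λ : ℝ) * x j ^ 2 ≤ Fintype.card Λ * max 1 (x j ^ 2) := by
      gcongr; exact le_max_right _ _
    linarith
  calc _ ≤ ((1 + Fintype.card Λ) * max 1 (x j ^ 2)) ^ n := by gcongr
    _ = (1 + Fintype.card Λ) ^ n * max 1 (x j ^ 2) ^ n := mul_pow _ _ _
    _ ≤ _ := by
        gcongr
        rcases max_cases 1 (x j ^ 2) with ⟨h6, -⟩ | ⟨h6, -⟩ <;> rw [h6]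
        · simpa using h0
        · linarith

theorem memLp_polyBdd_mul (hΩ : GappedState (hamEnd k μ f) Ω e Δ σ) (hΔ : 0 < Δ)
    {q : Pos Λ → ℂ} (hq : PolyBdd q) : MemLp (fun x => q x * schr Ω x) 2 volume := by
  obtain ⟨hc, C, n, h0, h⟩ := hq
  have hm : AEStronglyMeasurable (fun x => q x * schr Ω x) volume :=
    hc.aestronglyMeasurable.mul (Lp.memLp (schr Ω)).1
  rw [memLp_two_iff_integrable_sq_norm hm]
  have h1 : Integrable fun x : Pos Λ => C ^ 2 * ((1 + Fintype.card Λ) ^ (2 * n) *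
      ((1 + ∑ j, x j ^ (2 * (2 * n))) * ‖schr Ω x‖ ^ 2)) := by
    refine Integrable.const_mul (Integrable.const_mul ?_ _) _
    simp only [add_mul, one_mul, Finset.sum_mul]
    exact (integrable_sq _).add (integrable_finsetSum _ fun j _ => integrable_moment hΩ hΔ j _)
  refine h1.mono' (hm.norm.pow 2) (.of_forall fun x => ?_)
  rw [Real.norm_of_nonneg (by positivity), norm_mul, mul_pow]
  have h2 : ‖q x‖ ^ 2 ≤ C ^ 2 * ((1 + Fintype.card Λ) ^ (2 * n) *
      (1 + ∑ j, x j ^ (2 * (2 * n)))) := by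
    calc ‖q x‖ ^ 2 ≤ (C * (1 + ‖x‖ ^ 2) ^ n) ^ 2 := by gcongr; exact h x
      _ = C ^ 2 * (1 + ‖x‖ ^ 2) ^ (2 * n) := by rw [mul_pow, ← pow_mul, mul_comm n]
      _ ≤ _ := by gcongr; exact one_add_norm_sq_pow_le x _
  calc _ ≤ C ^ 2 * ((1 + Fintype.card Λ) ^ (2 * n) *
      (1 + ∑ j, x j ^ (2 * (2 * n)))) * ‖schr Ω x‖ ^ 2 := by gcongr
    _ = _ := by ring

omit [DecidableEq Λ] in
theorem inner_toLp {θ : Pos Λ → ℂ} (hθ : MemLp θ 2 volume) (F : Sch Λ) :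
    inner ℂ (hθ.toLp θ) (toL2 F) = ∫ x, (starRingEnd ℂ) (θ x) * F x := by
  rw [L2.inner_def]
  refine integral_congr_ae ?_
  filter_upwards [hθ.coeFn_toLp, toL2_ae F] with x h1 h2
  rw [h1, h2]
  simp [mul_comm]

omit [DecidableEq Λ] in
theorem inner_L2 (ψ : L2 Λ) (F : Sch Λ) :
    inner ℂ ψ (toL2 F) = ∫ x, (starRingEnd ℂ) (ψ x) * F x := by
  rw [← inner_toLp (Lp.memLp ψ), Lp.toLp_coeFn]

omit [DecidableEq Λ] in
theorem PolyBdd.conj {q : Pos Λ → ℂ} (h : PolyBdd q) : PolyBdd fun x => (starRingEnd ℂ) (q x) := by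
  obtain ⟨hc, C, n, h0, h⟩ := h
  exact ⟨Complex.continuous_conj.comp hc, C, n, h0, fun x => by rw [RCLike.norm_conj]; exact h x⟩

variable (Ω) in
/-- `c` is the momentum-space wave function of `Q` applied to the state. -/
def IsMomentum (Q : Module.End ℂ (FinVec Λ)) (c : L2 Λ) : Prop :=
  ∀ u, inner ℂ c (toL2 (toSch (turn Λ Complex.I u))) = inner ℂ Ω (toFock (Q u))

/-- `Q` acts as multiplication by a polynomially bounded `q`, so the position moments put the
conjugate of `q` times `Ω` into `L²`; a quarter turn takes that function to momentum space. -/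
theorem exists_isMomentum (hΩ : GappedState (hamEnd k μ f) Ω e Δ σ) (hΔ : 0 < Δ)
    {Q : Module.End ℂ (FinVec Λ)} (hQ : Q ∈ phiAlg Λ) : ∃ c, IsMomentum Ω Q c := by
  obtain ⟨q, hq, h⟩ := exists_toSch_phiAlg hQ
  have hm := memLp_polyBdd_mul hΩ hΔ hq.conj
  obtain ⟨χ, hχ⟩ := exists_inner_turn (schr.symm (hm.toLp _)) (z := -Complex.I) (by simp)
  refine ⟨schr χ, fun u => ?_⟩
  rw [← schr_toFock, LinearIsometryEquiv.inner_map_map, hχ, turn_turn (by simp), inner_schr_symm,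
    inner_toLp, ← LinearIsometryEquiv.inner_map_map schr, schr_toFock, inner_L2]
  refine integral_congr_ae (.of_forall fun x => ?_)
  simp only [h, map_mul, Complex.conj_conj]
  ring

/-- The inverse square of the regularised distance. -/
def invRho (x : Pos Λ) : ℝ := (1 + ‖x‖ ^ 2)⁻¹

omit [DecidableEq Λ] in
theorem hasTemperateGrowth_invRho : (invRho (Λ := Λ)).HasTemperateGrowth := by
  have h := Function.hasTemperateGrowth_one_add_norm_sq_rpow (H := Pos Λ) (-1)
  simpa only [Real.rpow_neg_one] using! h

omit [DecidableEq Λ] in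
theorem hasTemperateGrowth_one_add_norm_sq :
    (fun x : Pos Λ => 1 + ‖x‖ ^ 2).HasTemperateGrowth :=
  (Function.HasTemperateGrowth.const 1).add (Function.hasTemperateGrowth_norm_sq (Pos Λ))

omit [DecidableEq Λ] in
theorem invRho_pos (x : Pos Λ) : 0 < invRho x := by unfold invRho; positivity

omit [DecidableEq Λ] in
theorem invRho_mul (x : Pos Λ) : invRho x * (1 + ‖x‖ ^ 2) = 1 :=
  inv_mul_cancel₀ (by positivity)

omit [DecidableEq Λ] in
theorem abs_invRho_le (x : Pos Λ) : |invRho x| ≤ 1 := by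
  rw [abs_of_pos (invRho_pos x), invRho]
  exact inv_le_one_of_one_le₀ (by have := sq_nonneg ‖x‖; linarith)

omit [DecidableEq Λ] in
theorem abs_coord_mul_invRho_le (i : Λ) (x : Pos Λ) : |x i * invRho x| ≤ 1 := by
  rw [abs_mul, abs_of_pos (invRho_pos x), ← invRho_mul x, mul_comm]
  refine mul_le_mul_of_nonneg_left ?_ (invRho_pos x).le
  have := abs_coord_le x i
  nlinarith [sq_nonneg (‖x‖ - 1), norm_nonneg x]

omit [DecidableEq Λ] in
theorem abs_coord_sq_mul_invRho_le (i : Λ) (x : Pos Λ) : |x i ^ 2 * invRho x| ≤ 1 := by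
  rw [abs_mul, abs_of_pos (invRho_pos x), ← invRho_mul x, mul_comm, abs_of_nonneg (sq_nonneg _)]
  refine mul_le_mul_of_nonneg_left ?_ (invRho_pos x).le
  have := pow_le_pow_left₀ (abs_nonneg _) (abs_coord_le x i) 2
  rw [sq_abs] at this
  linarith

/-- Serves to prove identities between functions that lie in `L²` only after division by `1 + ‖x‖²`.
-/
theorem eq_zero_of_orthogonal (θ : L2 Λ)
    (h : ∀ u, inner ℂ θ (toL2 (mulS (fun x => 1 + ‖x‖ ^ 2) (toSch u))) = 0) : θ = 0 := by
  have h2 : MemLp (fun x => (starRingEnd ℂ) (θ x)) 2 volume := (Lp.memLp θ).star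
  have h3 := ae_eq_zero_of_orthogonal h2 1 fun u => by
    rw [← h u, inner_L2]
    refine integral_congr_ae (.of_forall fun x => ?_)
    simp only [mulS_apply hasTemperateGrowth_one_add_norm_sq, pow_one]
    ring
  refine Lp.ext ?_
  filter_upwards [h3, Lp.coeFn_zero ℂ 2 (volume : Measure (Pos Λ))] with x hx h0
  rw [h0]
  simpa using hx

omit [DecidableEq Λ] in
theorem inner_mulL_mulS {g b : Pos Λ → ℝ} (hg : g.HasTemperateGrowth) {C : ℝ}
    (hC : ∀ x, |g x| ≤ C) (hb : b.HasTemperateGrowth) (hgb : ∀ x, g x * (1 + ‖x‖ ^ 2) = b x)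
    (ψ : L2 Λ) (F : Sch Λ) :
    inner ℂ (mulL hg.1.continuous hC ψ) (toL2 (mulS (fun x => 1 + ‖x‖ ^ 2) F)) =
      inner ℂ ψ (toL2 (mulS b F)) := by
  rw [inner_mulL_left, mulL_toL2 hg]
  congr 2
  ext x
  rw [mulS_apply hg, mulS_apply hasTemperateGrowth_one_add_norm_sq, mulS_apply hb, ← hgb]
  push_cast
  ring

end momentum

/-! ### Elliptic regularity and rapid decay of the ground state. -/

section rapidGround
open MeasureTheory SchwartzMap
variable [Fintype Λ] [DecidableEq Λ]
variable {k : ℕ} {μ : Λ → ℝ} {f : (r : ℕ) → (Fin (2 * r) → Λ) → ℝ} {Ω : Fock Λ} {e Δ : ℝ} {σ : ℂ}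

omit [DecidableEq Λ] in
theorem coeFn_sum {ι : Type*} (s : Finset ι) (ψ : ι → L2 Λ) :
    ⇑(∑ i ∈ s, ψ i) =ᵐ[volume] fun x => ∑ i ∈ s, ψ i x := by
  classical
  induction s using Finset.induction_on with
  | empty =>
    filter_upwards [Lp.coeFn_zero ℂ 2 (volume : Measure (Pos Λ))] with x h0
    rw [Finset.sum_empty, Finset.sum_empty, h0]; rfl
  | insert i s hi ih =>
    rw [Finset.sum_insert hi]
    filter_upwards [ih, Lp.coeFn_add (ψ i) (∑ i ∈ s, ψ i)] with x h1 h2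
    rw [h2, Pi.add_apply, h1, Finset.sum_insert hi]

/-- The eigenvalue equation is tested on `Q u`. Commuting the two derivatives past `Q` leaves terms
with at most one derivative, always to the right of a field polynomial. -/
theorem sum_inner_der_der (hΩ : GappedState (hamEnd k μ f) Ω e Δ σ)
    {Q : Module.End ℂ (FinVec Λ)} (hQ : Q ∈ phiAlg Λ) :
    ∃ Q1 ∈ phiAlg Λ, ∃ Q2 : Λ → Module.End ℂ (FinVec Λ), (∀ j, Q2 j ∈ phiAlg Λ) ∧ ∀ u,
      ∑ j, (-(μ j : ℂ)) * inner ℂ Ω (toFock (Q (der j (der j u)))) =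
        inner ℂ Ω (toFock (Q1 u)) + ∑ j, inner ℂ Ω (toFock (Q2 j (der j u))) := by
  choose Q' hQ' h' using fun j => exists_der_mul j hQ
  choose Q'' hQ'' h'' using fun j => exists_der_mul j (hQ' j)
  refine ⟨(e : ℂ) • Q + (-1 : ℂ) • (evenPoly k f * Q) + ∑ j, (μ j : ℂ) • Q'' j,
    add_mem (add_mem (Subalgebra.smul_mem _ hQ _)
      (Subalgebra.smul_mem _ (mul_mem (evenPoly_mem_phiAlg k f) hQ) _))
      (sum_mem fun j _ => Subalgebra.smul_mem _ (hQ'' j) _), fun j => (2 * (μ j : ℂ)) • Q' j,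
    fun j => Subalgebra.smul_mem _ (hQ' j) _, fun u => ?_⟩
  have h1 := hΩ.eigen (Q u)
  have h2 : ∀ j, der j (der j (Q u)) = Q (der j (der j u)) + (2 : ℂ) • Q' j (der j u) + Q'' j u := by
    intro j
    have e1 : ∀ v, der j (Q v) = Q (der j v) + Q' j v := fun v => LinearMap.congr_fun (h' j) v
    have e2 : ∀ v, der j (Q' j v) = Q' j (der j v) + Q'' j v := fun v => LinearMap.congr_fun (h'' j) v
    rw [e1, map_add, e1, e2, two_smul]
    abel
  rw [hamEnd_apply] at h1
  simp only [h2, map_add, map_sum, map_smul, inner_add_right, inner_sum, inner_smul_right, mul_add,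
    Finset.sum_add_distrib] at h1
  simp only [LinearMap.add_apply, LinearMap.smul_apply, LinearMap.sum_apply, map_add, map_sum,
    map_smul, inner_add_right, inner_sum, inner_smul_right, Module.End.mul_apply]
  have h3 : ∀ j, (-(μ j : ℂ)) * (2 * inner ℂ Ω (toFock (Q' j (der j u)))) =
      -(2 * (μ j : ℂ) * inner ℂ Ω (toFock (Q' j (der j u)))) := fun j => by ring
  simp only [h3, neg_mul, Finset.sum_neg_distrib] at h1 ⊢
  linear_combination h1

/-- The relation of `sum_inner_der_der` after the quarter turn: a quadratic symbol times `c` on the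
left, growth at most linear on the right. Each term is first divided by `1 + ‖x‖²` so that the weak
identity can be read in `L²`. -/
theorem momentum_eq (hΩ : GappedState (hamEnd k μ f) Ω e Δ σ) (hΔ : 0 < Δ)
    {Q : Module.End ℂ (FinVec Λ)} (hQ : Q ∈ phiAlg Λ) {c : L2 Λ} (hc : IsMomentum Ω Q c) :
    ∃ Q1 ∈ phiAlg Λ, ∃ Q2 : Λ → Module.End ℂ (FinVec Λ), (∀ j, Q2 j ∈ phiAlg Λ) ∧
      ∃ (c1 : L2 Λ) (c2 : Λ → L2 Λ), IsMomentum Ω Q1 c1 ∧ (∀ j, IsMomentum Ω (Q2 j) (c2 j)) ∧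
      ∀ᵐ x, ((∑ j, μ j * x j ^ 2 : ℝ) : ℂ) * c x = c1 x + ∑ j, Complex.I * x j * c2 j x := by
  obtain ⟨Q1, hQ1, Q2, hQ2, h⟩ := sum_inner_der_der hΩ hQ
  obtain ⟨c1, hc1⟩ := exists_isMomentum hΩ hΔ hQ1
  choose c2 hc2 using fun j => exists_isMomentum hΩ hΔ (hQ2 j)
  refine ⟨Q1, hQ1, Q2, hQ2, c1, c2, hc1, hc2, ?_⟩
  have t0 := hasTemperateGrowth_invRho (Λ := Λ)
  have tc := hasTemperateGrowth_coord (Λ := Λ)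
  have t1 := fun j => (tc j).mul t0
  have t2 := fun j => ((tc j).pow 2).mul t0
  set M := mulL t0.1.continuous abs_invRho_le
  set M1 := fun j => mulL (t1 j).1.continuous (abs_coord_mul_invRho_le j)
  set M2 := fun j => mulL (t2 j).1.continuous (abs_coord_sq_mul_invRho_le j)
  have key : ∑ j, (μ j : ℂ) • M2 j c - M c1 - ∑ j, Complex.I • M1 j (c2 j) = 0 := by
    refine eq_zero_of_orthogonal _ fun v => ?_
    obtain ⟨u, rfl⟩ : ∃ u, v = turn Λ Complex.I u :=
      ⟨turn Λ (-Complex.I) v, by rw [turn_turn (by simp)]⟩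
    set G := toSch (turn Λ Complex.I u)
    have a1 : ∀ j (v : FinVec Λ), toSch (turn Λ Complex.I (der j v)) =
        (-Complex.I) • xS j (toSch (turn Λ Complex.I v)) := fun j v => by
      rw [turn_der, map_smul, toSch_phi]
    have a2 : ∀ j, mulS ((fun x : Pos Λ => x j) ^ 2) G = xS j (xS j G) := fun j => by
      ext x
      rw [mulS_apply ((tc j).pow 2), xS_apply, xS_apply]
      simp
      ring
    have a3 : mulS (fun _ : Pos Λ => 1) G = G := by
      ext x
      rw [mulS_apply (.const 1)]
      simp
    have b0 := inner_mulL_mulS t0 abs_invRho_le (.const 1) invRho_mul c1 G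
    have b1 := fun j => inner_mulL_mulS (t1 j) (abs_coord_mul_invRho_le j) (tc j)
      (fun x => by simp [mul_assoc, invRho_mul]) (c2 j) G
    have b2 := fun j => inner_mulL_mulS (t2 j) (abs_coord_sq_mul_invRho_le j) ((tc j).pow 2)
      (fun x => by simp [mul_assoc, invRho_mul]) c G
    have h3 := h u
    have d0 := fun u => (hc u).symm
    have d1 := fun u => (hc1 u).symm
    have d2 := fun j u => (hc2 j u).symm
    have hG : toSch (turn Λ Complex.I u) = G := rfl
    simp only [d0, d1, d2, a1, map_smul, inner_smul_right, hG] at h3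
    simp only [inner_sub_left, sum_inner, inner_smul_left, Complex.conj_ofReal, Complex.conj_I]
    rw [b0, a3]
    have b2' : ∀ j, inner ℂ (M2 j c) (toL2 (mulS (fun x => 1 + ‖x‖ ^ 2) G)) =
      inner ℂ c (toL2 (xS j (xS j G))) := fun j => by rw [← a2]; exact b2 j
    have b1' : ∀ j, inner ℂ (M1 j (c2 j)) (toL2 (mulS (fun x => 1 + ‖x‖ ^ 2) G)) =
      inner ℂ (c2 j) (toL2 (xS j G)) := b1
    simp only [b1', b2']
    have h4 : ∀ j, (-(μ j : ℂ)) * (-Complex.I * (-Complex.I * inner ℂ c (toL2 (xS j (xS j G))))) =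
        μ j * inner ℂ c (toL2 (xS j (xS j G))) := fun j => by
      linear_combination (-(μ j : ℂ) * inner ℂ c (toL2 (xS j (xS j G)))) * Complex.I_mul_I
    simp only [h4] at h3
    linear_combination h3
  have hz := Lp.coeFn_zero ℂ 2 (volume : Measure (Pos Λ))
  rw [← key] at hz
  filter_upwards [hz, Lp.coeFn_sub (∑ j, (μ j : ℂ) • M2 j c - M c1) (∑ j, Complex.I • M1 j (c2 j)),
    Lp.coeFn_sub (∑ j, (μ j : ℂ) • M2 j c) (M c1), coeFn_sum Finset.univ fun j => (μ j : ℂ) • M2 j c,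
    coeFn_sum Finset.univ fun j => Complex.I • M1 j (c2 j),
    eventually_countable_forall.2 fun j => Lp.coeFn_smul (μ j : ℂ) (M2 j c),
    eventually_countable_forall.2 fun j => Lp.coeFn_smul Complex.I (M1 j (c2 j)),
    mulL_ae t0.1.continuous abs_invRho_le c1,
    eventually_countable_forall.2 fun j =>
      mulL_ae (t1 j).1.continuous (abs_coord_mul_invRho_le j) (c2 j),
    eventually_countable_forall.2 fun j =>
      mulL_ae (t2 j).1.continuous (abs_coord_sq_mul_invRho_le j) c]
    with x h0 h1 h2 h3 h4 h5 h6 h7 h8 h9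
  rw [h1, Pi.sub_apply, h2, Pi.sub_apply, h3, h4] at h0
  simp only [h5, h6, Pi.smul_apply, M, M1, M2, h7, h8, h9, smul_eq_mul, Pi.mul_apply, Pi.pow_apply,
    Pi.zero_apply] at h0
  have hr : (invRho x : ℂ) ≠ 0 := by exact_mod_cast (invRho_pos x).ne'
  apply mul_left_cancel₀ hr
  have e1 : ∑ j, (μ j : ℂ) * (((x j ^ 2 * invRho x : ℝ) : ℂ) * c x) =
      invRho x * (((∑ j, μ j * x j ^ 2 : ℝ) : ℂ) * c x) := by
    push_cast
    rw [Finset.sum_mul, Finset.mul_sum]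
    exact Finset.sum_congr rfl fun j _ => by ring
  have e2 : ∑ j, Complex.I * (((x j * invRho x : ℝ) : ℂ) * c2 j x) =
      invRho x * ∑ j, Complex.I * x j * c2 j x := by
    push_cast
    rw [Finset.mul_sum]
    exact Finset.sum_congr rfl fun j _ => by ring
  rw [e1, e2] at h0
  linear_combination h0

/-- The momentum-space wave functions decay faster than any power. -/
theorem memLp_momentum (hΩ : GappedState (hamEnd k μ f) Ω e Δ σ) (hΔ : 0 < Δ) (n : ℕ)
    {Q : Module.End ℂ (FinVec Λ)} (hQ : Q ∈ phiAlg Λ) {c : L2 Λ} (hc : IsMomentum Ω Q c) :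
    MemLp (fun x => ((Real.sqrt (1 + ‖x‖ ^ 2) ^ n : ℝ) : ℂ) * c x) 2 volume := by
  induction n generalizing Q c with
  | zero => simpa using Lp.memLp c
  | succ n ih =>
    -- Dividing the linear right side by the quadratic symbol gains one power of `√(1 + ‖x‖²)`. The
    -- new wave functions belong to other field polynomials, hence the induction over all `Q` at
    -- once.
    obtain ⟨Q1, hQ1, Q2, hQ2, c1, c2, hc1, hc2, h⟩ := momentum_eq hΩ hΔ hQ hc
    obtain ⟨m, hm, hmj⟩ : ∃ m : ℝ, 0 < m ∧ ∀ j, m ≤ μ j := by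
      rcases isEmpty_or_nonempty Λ with h | h
      · exact ⟨1, one_pos, fun j => isEmptyElim j⟩
      · obtain ⟨j, hj⟩ := Finite.exists_min μ
        exact ⟨μ j, mu_pos hΩ hΔ j, hj⟩
    have hs : Continuous fun x : Pos Λ => ((Real.sqrt (1 + ‖x‖ ^ 2) ^ (n + 1) : ℝ) : ℂ) := by fun_prop
    have hb : MemLp (fun x => ‖((Real.sqrt (1 + ‖x‖ ^ 2) ^ n : ℝ) : ℂ) * c x‖ + m⁻¹ *
        (‖((Real.sqrt (1 + ‖x‖ ^ 2) ^ n : ℝ) : ℂ) * c1 x‖ +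
          ∑ j, ‖((Real.sqrt (1 + ‖x‖ ^ 2) ^ n : ℝ) : ℂ) * c2 j x‖)) 2 volume :=
      (ih hQ hc).norm.add (((ih hQ1 hc1).norm.add
        (memLp_finsetSum _ fun j _ => (ih (hQ2 j) (hc2 j)).norm)).const_mul _)
    refine hb.of_le (hs.aestronglyMeasurable.mul (Lp.memLp c).1) ?_
    filter_upwards [h] with x hx
    set ρ := Real.sqrt (1 + ‖x‖ ^ 2) with hρ
    have hρ2 : ρ ^ 2 = 1 + ‖x‖ ^ 2 := Real.sq_sqrt (by positivity)
    have hρ1 : 1 ≤ ρ := Real.one_le_sqrt.2 (by have := sq_nonneg ‖x‖; linarith)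
    have hρx : ‖x‖ ≤ ρ := Real.le_sqrt_of_sq_le (by linarith)
    have h1 : m * ‖x‖ ^ 2 * ‖c x‖ ≤ ‖c1 x‖ + ‖x‖ * ∑ j, ‖c2 j x‖ := by
      have h2 := congrArg norm hx
      rw [norm_mul, Complex.norm_real] at h2
      have h3 : m * ‖x‖ ^ 2 ≤ ‖∑ j, μ j * x j ^ 2‖ := by
        rw [EuclideanSpace.real_norm_sq_eq, Finset.mul_sum]
        exact (Finset.sum_le_sum fun j _ =>
          mul_le_mul_of_nonneg_right (hmj j) (sq_nonneg _)).trans (Real.le_norm_self _)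
      refine (mul_le_mul_of_nonneg_right h3 (norm_nonneg _)).trans ?_
      rw [h2]
      refine (norm_add_le _ _).trans (add_le_add le_rfl ((norm_sum_le _ _).trans ?_))
      rw [Finset.mul_sum]
      refine Finset.sum_le_sum fun j _ => ?_
      rw [norm_mul, norm_mul, Complex.norm_I, one_mul, Complex.norm_real]
      exact mul_le_mul_of_nonneg_right (abs_coord_le x j) (norm_nonneg _)
    have h2 : ρ * ‖c x‖ ≤ ‖c x‖ + m⁻¹ * (‖c1 x‖ + ∑ j, ‖c2 j x‖) := by
      have hS : 0 ≤ ∑ j, ‖c2 j x‖ := Finset.sum_nonneg fun j _ => norm_nonneg _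
      have h3 : ‖x‖ ^ 2 * ‖c x‖ ≤ m⁻¹ * (‖c1 x‖ + ‖x‖ * ∑ j, ‖c2 j x‖) := by
        rw [inv_mul_eq_div, le_div_iff₀ hm]; linarith
      have h4 : m⁻¹ * (‖c1 x‖ + ‖x‖ * ∑ j, ‖c2 j x‖) ≤
          m⁻¹ * (ρ * ‖c1 x‖ + ρ * ∑ j, ‖c2 j x‖) := by
        gcongr
        exact le_mul_of_one_le_left (norm_nonneg _) hρ1
      have h5 : ‖c x‖ ≤ ρ * ‖c x‖ := le_mul_of_one_le_left (norm_nonneg _) hρ1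
      refine le_of_mul_le_mul_left (a := ρ) ?_ (by linarith)
      calc ρ * (ρ * ‖c x‖) = (1 + ‖x‖ ^ 2) * ‖c x‖ := by rw [← hρ2]; ring
        _ ≤ ρ * ‖c x‖ + m⁻¹ * (ρ * ‖c1 x‖ + ρ * ∑ j, ‖c2 j x‖) := by linarith
        _ = _ := by ring
    have hρ0 : 0 ≤ ρ := by linarith
    refine le_trans ?_ (Real.le_norm_self _)
    simp only [norm_mul, Complex.norm_real, Real.norm_of_nonneg (pow_nonneg hρ0 _)]
    rw [← Finset.mul_sum]
    calc ρ ^ (n + 1) * ‖c x‖ = ρ ^ n * (ρ * ‖c x‖) := by ring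
      _ ≤ ρ ^ n * (‖c x‖ + m⁻¹ * (‖c1 x‖ + ∑ j, ‖c2 j x‖)) := by gcongr
      _ = _ := by ring

/-- For `A = Q D`, the wave function of `Q` exists in momentum space, where `D` is multiplication by
a function of polynomial growth; `memLp_momentum` absorbs it. -/
theorem exists_inner_of_mem_ordAlg (hΩ : GappedState (hamEnd k μ f) Ω e Δ σ) (hΔ : 0 < Δ)
    {A : Module.End ℂ (FinVec Λ)} (hA : A ∈ ordAlg Λ) :
    ∃ χ : Fock Λ, ∀ u, inner ℂ χ (toFock u) = inner ℂ Ω (toFock (A u)) := by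
  refine Submodule.mul_induction_on hA (fun Q hQ D hD => ?_) fun A B hA hB => ?_
  · obtain ⟨c, hc⟩ := exists_isMomentum hΩ hΔ hQ
    obtain ⟨q, ⟨hq, C, n, hC, hb⟩, h⟩ := exists_toSch_derAlg hD
    have hm : MemLp (fun x => (starRingEnd ℂ) (q x) * c x) 2 volume := by
      refine (memLp_momentum hΩ hΔ (2 * n) hQ hc).of_le_mul (c := C)
        ((Complex.continuous_conj.comp hq).aestronglyMeasurable.mul (Lp.memLp c).1)
        (.of_forall fun x => ?_)
      rw [norm_mul, norm_mul, RCLike.norm_conj, Complex.norm_real, pow_mul,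
        Real.sq_sqrt (by positivity), Real.norm_of_nonneg (by positivity), ← mul_assoc]
      exact mul_le_mul_of_nonneg_right (hb x) (norm_nonneg _)
    obtain ⟨χ, hχ⟩ := exists_inner_turn (schr.symm (hm.toLp _)) (z := Complex.I) (by simp)
    refine ⟨χ, fun u => ?_⟩
    rw [hχ, inner_schr_symm, inner_toLp, Module.End.mul_apply, ← hc, inner_L2]
    refine integral_congr_ae (.of_forall fun x => ?_)
    simp only [h, map_mul, Complex.conj_conj]
    ring
  · obtain ⟨χ, h1⟩ := hA
    obtain ⟨χ', h2⟩ := hB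
    refine ⟨χ + χ', fun u => ?_⟩
    rw [inner_add_left, h1, h2, LinearMap.add_apply, map_add, inner_add_right]

theorem rapid_ground (hΩ : GappedState (hamEnd k μ f) Ω e Δ σ) (hΔ : 0 < Δ) : Rapid Ω :=
  rapid_of_inner fun m => exists_inner_of_mem_ordAlg hΩ hΔ (wtOp_mem_ordAlg m)

end rapidGround

/-! ### The gap inequality for products of fields and derivatives. -/

section gapRep
variable {W E : Type*} [Ring W] [Algebra ℂ W] [NormedAddCommGroup E] [InnerProductSpace ℂ E]
  [Fintype Λ] [DecidableEq Λ]

/-- A gapped ground state `V 1` of `-∑ μ_j d_j² + F` with energy `e` and gap `Δ`, where the operators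
`A` of an algebra act as `V A`, and `q`, `d` are canonically conjugate. -/
structure GapRep (V : W →ₗ[ℂ] E) (q d : Λ → W) (F : W) (μ : Λ → ℝ) (e Δ : ℝ) : Prop where
  q_comm : ∀ i j, q i * q j = q j * q i
  d_comm : ∀ i j, d i * d j = d j * d i
  d_q : ∀ i j, d i * q j = q j * d i + if i = j then 1 else 0
  F_q : ∀ j, F * q j = q j * F
  inner_q : ∀ j A B, inner ℂ (V (q j * A)) (V B) = inner ℂ (V A) (V (q j * B))
  inner_d : ∀ j A B, inner ℂ (V (d j * A)) (V B) = -inner ℂ (V A) (V (d j * B))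
  norm_one : ‖V 1‖ = 1
  mean_q : ∀ j, inner ℂ (V 1) (V (q j)) = 0
  mean_d : ∀ j, inner ℂ (V 1) (V (d j)) = 0
  gap : ∀ A, Δ * (‖V A‖ ^ 2 - ‖inner ℂ (V 1) (V A)‖ ^ 2) ≤
    ∑ j, μ j * ‖V (d j * A)‖ ^ 2 + (inner ℂ (V A) (V (F * A))).re - e * ‖V A‖ ^ 2
  eigen : ∀ A, ∑ j, (-(μ j : ℂ)) * inner ℂ (V A) (V (d j * d j)) + inner ℂ (V A) (V F) =
    (e : ℂ) * inner ℂ (V A) (V 1)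

variable {V : W →ₗ[ℂ] E} {q d : Λ → W} {F : W} {μ : Λ → ℝ} {e Δ : ℝ}

/-- The product of the fields along a list. -/
def fieldProd (q : Λ → W) (l : List Λ) : W := (l.map q).prod

omit [Algebra ℂ W] [Fintype Λ] [DecidableEq Λ] in
theorem fieldProd_cons (q : Λ → W) (i : Λ) (l : List Λ) : fieldProd q (i :: l) = q i * fieldProd q l := by
  simp [fieldProd]

omit [Algebra ℂ W] [Fintype Λ] [DecidableEq Λ] in
theorem fieldProd_append (q : Λ → W) (l l' : List Λ) : fieldProd q (l ++ l') = fieldProd q l * fieldProd q l' := by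
  simp [fieldProd]

namespace GapRep
variable (G : GapRep V q d F μ e Δ)
include G

theorem fieldProd_perm {l l' : List Λ} (h : l.Perm l') : fieldProd q l = fieldProd q l' := by
  rw [fieldProd, fieldProd]
  refine (h.map q).prod_eq' ?_
  refine List.Pairwise.imp_mem.2 (List.pairwise_of_forall fun a b ha hb => ?_)
  obtain ⟨i, _, rfl⟩ := List.mem_map.1 ha
  obtain ⟨j, _, rfl⟩ := List.mem_map.1 hb
  exact G.q_comm i j

theorem fieldProd_comm (l l' : List Λ) : fieldProd q l * fieldProd q l' = fieldProd q l' * fieldProd q l := by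
  rw [← fieldProd_append, ← fieldProd_append]
  exact G.fieldProd_perm List.perm_append_comm

theorem F_fieldProd (l : List Λ) : F * fieldProd q l = fieldProd q l * F := by
  induction l with
  | nil => simp [fieldProd]
  | cons i l ih => rw [fieldProd_cons, ← mul_assoc, G.F_q, mul_assoc, ih, mul_assoc]

theorem inner_fieldProd (l : List Λ) (A B : W) :
    inner ℂ (V (fieldProd q l * A)) (V B) = inner ℂ (V A) (V (fieldProd q l * B)) := by
  induction l generalizing A B with
  | nil => simp [fieldProd]
  | cons i l ih =>
    have h : fieldProd q (i :: l) * B = fieldProd q l * (q i * B) := by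
      rw [← mul_assoc]
      have h1 : fieldProd q [i] = q i := by simp [fieldProd]
      rw [← h1, ← fieldProd_append, G.fieldProd_perm (l' := l ++ [i])]
      exact (List.perm_append_singleton i l).symm
    rw [h, fieldProd_cons, mul_assoc, G.inner_q, ih]

theorem inner_d_pow (i : Λ) (a : ℕ) (A B : W) :
    inner ℂ (V (d i ^ a * A)) (V B) = (-1 : ℂ) ^ a * inner ℂ (V A) (V (d i ^ a * B)) := by
  induction a generalizing A B with
  | zero => simp
  | succ a ih =>
    rw [pow_succ', mul_assoc, G.inner_d, ih, ← mul_assoc (d i ^ a), ← pow_succ, pow_succ']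
    ring

theorem d_fieldProd (j : Λ) (l : List Λ) :
    d j * fieldProd q l = fieldProd q l * d j + (l.count j : W) * fieldProd q (l.erase j) := by
  induction l with
  | nil => simp [fieldProd]
  | cons i l ih =>
    rw [fieldProd_cons, ← mul_assoc, G.d_q, add_mul, mul_assoc, ih, mul_add, ← mul_assoc, add_assoc]
    congr 1
    by_cases h : j = i
    · subst h
      rw [if_pos rfl, one_mul, List.count_cons_self, List.erase_cons_head,
        (Nat.cast_commute (l.count j) (q j)).symm.left_comm, ← fieldProd_cons]
      rcases Nat.eq_zero_or_pos (l.count j) with h0 | h0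
      · simp [h0]
      · rw [← G.fieldProd_perm (List.perm_cons_erase (List.count_pos_iff.1 h0))]
        push_cast
        noncomm_ring
    · rw [if_neg h, zero_mul, add_zero, List.count_cons_of_ne (Ne.symm h),
        List.erase_cons_tail (by simpa using Ne.symm h), fieldProd_cons,
        (Nat.cast_commute (l.count j) (q i)).symm.left_comm]

/-- This is the engine of the moment bounds. As in the Poincaré inequality, the terms linear in `g'`
cancel; what remains of `H - e` is its commutator with `D`, and only `F` contributes to it because
the derivatives commute. -/
theorem gap_mul {g D : W} {g' : Λ → W} {z : ℂ} (hz : z ≠ 0)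
    (hg : ∀ A B, inner ℂ (V (g * A)) (V B) = inner ℂ (V A) (V (g * B)))
    (hgF : F * g = g * F) (hdg : ∀ j, d j * g = g * d j + g' j) (hgg : ∀ j, g' j * g = g * g' j)
    (hD : ∀ A B, inner ℂ (V (D * A)) (V B) = z * inner ℂ (V A) (V (D * B)))
    (hdD : ∀ j, d j * D = D * d j) :
    Δ * (‖V (g * D)‖ ^ 2 - ‖inner ℂ (V 1) (V (g * D))‖ ^ 2) ≤
      ∑ j, μ j * ‖V (g' j * D)‖ ^ 2 + (inner ℂ (V (g * (g * D))) (V (F * D - D * F))).re := by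
  have e2 : ∀ A B : W, (inner ℂ (V A) (V B)).re = (inner ℂ (V B) (V A)).re :=
    fun A B => by rw [← inner_conj_symm, Complex.conj_re]
  have e3 : ∀ A : W, ‖V A‖ ^ 2 = (inner ℂ (V A) (V A)).re := fun A => by
    rw [inner_self_eq_norm_sq_to_K]; norm_cast
  have h1 := G.gap (g * D)
  -- The leftmost `D` crosses to the other side with the sign `z`, which cancels from the equation;
  -- the result is `⟨g² D Ω, D (H - e) Ω⟩ = 0`.
  have h2 := G.eigen (D * (g * (g * D)))
  simp only [hD] at h2
  have h3 : ∑ j, (-(μ j : ℂ)) * inner ℂ (V (g * (g * D))) (V (D * (d j * d j))) +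
      inner ℂ (V (g * (g * D))) (V (D * F)) = (e : ℂ) * inner ℂ (V (g * (g * D))) (V (D * 1)) := by
    apply mul_left_cancel₀ hz
    rw [mul_add, Finset.mul_sum]
    rw [mul_left_comm, ← h2]
    congr 1
    exact Finset.sum_congr rfl fun j _ => by ring
  have h4 := congrArg Complex.re h3
  have h5 : ∀ j, ((-(μ j : ℂ)) * inner ℂ (V (g * (g * D))) (V (D * (d j * d j)))).re =
      μ j * (‖V (g * (d j * D))‖ ^ 2 + 2 * (inner ℂ (V (g * (d j * D))) (V (g' j * D))).re) := by
    intro j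
    have h6 : D * (d j * d j) = d j * (d j * D) := by
      rw [← mul_assoc, ← hdD, mul_assoc, ← hdD]
    have h7 : d j * (g * (g * D)) = g * (g * (d j * D)) + g * (g' j * D) + g * (g' j * D) := by
      rw [← mul_assoc, hdg, add_mul, mul_assoc g, ← mul_assoc (d j) g, hdg, ← mul_assoc (g' j), hgg]
      noncomm_ring
    have h8 : inner ℂ (V (g * (g * D))) (V (d j * (d j * D))) =
        -inner ℂ (V (d j * (g * (g * D)))) (V (d j * D)) := by
      rw [G.inner_d, neg_neg]
    rw [h6, h8, h7, neg_mul_neg, Complex.re_ofReal_mul]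
    congr 1
    simp only [map_add, inner_add_left, Complex.add_re, hg]
    rw [e3, hg, e2 (g' j * D) (g * (d j * D)), hg]
    ring
  have h9 : inner ℂ (V (g * (g * D))) (V (D * 1)) = inner ℂ (V (g * D)) (V (g * D)) := by
    rw [mul_one, hg]
  rw [Complex.add_re, Complex.re_sum, h9, Complex.re_ofReal_mul, ← e3] at h4
  simp only [h5] at h4
  have h10 : ∀ j, ‖V (d j * (g * D))‖ ^ 2 = ‖V (g * (d j * D))‖ ^ 2 +
      2 * (inner ℂ (V (g * (d j * D))) (V (g' j * D))).re + ‖V (g' j * D)‖ ^ 2 := by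
    intro j
    rw [← mul_assoc, hdg, add_mul, mul_assoc, map_add, e3 (g * (d j * D)), e3 (g' j * D),
      ← Complex.ofReal_re (‖_‖ ^ 2)]
    have := inner_self_eq_norm_sq_to_K (𝕜 := ℂ) (V (g * (d j * D)) + V (g' j * D))
    push_cast
    rw [← Complex.coe_algebraMap, ← this]
    simp only [inner_add_left, inner_add_right, Complex.add_re]
    rw [e2 (g' j * D) (g * (d j * D))]
    ring
  have h11 : (inner ℂ (V (g * D)) (V (F * (g * D)))).re =
      (inner ℂ (V (g * (g * D))) (V (F * D))).re := by
    rw [← mul_assoc, hgF, mul_assoc, hg (g * D)]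
  rw [map_sub, inner_sub_right, Complex.sub_re]
  simp only [h10, h11, mul_add, Finset.sum_add_distrib] at h1 h4 ⊢
  linarith

end GapRep
end gapRep

/-! ### Degree and coefficient bounds for iterated commutators. -/

section poly
variable {W E : Type*} [Ring W] [Algebra ℂ W] [NormedAddCommGroup E] [InnerProductSpace ℂ E]

/-- `Poly q n C A`: `A` is a real combination of products of at most `n` fields, each of the parity of
`n`, with coefficients of total absolute value at most `C`. -/
inductive Poly (q : Λ → W) : ℕ → ℝ → W → Prop
  | mono (l : List Λ) : Poly q l.length 1 (fieldProd q l)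
  | zero (n : ℕ) : Poly q n 0 0
  | add {n : ℕ} {C C' : ℝ} {A B : W} : Poly q n C A → Poly q n C' B → Poly q n (C + C') (A + B)
  | smul {n : ℕ} {C : ℝ} {A : W} (c : ℝ) : Poly q n C A → Poly q n (|c| * C) ((c : ℂ) • A)
  | weaken {n : ℕ} {C C' : ℝ} {A : W} (j : ℕ) : C ≤ C' → Poly q n C A → Poly q (n + 2 * j) C' A

theorem Poly.nonneg {q : Λ → W} {n : ℕ} {C : ℝ} {A : W} (h : Poly q n C A) : 0 ≤ C := by
  induction h with
  | mono l => exact zero_le_one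
  | zero n => exact le_rfl
  | add _ _ h1 h2 => exact add_nonneg h1 h2
  | smul c _ h => positivity
  | weaken j hC _ h => exact h.trans hC

theorem Poly.sum {q : Λ → W} {n : ℕ} {ι : Type*} (s : Finset ι) {C : ι → ℝ} {A : ι → W}
    (h : ∀ x ∈ s, Poly q n (C x) (A x)) : Poly q n (∑ x ∈ s, C x) (∑ x ∈ s, A x) := by
  classical
  induction s using Finset.induction_on with
  | empty => simpa using Poly.zero n
  | insert x s hx ih =>
    rw [Finset.sum_insert hx, Finset.sum_insert hx]
    exact (h x (Finset.mem_insert_self x s)).add (ih fun y hy => h y (Finset.mem_insert_of_mem hy))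

theorem Poly.le {q : Λ → W} {n : ℕ} {C C' : ℝ} {A : W} (h : Poly q n C A) (hC : C ≤ C') :
    Poly q n C' A := h.weaken 0 hC

theorem Poly.fieldProd_mul {q : Λ → W} {n : ℕ} {C : ℝ} {A : W} (h : Poly q n C A) (l : List Λ) :
    Poly q (l.length + n) C (fieldProd q l * A) := by
  induction h with
  | mono m => rw [← fieldProd_append, ← List.length_append]; exact .mono _
  | zero n => rw [mul_zero]; exact .zero _
  | add _ _ h1 h2 => rw [mul_add]; exact h1.add h2
  | smul c _ h => rw [mul_smul_comm]; exact h.smul c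
  | weaken j hC _ h => rw [← add_assoc]; exact h.weaken j hC

theorem Poly.abs_re_le {q : Λ → W} {n : ℕ} {C : ℝ} {A : W} (h : Poly q n C A) (Φ : W →ₗ[ℂ] ℂ)
    {B : ℝ} (h0 : 0 ≤ B) (hB : ∀ l : List Λ, l.length ≤ n → Even (l.length + n) → |(Φ (fieldProd q l)).re| ≤ B) :
    |(Φ A).re| ≤ C * B := by
  induction h with
  | mono l => rw [one_mul]; exact hB l le_rfl (Even.add_self _)
  | zero n => simp
  | add _ _ h1 h2 =>
    rw [map_add, Complex.add_re, add_mul]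
    exact (abs_add_le _ _).trans (add_le_add (h1 hB) (h2 hB))
  | smul c _ h =>
    rw [map_smul, smul_eq_mul, Complex.re_ofReal_mul, abs_mul, mul_assoc]
    exact mul_le_mul_of_nonneg_left (h hB) (abs_nonneg c)
  | @weaken n C C' A j hC hp h =>
    have h1 := h fun l hl he => hB l (by omega) (by
      rw [← add_assoc]; exact he.add (even_two_mul j))
    exact h1.trans (mul_le_mul_of_nonneg_right hC h0)

/-- The commutator with an element, as a linear map. -/
def adE (x : W) : Module.End ℂ W := LinearMap.mulLeft ℂ x - LinearMap.mulRight ℂ x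

theorem adE_apply (x A : W) : adE x A = x * A - A * x := rfl

/-- Left multiplication by `x` is the sum of the commuting operators `adE x` and right
multiplication by `x`, so the binomial theorem applies. -/
theorem pow_mul_eq_sum_adE (x A : W) (a : ℕ) :
    x ^ a * A = ∑ m ∈ Finset.range (a + 1), (a.choose m : ℂ) • ((adE x ^ m) A * x ^ (a - m)) := by
  have h0 : Commute (adE x) (LinearMap.mulRight ℂ x) := by
    refine LinearMap.ext fun B => ?_
    simp only [Module.End.mul_apply, adE_apply, LinearMap.mulRight_apply]
    noncomm_ring
  have h1 : adE x + LinearMap.mulRight ℂ x = LinearMap.mulLeft ℂ x := by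
    refine LinearMap.ext fun B => ?_
    simp only [LinearMap.add_apply, adE_apply, LinearMap.mulRight_apply, LinearMap.mulLeft_apply]
    abel
  have h2 := LinearMap.congr_fun (h0.add_pow a) A
  rw [h1, LinearMap.pow_mulLeft, LinearMap.mulLeft_apply, LinearMap.sum_apply] at h2
  rw [h2]
  refine Finset.sum_congr rfl fun m _ => ?_
  rw [(Nat.cast_commute (a.choose m) _).symm.eq, Module.End.mul_apply, h0.pow_pow m (a - m),
    Module.End.mul_apply, LinearMap.pow_mulRight, LinearMap.mulRight_apply,
    Module.End.natCast_apply, Nat.cast_smul_eq_nsmul]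

variable [Fintype Λ] [DecidableEq Λ] {V : W →ₗ[ℂ] E} {q d : Λ → W} {F : W} {μ : Λ → ℝ} {e Δ : ℝ}

theorem GapRep.adE_fieldProd (G : GapRep V q d F μ e Δ) (i : Λ) (l : List Λ) :
    adE (d i) (fieldProd q l) = (((l.count i : ℝ)) : ℂ) • fieldProd q (l.erase i) := by
  rw [adE_apply, G.d_fieldProd, add_sub_cancel_left, Complex.ofReal_natCast, Nat.cast_smul_eq_nsmul,
    nsmul_eq_mul]

/-- The degree-zero case is recorded separately: `n - 1` truncates there, and after `weaken` the
parity of the degree would otherwise be lost. -/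
theorem Poly.adE (G : GapRep V q d F μ e Δ) (i : Λ) {n : ℕ} {C : ℝ} {A : W} (h : Poly q n C A) :
    Poly q (n - 1) (n * C) (adE (d i) A) ∧ (n = 0 → Phi4.adE (d i) A = 0) := by
  induction h with
  | mono l =>
    rw [G.adE_fieldProd, mul_one]
    by_cases hi : i ∈ l
    · refine ⟨?_, fun h => ?_⟩
      · rw [← List.length_erase_of_mem hi]
        refine ((Poly.mono (q := q) (l.erase i)).smul _).le ?_
        rw [mul_one, abs_of_nonneg (by positivity)]
        exact_mod_cast List.count_le_length
      · rw [List.length_eq_zero_iff] at h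
        simp [h] at hi
    · rw [List.count_eq_zero_of_not_mem hi, Nat.cast_zero, Complex.ofReal_zero, zero_smul]
      exact ⟨(Poly.zero _).le (by positivity), fun _ => rfl⟩
  | zero n => rw [map_zero, mul_zero]; exact ⟨.zero _, fun _ => rfl⟩
  | add _ _ h1 h2 =>
    rw [map_add, mul_add]
    exact ⟨h1.1.add h2.1, fun h => by rw [h1.2 h, h2.2 h, add_zero]⟩
  | smul c _ h =>
    rw [map_smul, mul_left_comm]
    exact ⟨h.1.smul c, fun h0 => by rw [h.2 h0, smul_zero]⟩
  | @weaken n C C' A j hC hp h =>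
    have hn := hp.nonneg
    refine ⟨?_, fun h0 => h.2 (by omega)⟩
    rcases Nat.eq_zero_or_pos n with h0 | h0
    · rw [h.2 h0]
      exact (Poly.zero _).le (by have := hn.trans hC; positivity)
    · have h1 : n + 2 * j - 1 = n - 1 + 2 * j := by omega
      rw [h1]
      refine h.1.weaken j ?_
      push_cast
      have : (0 : ℝ) ≤ j := by positivity
      nlinarith

/-- The induction starts at the first commutator rather than at `F`: only the monomials containing
the site `i` survive there, so a local bound on the couplings suffices. -/
theorem Poly.adE_pow (G : GapRep V q d F μ e Δ) (i : Λ) {h : ℕ} {fb : ℝ} (h1 : 1 ≤ h)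
    (hF : Poly q (2 * h - 1) (2 * h * fb) (Phi4.adE (d i) F)) (m : ℕ) (hm : 1 ≤ m) :
    Poly q (2 * h - m) ((2 * h) ^ m * fb) ((Phi4.adE (d i) ^ m) F) ∧
      (2 * h < m → (Phi4.adE (d i) ^ m) F = 0) := by
  have hfb : 0 ≤ fb := by
    have := hF.nonneg
    have h2 : (0 : ℝ) < 2 * h := by positivity
    exact nonneg_of_mul_nonneg_right this h2
  induction m, hm using Nat.le_induction with
  | base => exact ⟨by simpa using hF, fun h => by omega⟩
  | succ m hm ih =>
    rw [pow_succ' (Phi4.adE (d i)), Module.End.mul_apply]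
    have h2 := Poly.adE G i ih.1
    refine ⟨?_, fun h3 => ?_⟩
    · rw [← Nat.sub_sub]
      refine h2.1.le ?_
      rw [pow_succ']
      have h4 : ((2 * h - m : ℕ) : ℝ) ≤ 2 * h := by
        have : 2 * h - m ≤ 2 * h := Nat.sub_le _ _
        exact_mod_cast this
      calc _ ≤ 2 * (h : ℝ) * ((2 * h) ^ m * fb) := by gcongr
        _ = _ := by ring
    · exact h2.2 (by omega)

end poly

/-! ### Numerical constants of the moment induction. -/

/-- The numerical constants of the moment bound: `P`, `κ` are the weights of a momentum and a field,
and `w` bounds the total weight of the monomials considered. -/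
structure MomentScale (μ : Λ → ℝ) (Δ fb P s κ : ℝ) (h w : ℕ) : Prop where
  P_ge : 7 / 10 ≤ P
  s_nonneg : 0 ≤ s
  κ_eq : κ = 8 * w * (4 * s + 1)
  one_le_h : 1 ≤ h
  one_le_w : 1 ≤ w
  Δ_pos : 0 < Δ
  μ_le : ∀ j, μ j ≤ s ^ 2 * Δ
  fb_le : fb ≤ P ^ 2 * (s ^ 2 * Δ)

namespace MomentScale
variable {μ : Λ → ℝ} {Δ fb P s κ : ℝ} {h w : ℕ} (S : MomentScale μ Δ fb P s κ h w)
include S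

theorem P_pos : 0 < P := by have := S.P_ge; linarith

theorem w_le : 8 * (w : ℝ) ≤ κ := by
  have h1 := S.s_nonneg
  have h2 : (0 : ℝ) ≤ w := by positivity
  rw [S.κ_eq]
  nlinarith

theorem s_le : 32 * w * s ≤ κ := by
  have h2 : (0 : ℝ) ≤ w := by positivity
  rw [S.κ_eq]
  nlinarith

theorem κ_ge : 8 ≤ κ := by
  have h1 : (1 : ℝ) ≤ w := by exact_mod_cast S.one_le_w
  have := S.w_le
  linarith

theorem κ_pos : 0 < κ := by have := S.κ_ge; linarith

theorem κ_le_pow : κ ≤ κ ^ h :=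
  le_self_pow₀ (by have := S.κ_ge; linarith) (by have := S.one_le_h; omega)

theorem bound_nonneg (c n : ℕ) : 0 ≤ P ^ c * κ ^ n := by
  have := S.P_pos
  have := S.κ_pos
  positivity

/-- The price of a commutator `[∂, φ]`: a field and a derivative disappear at the cost of a
multiplicity at most `2 w`, while `P κ^(1+h) ≥ (7/10) · 8 · 8 w > 20 · 2 w`. -/
theorem step {x : ℝ} (hx : x ≤ 2 * w) (τ n : ℕ) :
    x * (P ^ τ * κ ^ n) ≤ 1 / 20 * (P ^ (τ + 1) * κ ^ (n + 1 + h)) := by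
  have h1 := S.P_pos
  have h2 := S.κ_pos
  have h4 : x ≤ 1 / 20 * (P * (κ * κ ^ h)) := by
    have h5 : 7 / 10 * (κ * 8) ≤ P * (κ * κ ^ h) := by
      have := S.P_ge
      have := S.κ_le_pow
      have := S.κ_ge
      gcongr
      linarith
    have := S.w_le
    linarith
  calc x * (P ^ τ * κ ^ n) ≤ 1 / 20 * (P * (κ * κ ^ h)) * (P ^ τ * κ ^ n) :=
        mul_le_mul_of_nonneg_right h4 (S.bound_nonneg _ _)
    _ = _ := by ring

/-- The term of order `m = 2 + j` in the expansion of `[F, ∂^a]` with `a = m + c`. Relative to the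
square of the target bound it lacks `P^m κ^(m + h j)`, which must pay for the binomial coefficient,
the commutator constants and `fb`, and leave a geometric factor in `j`. -/
theorem choose_step {j c b : ℕ} (hw : b + h * (2 + j + c) ≤ w) (hj : 2 + j ≤ 2 * h) :
    ((2 + j + c).choose (2 + j) : ℝ) * ((2 * h) ^ (2 + j) * fb *
      (2 ^ (2 + j) * P ^ (2 + j + 2 * c) * κ ^ (2 * b + 2 * h - (2 + j) + h * (2 + j + 2 * c)))) ≤
    1 / 128 * (1 / 8) ^ j * (Δ * (P ^ (2 + j + c) * κ ^ (b + h * (2 + j + c))) ^ 2) := by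
  have h1 := S.P_pos
  have h2 := S.κ_pos
  have h3 := S.s_nonneg
  have hD := S.Δ_pos
  set a := 2 + j + c with ha
  set m := 2 + j with hm
  -- Here `m ! ≥ 2` because `m ≥ 2`.
  have hch : (a.choose m : ℝ) ≤ 1 / 2 * (a : ℝ) ^ m := by
    refine (Nat.choose_le_pow_div m a).trans ?_
    have h5 : (2 : ℝ) ≤ (m.factorial : ℝ) := by
      have : Nat.factorial 2 ≤ m.factorial := Nat.factorial_le (by omega)
      exact_mod_cast this
    rw [div_le_iff₀ (by linarith)]
    have : (0 : ℝ) ≤ (a : ℝ) ^ m := by positivity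
    nlinarith
  have hha : ((h * a : ℕ) : ℝ) ≤ w := by
    have : h * a ≤ w := by omega
    exact_mod_cast this
  have hcw : (a.choose m : ℝ) * (4 * h) ^ m ≤ 1 / 2 * (4 * w : ℝ) ^ m := by
    calc (a.choose m : ℝ) * (4 * h) ^ m ≤ 1 / 2 * (a : ℝ) ^ m * (4 * h) ^ m := by gcongr
      _ = 1 / 2 * (4 * ((h * a : ℕ) : ℝ)) ^ m := by push_cast; rw [mul_assoc, ← mul_pow]; ring
      _ ≤ _ := by gcongr
  -- Write `κ = 4w · 2(4s+1)`: two of the factors `2(4s+1)` give `64 s²`, the other `j` give `2`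
  -- each.
  have hκm : (4 * w : ℝ) ^ m * (64 * s ^ 2) * 2 ^ j ≤ κ ^ m := by
    have h5 : κ ^ m = (4 * w : ℝ) ^ m * (2 * (4 * s + 1)) ^ 2 * (2 * (4 * s + 1)) ^ j := by
      rw [mul_assoc, ← pow_add, ← hm, ← mul_pow, S.κ_eq]; ring
    rw [h5]
    gcongr
    · nlinarith
    · linarith
  -- Since `P κ^h ≥ (7/10) · 8`. Combined with the powers of `2` above, `2 · 5 ≥ 8` yields the ratio
  -- `1/8`.
  have hPj : (5 : ℝ) ^ j ≤ P ^ j * κ ^ (h * j) := by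
    rw [pow_mul, ← mul_pow]
    have h5 : (5 : ℝ) ≤ P * κ ^ h := by
      have := S.P_ge
      have := S.κ_le_pow
      have := S.κ_ge
      nlinarith
    gcongr
  have hexp : 2 * b + 2 * h - m + h * (m + 2 * c) + (m + h * j) = 2 * (b + h * a) := by
    have : 2 * b + 2 * h - m + m = 2 * b + 2 * h := by omega
    calc _ = 2 * b + 2 * h - m + m + h * (m + 2 * c) + h * j := by ring
      _ = 2 * b + 2 * h + h * (m + 2 * c) + h * j := by rw [this]
      _ = _ := by rw [ha, hm]; ring
  have hkey : (a.choose m : ℝ) * (4 * h) ^ m * s ^ 2 ≤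
      1 / 128 * (1 / 8) ^ j * (P ^ j * (κ ^ m * κ ^ (h * j))) := by
    calc (a.choose m : ℝ) * (4 * h) ^ m * s ^ 2 ≤ 1 / 2 * (4 * w : ℝ) ^ m * s ^ 2 := by gcongr
      _ = 1 / 128 * ((4 * w : ℝ) ^ m * (64 * s ^ 2)) := by ring
      _ = 1 / 128 * (1 / 8) ^ j * (((4 * w : ℝ) ^ m * (64 * s ^ 2)) * 8 ^ j) := by
          have h8 : (1 / 8 : ℝ) ^ j * 8 ^ j = 1 := by rw [← mul_pow]; norm_num
          linear_combination (-(1 / 128 * ((4 * w : ℝ) ^ m * (64 * s ^ 2)))) * h8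
      _ ≤ 1 / 128 * (1 / 8) ^ j * (((4 * w : ℝ) ^ m * (64 * s ^ 2)) * (2 ^ j * 5 ^ j)) := by
          rw [← mul_pow]
          gcongr
          norm_num
      _ = 1 / 128 * (1 / 8) ^ j * (((4 * w : ℝ) ^ m * (64 * s ^ 2) * 2 ^ j) * 5 ^ j) := by ring
      _ ≤ 1 / 128 * (1 / 8) ^ j * (κ ^ m * (P ^ j * κ ^ (h * j))) := by gcongr
      _ = _ := by ring
  have hT : (P ^ a * κ ^ (b + h * a)) ^ 2 =
      (P ^ (m + 2 * c) * P ^ 2 * P ^ j) *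
        (κ ^ (2 * b + 2 * h - m + h * (m + 2 * c)) * (κ ^ m * κ ^ (h * j))) := by
    rw [mul_pow, ← pow_mul κ, mul_comm (b + h * a) 2, ← hexp]
    rw [pow_add κ _ (m + h * j), pow_add κ m (h * j), ← pow_mul P, ← pow_add P, ← pow_add P]
    congr 2
    omega
  rw [hT]
  set K := κ ^ (2 * b + 2 * h - m + h * (m + 2 * c))
  have hK : 0 ≤ K := by positivity
  calc (a.choose m : ℝ) * ((2 * h) ^ m * fb * (2 ^ m * P ^ (m + 2 * c) * K))
      = (a.choose m : ℝ) * (4 * h) ^ m * (fb * (P ^ (m + 2 * c) * K)) := by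
        have : (4 * h : ℝ) ^ m = (2 * h) ^ m * 2 ^ m := by rw [← mul_pow]; ring
        rw [this]; ring
    _ ≤ (a.choose m : ℝ) * (4 * h) ^ m * (P ^ 2 * (s ^ 2 * Δ) * (P ^ (m + 2 * c) * K)) := by
        have := S.fb_le
        gcongr
    _ = (a.choose m : ℝ) * (4 * h) ^ m * s ^ 2 * (Δ * P ^ 2 * (P ^ (m + 2 * c) * K)) := by ring
    _ ≤ 1 / 128 * (1 / 8) ^ j * (P ^ j * (κ ^ m * κ ^ (h * j))) *
        (Δ * P ^ 2 * (P ^ (m + 2 * c) * K)) := by gcongr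
    _ = _ := by ring

end MomentScale

/-! ### Correlations of fields between powers of a derivative. -/

section corr
variable {W E : Type*} [Ring W] [Algebra ℂ W] [NormedAddCommGroup E] [InnerProductSpace ℂ E]
variable [Fintype Λ] [DecidableEq Λ] {V : W →ₗ[ℂ] E} {q d : Λ → W} {F : W} {μ : Λ → ℝ} {e Δ : ℝ}

/-- The correlation of a product of fields between two powers of a momentum. -/
def corr (V : W →ₗ[ℂ] E) (q d : Λ → W) (i : Λ) (l : List Λ) (α β : ℕ) : ℝ :=
  (inner ℂ (V (d i ^ α)) (V (fieldProd q l * d i ^ β))).re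

omit [Fintype Λ] [DecidableEq Λ] in
theorem re_inner_comm (x y : E) : (inner ℂ x y).re = (inner ℂ y x).re := by
  rw [← inner_conj_symm, Complex.conj_re]

variable (G : GapRep V q d F μ e Δ)
include G

theorem corr_symm (i : Λ) (l : List Λ) (α β : ℕ) : corr V q d i l α β = corr V q d i l β α := by
  rw [corr, corr, re_inner_comm, G.inner_fieldProd]

/-- Integration by parts: one derivative crosses from left to right, with a term in which it removes
a field. -/
theorem corr_succ (i : Λ) (l : List Λ) (α β : ℕ) :
    corr V q d i l (α + 1) β =
      -corr V q d i l α (β + 1) - l.count i * corr V q d i (l.erase i) α β := by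
  have h1 : d i * (fieldProd q l * d i ^ β) =
      fieldProd q l * d i ^ (β + 1) + (((l.count i : ℝ)) : ℂ) • (fieldProd q (l.erase i) * d i ^ β) := by
    rw [← mul_assoc, G.d_fieldProd, add_mul, mul_assoc, ← pow_succ', mul_assoc, Complex.ofReal_natCast,
      Nat.cast_smul_eq_nsmul, nsmul_eq_mul]
  rw [corr, corr, corr, pow_succ', G.inner_d, h1, map_add, map_smul, inner_add_right,
    inner_smul_right, Complex.neg_re, Complex.add_re, Complex.re_ofReal_mul]
  ring

variable {fb P s κ : ℝ} {h w : ℕ} (S : MomentScale μ Δ fb P s κ h w)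
include S

/-- Cauchy–Schwarz after splitting the fields into two equal halves, one for each side; this is why
the number of fields must be even. -/
theorem abs_corr_diag_le (i : Λ) {a : ℕ}
    (hyp : ∀ (l : List Λ) (c : ℕ), c < a → l.length + h * c ≤ w →
      ‖V (fieldProd q l * d i ^ c)‖ ≤ P ^ c * κ ^ (l.length + h * c))
    {β : ℕ} {m : List Λ} (hm : Even m.length) (hβ : β < a)
    (hw : m.length + h * (2 * β) ≤ 2 * w) :
    |corr V q d i m β β| ≤ P ^ (2 * β) * κ ^ (m.length + h * (2 * β)) := by
  obtain ⟨n, hn⟩ := hm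
  have h0 : h * (2 * β) = 2 * (h * β) := by ring
  have h1 : (m.take n).length = n := by rw [List.length_take]; omega
  have h2 : (m.drop n).length = n := by rw [List.length_drop]; omega
  have h3 : corr V q d i m β β =
      (inner ℂ (V (fieldProd q (m.take n) * d i ^ β)) (V (fieldProd q (m.drop n) * d i ^ β))).re := by
    rw [G.inner_fieldProd, ← mul_assoc, ← fieldProd_append, List.take_append_drop, corr]
  rw [h3]
  refine (Complex.abs_re_le_norm _).trans ((norm_inner_le_norm _ _).trans ?_)
  have h4 := hyp (m.take n) β hβ (by omega)
  have h5 := hyp (m.drop n) β hβ (by omega)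
  rw [h1] at h4
  rw [h2] at h5
  refine (mul_le_mul h4 h5 (norm_nonneg _) (S.bound_nonneg _ _)).trans (le_of_eq ?_)
  rw [hn]
  ring

/-- By symmetry of the real part, the two correlations in `corr_succ` coincide, so the principal
term cancels and only half of the commutator term is left. The result contains no extra derivative.
-/
theorem abs_corr_succ_le (i : Λ) {a : ℕ}
    (hyp : ∀ (l : List Λ) (c : ℕ), c < a → l.length + h * c ≤ w →
      ‖V (fieldProd q l * d i ^ c)‖ ≤ P ^ c * κ ^ (l.length + h * c))
    {β : ℕ} {m : List Λ} (hm : Even (m.length + 1)) (hβ : β < a)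
    (hw : m.length + h * (2 * β) ≤ 2 * w + 1) :
    |corr V q d i m (β + 1) β| ≤
      m.length / 2 * (P ^ (2 * β) * κ ^ (m.length - 1 + h * (2 * β))) := by
  have h1 := corr_succ G i m β β
  rw [corr_symm G i m β (β + 1)] at h1
  have h2 : corr V q d i m (β + 1) β = -(m.count i / 2 * corr V q d i (m.erase i) β β) := by
    linarith
  rw [h2, abs_neg, abs_mul, abs_of_nonneg (by positivity)]
  by_cases hi : i ∈ m
  · have h3 := List.length_erase_of_mem hi
    have h5 : 0 < m.length := List.length_pos_of_mem hi
    have h4 := abs_corr_diag_le G S i hyp (β := β) (m := m.erase i)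
      (by rw [h3]; obtain ⟨n, hn⟩ := hm; exact ⟨n - 1, by omega⟩) hβ (by omega)
    rw [h3] at h4
    have h6 : (m.count i : ℝ) ≤ m.length := by exact_mod_cast List.count_le_length
    gcongr
  · rw [List.count_eq_zero_of_not_mem hi]
    simp only [Nat.cast_zero, zero_div, zero_mul]
    have := S.bound_nonneg (2 * β) (m.length - 1 + h * (2 * β))
    positivity

/-- The numbers of derivatives on the two sides are balanced by integration by parts, down to a
difference of `0` or `1`. The condition `2 * β + δ < 2 * a` keeps the balanced powers below `a`,
where `hyp` applies, and the factor `2 ^ δ` absorbs the commutator terms. -/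
theorem abs_corr_le (i : Λ) {a : ℕ}
    (hyp : ∀ (l : List Λ) (c : ℕ), c < a → l.length + h * c ≤ w →
      ‖V (fieldProd q l * d i ^ c)‖ ≤ P ^ c * κ ^ (l.length + h * c)) (δ : ℕ) :
    ∀ (β : ℕ) (m : List Λ), Even (m.length + δ) → 2 * β + δ < 2 * a →
      m.length + h * (2 * β + δ) ≤ 2 * w →
      |corr V q d i m (β + δ) β| ≤
        2 ^ δ * P ^ (2 * β + δ) * κ ^ (m.length + h * (2 * β + δ)) := by
  induction δ using Nat.strong_induction_on with
  | _ δ ih =>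
  intro β m hm hβ hw
  have hwm : (m.length : ℝ) ≤ 2 * w := by
    have : m.length ≤ 2 * w := by omega
    exact_mod_cast this
  have hP := S.P_pos
  have hκ := S.κ_pos
  rcases δ with _ | _ | δ
  · simpa using abs_corr_diag_le G S i hyp hm (by omega) hw
  · have hh : h * (2 * β + (0 + 1)) = h * (2 * β) + h := by ring
    refine (abs_corr_succ_le G S i hyp hm (by omega) (by omega)).trans ?_
    by_cases h0 : m.length = 0
    · rw [h0]
      simp only [Nat.cast_zero, zero_div, zero_mul]
      positivity
    · have h1 := S.step (x := m.length / 2) (by linarith) (2 * β) (m.length - 1 + h * (2 * β))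
      refine h1.trans ?_
      have h2 : m.length - 1 + h * (2 * β) + 1 + h = m.length + h * (2 * β + (0 + 1)) := by omega
      rw [h2, zero_add, pow_one, mul_assoc]
      have := S.bound_nonneg (2 * β + 1) (m.length + h * (2 * β + 1))
      linarith
  · have h1 := corr_succ G i m (β + (δ + 1)) β
    have e1 : h * (2 * β + (δ + 1 + 1)) = h * (2 * β + (δ + 1)) + h := by ring
    have h2 := ih δ (by omega) (β + 1) m (by
        obtain ⟨n, hn⟩ := hm; exact ⟨n - 1, by omega⟩) (by omega)
      (by rw [show 2 * (β + 1) + δ = 2 * β + (δ + 1 + 1) by ring]; exact hw)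
    have e2 : β + 1 + δ = β + (δ + 1) := by ring
    have e3 : 2 * (β + 1) + δ = 2 * β + (δ + 1 + 1) := by ring
    rw [e2, e3] at h2
    have h3 : |(m.count i : ℝ) * corr V q d i (m.erase i) (β + (δ + 1)) β| ≤
        2 ^ (δ + 1) * (1 / 20 * (P ^ (2 * β + (δ + 1 + 1)) *
          κ ^ (m.length + h * (2 * β + (δ + 1 + 1))))) := by
      rw [abs_mul, Nat.abs_cast]
      by_cases hi : i ∈ m
      · have h4 := List.length_erase_of_mem hi
        have h5 : 0 < m.length := List.length_pos_of_mem hi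
        have h6 := ih (δ + 1) (by omega) β (m.erase i) (by
          rw [h4]; obtain ⟨n, hn⟩ := hm; exact ⟨n - 1, by omega⟩) (by omega) (by
          rw [h4]; omega)
        rw [h4] at h6
        have h7 : (m.count i : ℝ) ≤ m.length := by exact_mod_cast List.count_le_length
        have h8 := S.step (h7.trans hwm) (2 * β + (δ + 1)) (m.length - 1 + h * (2 * β + (δ + 1)))
        have h9 : m.length - 1 + h * (2 * β + (δ + 1)) + 1 + h =
          m.length + h * (2 * β + (δ + 1 + 1)) := by omega
        rw [h9] at h8
        calc _ ≤ (m.count i : ℝ) * (2 ^ (δ + 1) * P ^ (2 * β + (δ + 1)) *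
              κ ^ (m.length - 1 + h * (2 * β + (δ + 1)))) := by gcongr
          _ = 2 ^ (δ + 1) * (m.count i * (P ^ (2 * β + (δ + 1)) *
              κ ^ (m.length - 1 + h * (2 * β + (δ + 1))))) := by ring
          _ ≤ _ := mul_le_mul_of_nonneg_left h8 (by positivity)
      · rw [List.count_eq_zero_of_not_mem hi, Nat.cast_zero, zero_mul]
        positivity
    have h10 : corr V q d i m (β + (δ + 1 + 1)) β = -corr V q d i m (β + (δ + 1)) (β + 1) -
        m.count i * corr V q d i (m.erase i) (β + (δ + 1)) β := h1
    rw [h10]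
    refine (abs_sub _ _).trans ?_
    rw [abs_neg]
    refine (add_le_add h2 h3).trans ?_
    set Y := P ^ (2 * β + (δ + 1 + 1)) * κ ^ (m.length + h * (2 * β + (δ + 1 + 1))) with hY
    have hY0 : 0 ≤ 2 ^ δ * Y := by positivity
    rw [mul_assoc, mul_assoc, ← hY, pow_succ 2 (δ + 1), pow_succ 2 δ]
    nlinarith

end corr

/-! ### The moment induction. -/

section main
variable {W E : Type*} [Ring W] [Algebra ℂ W] [NormedAddCommGroup E] [InnerProductSpace ℂ E]
variable [Fintype Λ] [DecidableEq Λ] {V : W →ₗ[ℂ] E} {q d : Λ → W} {F : W} {μ : Λ → ℝ} {e Δ : ℝ}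
variable (G : GapRep V q d F μ e Δ) {fb P s κ : ℝ} {h w : ℕ} (S : MomentScale μ Δ fb P s κ h w)

-- Makes the gradient term depend on the length of the product only, and not on the number of sites.
omit [Fintype Λ] in
theorem sum_count_sq_le [Fintype Λ] (l : List Λ) :
    ∑ j, (l.count j : ℝ) ^ 2 ≤ (l.length : ℝ) ^ 2 := by
  have h1 : ∑ j, (l.count j : ℝ) = l.length := by
    have : ∑ j, l.count j = l.length := by
      have := Multiset.sum_count_eq_card (s := Finset.univ) (m := (l : Multiset Λ)) (by simp)
      simpa using this
    exact_mod_cast this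
  calc ∑ j, (l.count j : ℝ) ^ 2 ≤ ∑ j, (l.count j : ℝ) * l.length := by
        refine Finset.sum_le_sum fun j _ => ?_
        rw [sq]
        gcongr
        exact List.count_le_length
    _ = _ := by rw [← Finset.sum_mul, h1, sq]

-- Removing a field gains a factor `κ`, and `κ ≥ 32 w s` beats both the multiplicity and `μ j ≤ s²
-- Δ`; the constant is `1 / 32²`.
include S in
theorem gradient_le (i : Λ) {a : ℕ} {l : List Λ} (hw : l.length + h * a ≤ w)
    (hyp : ∀ j ∈ l, ‖V (fieldProd q (l.erase j) * d i ^ a)‖ ≤ P ^ a * κ ^ (l.length - 1 + h * a)) :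
    ∑ j, μ j * ‖V ((l.count j : W) * fieldProd q (l.erase j) * d i ^ a)‖ ^ 2 ≤
      1 / 1024 * (Δ * (P ^ a * κ ^ (l.length + h * a)) ^ 2) := by
  have hP := S.P_pos
  have hκ := S.κ_pos
  have hs := S.s_nonneg
  have hΔ := S.Δ_pos
  set B := P ^ a * κ ^ (l.length - 1 + h * a) with hB
  have h1 : ∀ j, μ j * ‖V ((l.count j : W) * fieldProd q (l.erase j) * d i ^ a)‖ ^ 2 ≤
      s ^ 2 * Δ * B ^ 2 * (l.count j : ℝ) ^ 2 := by
    intro j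
    have h2 : ‖V ((l.count j : W) * fieldProd q (l.erase j) * d i ^ a)‖ =
        l.count j * ‖V (fieldProd q (l.erase j) * d i ^ a)‖ := by
      rw [mul_assoc, ← nsmul_eq_mul, map_nsmul, ← Nat.cast_smul_eq_nsmul ℂ, norm_smul]
      simp
    rw [h2]
    by_cases hj : j ∈ l
    · calc _ ≤ s ^ 2 * Δ * (l.count j * ‖V (fieldProd q (l.erase j) * d i ^ a)‖) ^ 2 := by
            gcongr
            exact S.μ_le j
        _ ≤ s ^ 2 * Δ * (l.count j * B) ^ 2 := by
            gcongr
            exact hyp j hj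
        _ = _ := by ring
    · simp [List.count_eq_zero_of_not_mem hj]
  refine (Finset.sum_le_sum fun j _ => h1 j).trans ?_
  rw [← Finset.mul_sum]
  by_cases h0 : l.length = 0
  · have : l = [] := List.length_eq_zero_iff.1 h0
    subst this
    simp only [List.count_nil, Nat.cast_zero, ne_eq, OfNat.ofNat_ne_zero, not_false_eq_true,
      zero_pow, Finset.sum_const_zero, mul_zero]
    positivity
  · have h3 : P ^ a * κ ^ (l.length + h * a) = B * κ := by
      rw [hB, mul_assoc, ← pow_succ]
      congr 2
      omega
    rw [h3]
    have h4 : (l.length : ℝ) ≤ w := by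
      have : l.length ≤ w := by omega
      exact_mod_cast this
    have h5 : 32 * (l.length : ℝ) * s ≤ κ := by
      refine le_trans ?_ S.s_le
      gcongr
    have h6 : (32 * (l.length : ℝ) * s) ^ 2 ≤ κ ^ 2 := by gcongr
    calc _ ≤ s ^ 2 * Δ * B ^ 2 * (l.length : ℝ) ^ 2 := by
          gcongr
          exact sum_count_sq_le l
      _ = 1 / 1024 * (Δ * B ^ 2) * (32 * (l.length : ℝ) * s) ^ 2 := by ring
      _ ≤ 1 / 1024 * (Δ * B ^ 2) * κ ^ 2 := by gcongr
      _ = _ := by ring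

-- The commutator is expanded in iterated commutators of `F`, each a field polynomial of lower
-- degree, and the resulting correlations between `∂^a` and `∂^(a-m)` involve fewer than `2 a`
-- derivatives in total. Parity of degrees in `Poly` supplies the evenness needed for the
-- correlation bounds.
include G S in
theorem commutator_le (i : Λ) {a : ℕ} {l : List Λ} (hw : l.length + h * a ≤ w)
    (hF : Poly q (2 * h - 1) (2 * h * fb) (adE (d i) F))
    (hyp : ∀ (l : List Λ) (c : ℕ), c < a → l.length + h * c ≤ w →
      ‖V (fieldProd q l * d i ^ c)‖ ≤ P ^ c * κ ^ (l.length + h * c)) :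
    (inner ℂ (V (fieldProd q l * (fieldProd q l * d i ^ a))) (V (F * d i ^ a - d i ^ a * F))).re ≤
      (1 / 512 + 1 / 112) * (Δ * (P ^ a * κ ^ (l.length + h * a)) ^ 2) := by
  have hP := S.P_pos
  have hκ := S.κ_pos
  have hs := S.s_nonneg
  have hΔ := S.Δ_pos
  have hfb : 0 ≤ fb := by
    have h2 : (0 : ℝ) < 2 * h := by
      have := S.one_le_h
      positivity
    exact nonneg_of_mul_nonneg_right hF.nonneg h2
  set T := Δ * (P ^ a * κ ^ (l.length + h * a)) ^ 2 with hT
  set Φ : ℕ → W →ₗ[ℂ] ℂ := fun m =>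
    (innerSL ℂ (V (d i ^ a))).toLinearMap ∘ₗ V ∘ₗ LinearMap.mulRight ℂ (d i ^ (a - m)) with hΦ
  have hΦl : ∀ m l', ((Φ m) (fieldProd q l')).re = corr V q d i l' a (a - m) := fun m l' => rfl
  have h1 : F * d i ^ a - d i ^ a * F =
      -∑ m ∈ Finset.range a, (a.choose (m + 1) : ℂ) •
        ((adE (d i) ^ (m + 1)) F * d i ^ (a - (m + 1))) := by
    rw [pow_mul_eq_sum_adE, Finset.sum_range_succ']
    simp
  have h2 : (inner ℂ (V (fieldProd q l * (fieldProd q l * d i ^ a))) (V (F * d i ^ a - d i ^ a * F))).re =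
      -∑ m ∈ Finset.range a, (a.choose (m + 1) : ℝ) *
        ((Φ (m + 1)) (fieldProd q (l ++ l) * (adE (d i) ^ (m + 1)) F)).re := by
    rw [h1, map_neg, inner_neg_right, Complex.neg_re, map_sum, inner_sum, Complex.re_sum]
    congr 1
    refine Finset.sum_congr rfl fun m _ => ?_
    rw [map_smul, inner_smul_right, ← Complex.ofReal_natCast, Complex.re_ofReal_mul]
    congr 2
    rw [hΦ, ← mul_assoc, ← fieldProd_append, G.inner_fieldProd, ← mul_assoc]
    rfl
  have hpoly : ∀ m, 1 ≤ m → Poly q (2 * l.length + (2 * h - m)) ((2 * h) ^ m * fb)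
      (fieldProd q (l ++ l) * (adE (d i) ^ m) F) := fun m hm => by
    have := (Poly.adE_pow G i S.one_le_h hF m hm).1.fieldProd_mul (l ++ l)
    rwa [List.length_append, ← two_mul] at this
  -- Orders `m = 2 + j`; for `m > 2 h` the iterated commutator vanishes.
  have hsecond : ∀ j c, a = 2 + j + c →
      (a.choose (2 + j) : ℝ) * |((Φ (2 + j)) (fieldProd q (l ++ l) * (adE (d i) ^ (2 + j)) F)).re| ≤
        1 / 128 * (1 / 8) ^ j * T := by
    intro j c hc
    by_cases hj : 2 + j ≤ 2 * h
    · have h5 : |((Φ (2 + j)) (fieldProd q (l ++ l) * (adE (d i) ^ (2 + j)) F)).re| ≤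
          (2 * h) ^ (2 + j) * fb * (2 ^ (2 + j) * P ^ (2 + j + 2 * c) *
            κ ^ (2 * l.length + 2 * h - (2 + j) + h * (2 + j + 2 * c))) := by
        refine (hpoly (2 + j) (by omega)).abs_re_le (Φ (2 + j)) (by positivity)
          fun l' hl' he => ?_
        have h6 : a - (2 + j) = c := by omega
        have h7 : h * (2 * c + (2 + j)) = h * (2 + j + 2 * c) := by ring
        have h8 : 2 * l.length + 2 * h + h * (2 + j + 2 * c) ≤ 2 * w + 2 * h := by
          have : h * (2 + j + 2 * c) ≤ 2 * (h * a) := by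
            rw [hc, ← mul_left_comm]
            gcongr
            omega
          omega
        have h9 : h * (2 + j + 2 * c) + h * (2 + j) = 2 * (h * a) := by rw [hc]; ring
        have h10 : 2 * h ≤ h * (2 + j) := by nlinarith [Nat.zero_le (h * j)]
        rw [hΦl, h6, hc, show 2 + j + c = c + (2 + j) by ring]
        refine (abs_corr_le G S i hyp (2 + j) c l' ?_ (by omega) (by omega)).trans ?_
        · obtain ⟨n, hn⟩ := he
          exact ⟨n + (2 + j) - l.length - h, by omega⟩
        · rw [h7, add_comm (2 * c) (2 + j)]
          have : 1 ≤ κ := by have := S.κ_ge; linarith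
          gcongr
          omega
      have h11 := S.choose_step (j := j) (c := c) (b := l.length) (by rw [← hc]; exact hw) hj
      rw [← hc] at h11
      exact (mul_le_mul_of_nonneg_left h5 (by positivity)).trans h11
    · rw [(Poly.adE_pow G i S.one_le_h hF (2 + j) (by omega)).2 (by omega)]
      simp only [mul_zero, map_zero, Complex.zero_re, abs_zero]
      positivity
  -- The first order cannot go through `choose_step`, which needs the factors from `m ≥ 2`. The
  -- sharper `abs_corr_succ_le` frees two powers each of `P` and `κ`, and `κ ≥ 32 w s` gives `2 /
  -- 32² = 1 / 512`.
  have hfirst : (a : ℝ) * |((Φ 1) (fieldProd q (l ++ l) * (adE (d i) ^ 1) F)).re| ≤ 1 / 512 * T := by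
    rcases Nat.eq_zero_or_pos a with h0 | h0
    · rw [h0, Nat.cast_zero, zero_mul]
      positivity
    obtain ⟨c, rfl⟩ := Nat.exists_eq_succ_of_ne_zero h0.ne'
    have hh := S.one_le_h
    have hhc : h * (c + 1) = h * c + h := by ring
    have h5 : |((Φ 1) (fieldProd q (l ++ l) * (adE (d i) ^ 1) F)).re| ≤
        (2 * h) ^ 1 * fb * (w * (P ^ (2 * c) *
          κ ^ (2 * l.length + 2 * h - 2 + h * (2 * c)))) := by
      refine (hpoly 1 le_rfl).abs_re_le (Φ 1) (by positivity) fun l' hl' he => ?_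
      rw [hΦl, Nat.succ_sub_one]
      have h7 : h * (2 * c) = 2 * (h * c) := by ring
      refine (abs_corr_succ_le G S i hyp (β := c) (m := l') ?_ (by omega) (by
        simp only [Nat.succ_eq_add_one] at hw; omega)).trans ?_
      · obtain ⟨n, hn⟩ := he
        exact ⟨n - l.length - h + 1, by omega⟩
      · have h8 : 1 ≤ κ := by have := S.κ_ge; linarith
        have h9 : (l'.length : ℝ) / 2 ≤ w := by
          have : l'.length ≤ 2 * w := by simp only [Nat.succ_eq_add_one] at hw; omega
          have : (l'.length : ℝ) ≤ 2 * w := by exact_mod_cast this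
          linarith
        have h10 : l'.length - 1 + h * (2 * c) ≤ 2 * l.length + 2 * h - 2 + h * (2 * c) := by omega
        gcongr
    have h6 : ((h * (c + 1) : ℕ) : ℝ) ≤ w := by
      have : h * (c + 1) ≤ w := by simp only [Nat.succ_eq_add_one] at hw; omega
      exact_mod_cast this
    have hexp : T = Δ * P ^ 2 * κ ^ 2 * (P ^ (2 * c) *
        κ ^ (2 * l.length + 2 * h - 2 + h * (2 * c))) := by
      have h7 : 2 * (l.length + h * (c + 1)) = 2 + (2 * l.length + 2 * h - 2 + h * (2 * c)) := by
        have h7 : h * (2 * c) = 2 * (h * c) := by ring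
        omega
      rw [hT, mul_pow, ← pow_mul κ, mul_comm (l.length + _) 2, Nat.succ_eq_add_one, h7,
        pow_add κ 2]
      ring
    rw [hexp]
    set Y := P ^ (2 * c) * κ ^ (2 * l.length + 2 * h - 2 + h * (2 * c))
    have hY : 0 ≤ Y := by positivity
    have h8 : (32 * w * s) ^ 2 ≤ κ ^ 2 := by
      have := S.s_le
      gcongr
    calc _ ≤ ((c + 1 : ℕ) : ℝ) * ((2 * h) ^ 1 * fb * (w * Y)) := by gcongr
      _ = 2 * ((h * (c + 1) : ℕ) : ℝ) * fb * (w * Y) := by push_cast; ring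
      _ ≤ 2 * w * (P ^ 2 * (s ^ 2 * Δ)) * (w * Y) := by
        have := S.fb_le
        gcongr
      _ = 1 / 512 * (Δ * P ^ 2 * (32 * w * s) ^ 2 * Y) := by ring
      _ ≤ _ := by
        rw [mul_le_mul_iff_right₀ (by norm_num)]
        gcongr
  rw [h2]
  refine (neg_le_abs _).trans ((Finset.abs_sum_le_sum_abs _ _).trans ?_)
  simp only [abs_mul, Nat.abs_cast]
  have hT0 : 0 ≤ T := by positivity
  rcases Nat.eq_zero_or_pos a with h0 | h0
  · rw [h0, Finset.sum_range_zero]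
    positivity
  obtain ⟨n, rfl⟩ := Nat.exists_eq_succ_of_ne_zero h0.ne'
  rw [Finset.sum_range_succ', zero_add, Nat.choose_one_right, add_comm, add_mul]
  refine add_le_add hfirst ?_
  have h12 : ∀ j ∈ Finset.range n, (n.succ.choose (j + 1 + 1) : ℝ) *
      |((Φ (j + 1 + 1)) (fieldProd q (l ++ l) * (adE (d i) ^ (j + 1 + 1)) F)).re| ≤
        (1 / 8) ^ j * (1 / 128 * T) := fun j hj => by
    have hj' := Finset.mem_range.1 hj
    have := hsecond j (n - 1 - j) (by simp only [Nat.succ_eq_add_one]; omega)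
    rw [show j + 1 + 1 = 2 + j by ring]
    refine this.trans (le_of_eq ?_)
    ring
  refine (Finset.sum_le_sum h12).trans ?_
  rw [← Finset.sum_mul]
  -- The orders from two on sum to `8/7 · 1/128 = 1/112`.
  have h13 : ∑ j ∈ Finset.range n, (1 / 8 : ℝ) ^ j ≤ 8 / 7 := by
    have h14 := geom_sum_eq (x := (1 / 8 : ℝ)) (by norm_num) n
    rw [h14, div_le_iff_of_neg (by norm_num)]
    have : (0 : ℝ) ≤ (1 / 8) ^ n := by positivity
    linarith
  calc _ ≤ 8 / 7 * (1 / 128 * T) := by gcongr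
    _ = _ := by ring

-- One field or derivative is moved to the left vector and Cauchy–Schwarz is applied; two smaller
-- moments, each with its factor `1/2`, give `1/4`, and the commutator costs at most `1/20`. A lone
-- field or derivative has mean zero.
include G S in
theorem mean_le (i : Λ) {a : ℕ} {l : List Λ} (hw : l.length + h * a ≤ w)
    (hyp : ∀ (l' : List Λ) (c : ℕ), (c < a ∨ c = a ∧ l'.length < l.length) →
      l'.length + h * c ≤ w → ‖V (fieldProd q l' * d i ^ c)‖ ≤ P ^ c * κ ^ (l'.length + h * c) ∧
        (l'.length + c ≠ 0 →
          ‖V (fieldProd q l' * d i ^ c)‖ ≤ 1 / 2 * (P ^ c * κ ^ (l'.length + h * c))))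
    (h0 : l.length + a ≠ 0) :
    ‖inner ℂ (V 1) (V (fieldProd q l * d i ^ a))‖ ≤ 2 / 5 * (P ^ a * κ ^ (l.length + h * a)) := by
  have hP := S.P_pos
  have hκ := S.κ_pos
  have hh := S.one_le_h
  have hl1 : ∀ j, fieldProd q [j] = q j := fun j => by simp [fieldProd]
  rcases Nat.eq_zero_or_pos a with ha | ha
  · subst ha
    rcases l with _ | ⟨j, l⟩
    · simp at h0
    rcases l with _ | ⟨j', l⟩
    · rw [hl1, pow_zero, mul_one, G.mean_q, norm_zero]
      positivity
    · rw [fieldProd_cons, mul_assoc, ← G.inner_q, mul_one]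
      simp only [List.length_cons] at hw hyp ⊢
      have h1 := (hyp [j] 0 (by simp) (by simp; omega)).2 (by simp)
      have h2 := (hyp (j' :: l) 0 (by simp) (by simp; omega)).2 (by simp)
      rw [hl1, pow_zero, mul_one] at h1
      refine (norm_inner_le_norm _ _).trans ((mul_le_mul h1 h2 (norm_nonneg _)
        (by positivity)).trans ?_)
      simp only [List.length_cons, List.length_nil, mul_zero, add_zero, zero_add, pow_zero,
        one_mul, pow_one]
      have : 0 ≤ κ ^ (l.length + 1 + 1) := by positivity
      rw [pow_succ κ (l.length + 1)] at this ⊢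
      linarith
  · obtain ⟨c, rfl⟩ := Nat.exists_eq_succ_of_ne_zero ha.ne'
    have hhc : h * (c + 1) = h * c + h := by ring
    simp only [Nat.succ_eq_add_one] at *
    by_cases h1 : l.length + c = 0
    · have h2 : l = [] := List.length_eq_zero_iff.1 (by omega)
      have h3 : c = 0 := by omega
      subst h2 h3
      simp only [fieldProd, List.map_nil, List.prod_nil, one_mul, zero_add, pow_one, G.mean_d, norm_zero]
      positivity
    · have h2 : fieldProd q l * d i ^ (c + 1) = d i * (fieldProd q l * d i ^ c) -
          (l.count i) • (fieldProd q (l.erase i) * d i ^ c) := by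
        rw [← mul_assoc (d i), G.d_fieldProd, add_mul, nsmul_eq_mul, mul_assoc, mul_assoc, pow_succ']
        abel
      have h3 := (hyp [] 1 (by simp; omega) (by simp; omega)).2 (by simp)
      have h4 := (hyp l c (Or.inl (by omega)) (by omega)).2 h1
      have h5 : ‖V (d i)‖ ≤ 1 / 2 * (P * κ ^ h) := by simpa [fieldProd] using h3
      have h6 : ‖inner ℂ (V 1) (V (d i * (fieldProd q l * d i ^ c)))‖ ≤
          1 / 4 * (P ^ (c + 1) * κ ^ (l.length + h * (c + 1))) := by
        have h7 : inner ℂ (V 1) (V (d i * (fieldProd q l * d i ^ c))) =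
            -inner ℂ (V (d i)) (V (fieldProd q l * d i ^ c)) := by
          have := G.inner_d i 1 (fieldProd q l * d i ^ c)
          rw [mul_one] at this
          rw [this, neg_neg]
        rw [h7, norm_neg]
        refine (norm_inner_le_norm _ _).trans ((mul_le_mul h5 h4 (norm_nonneg _)
          (by positivity)).trans (le_of_eq ?_))
        rw [hhc]
        ring
      have h8 : ‖inner ℂ (V 1) (V ((l.count i) • (fieldProd q (l.erase i) * d i ^ c)))‖ ≤
          1 / 20 * (P ^ (c + 1) * κ ^ (l.length + h * (c + 1))) := by
        rw [map_nsmul, ← Nat.cast_smul_eq_nsmul ℂ, inner_smul_right, norm_mul, Complex.norm_natCast]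
        by_cases hi : i ∈ l
        · have h9 := List.length_erase_of_mem hi
          have h10 : 0 < l.length := List.length_pos_of_mem hi
          have h11 := (hyp (l.erase i) c (Or.inl (by omega)) (by omega)).1
          rw [h9] at h11
          have h12 : (l.count i : ℝ) ≤ 2 * w := by
            have h12 : l.count i ≤ l.length := List.count_le_length
            have : l.count i ≤ 2 * w := by omega
            exact_mod_cast this
          have h13 := S.step h12 c (l.length - 1 + h * c)
          rw [show l.length - 1 + h * c + 1 + h = l.length + h * (c + 1) by omega] at h13
          refine le_trans ?_ h13
          gcongr
          refine (norm_inner_le_norm _ _).trans ?_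
          rw [G.norm_one, one_mul]
          exact h11
        · rw [List.count_eq_zero_of_not_mem hi, Nat.cast_zero, zero_mul]
          positivity
      rw [h2, map_sub, inner_sub_right]
      refine (norm_sub_le _ _).trans ((add_le_add h6 h8).trans ?_)
      have := S.bound_nonneg (c + 1) (l.length + h * (c + 1))
      linarith

-- Induction on the number of derivatives and then of fields, driven by `GapRep.gap_mul`. The factor
-- `1/2` for nonempty products is carried along because `mean_le` multiplies two such bounds and
-- must come out strictly below one.
include G S in
theorem norm_fieldProd_mul_pow_le (i : Λ) (hF : Poly q (2 * h - 1) (2 * h * fb) (adE (d i) F)) (a : ℕ) :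
    ∀ (b : ℕ) (l : List Λ), l.length = b → l.length + h * a ≤ w →
      ‖V (fieldProd q l * d i ^ a)‖ ≤ P ^ a * κ ^ (l.length + h * a) ∧
        (l.length + a ≠ 0 →
          ‖V (fieldProd q l * d i ^ a)‖ ≤ 1 / 2 * (P ^ a * κ ^ (l.length + h * a))) := by
  induction a using Nat.strong_induction_on with
  | _ a iha =>
  intro b
  induction b using Nat.strong_induction_on with
  | _ b ihb =>
  rintro l rfl hw
  have hP := S.P_pos
  have hκ := S.κ_pos
  have hT := S.bound_nonneg a (l.length + h * a)
  suffices h1 : l.length + a ≠ 0 →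
      ‖V (fieldProd q l * d i ^ a)‖ ≤ 1 / 2 * (P ^ a * κ ^ (l.length + h * a)) by
    refine ⟨?_, h1⟩
    by_cases h0 : l.length + a = 0
    · have h2 : l = [] := List.length_eq_zero_iff.1 (by omega)
      have h3 : a = 0 := by omega
      subst h2 h3
      simp [fieldProd, G.norm_one]
    · have := h1 h0
      linarith
  intro h0
  have hyp : ∀ (l' : List Λ) (c : ℕ), (c < a ∨ c = a ∧ l'.length < l.length) →
      l'.length + h * c ≤ w → ‖V (fieldProd q l' * d i ^ c)‖ ≤ P ^ c * κ ^ (l'.length + h * c) ∧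
        (l'.length + c ≠ 0 →
          ‖V (fieldProd q l' * d i ^ c)‖ ≤ 1 / 2 * (P ^ c * κ ^ (l'.length + h * c))) := by
    rintro l' c (hc | ⟨rfl, hc⟩) hw'
    · exact iha c hc _ l' rfl hw'
    · exact ihb _ hc l' rfl hw'
  have h2 := G.gap_mul (g := fieldProd q l) (D := d i ^ a)
    (g' := fun j => (l.count j : W) * fieldProd q (l.erase j)) (z := (-1) ^ a) (by simp)
    (G.inner_fieldProd l) (G.F_fieldProd l) (fun j => G.d_fieldProd j l) (fun j => by
      rw [mul_assoc, G.fieldProd_comm, (Nat.cast_commute _ _).left_comm])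
    (G.inner_d_pow i a) (fun j => (Commute.pow_right (G.d_comm j i) a).eq)
  have h3 := gradient_le S i (V := V) (q := q) (d := d) hw fun j hj => by
    have h4 := List.length_erase_of_mem hj
    have h5 := List.length_pos_of_mem hj
    have h6 := (hyp (l.erase j) a (Or.inr ⟨rfl, by omega⟩) (by omega)).1
    rwa [h4] at h6
  have h4 := commutator_le G S i hw hF fun l' c hc hw' => (hyp l' c (Or.inl hc) hw').1
  have h5 := mean_le G S i hw hyp h0
  have h6 : ‖inner ℂ (V 1) (V (fieldProd q l * d i ^ a))‖ ^ 2 ≤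
      (2 / 5 * (P ^ a * κ ^ (l.length + h * a))) ^ 2 := by gcongr
  set T := P ^ a * κ ^ (l.length + h * a) with hTd
  -- Variance: `1/1024 + 1/512 + 1/112 < 1/50`. Adding the squared mean, `1/50 + (2/5)² < (1/2)²`,
  -- which closes the induction.
  have h7 : Δ * (‖V (fieldProd q l * d i ^ a)‖ ^ 2 -
      ‖inner ℂ (V 1) (V (fieldProd q l * d i ^ a))‖ ^ 2) ≤ Δ * (1 / 50 * T ^ 2) := by
    refine h2.trans ((add_le_add h3 h4).trans ?_)
    have : 0 ≤ Δ * T ^ 2 := by have := S.Δ_pos; positivity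
    linarith
  have h8 := le_of_mul_le_mul_left h7 S.Δ_pos
  refine abs_le_of_sq_le_sq' ?_ (by positivity) |>.2
  nlinarith [sq_nonneg T]

-- Normal ordering of the powers of `φ + ∂`, one factor at a time. A field in place of a derivative,
-- and the commutator term, only have smaller weight, so all terms are compared with that of the
-- pure derivative.
include G S in
theorem norm_fieldProd_mul_pow_mul_pow_le (i : Λ)
    (hF : Poly q (2 * h - 1) (2 * h * fb) (adE (d i) F)) (m : ℕ) :
    ∀ a b : ℕ, b + h * (a + m) ≤ w →
      ‖V (q i ^ b * d i ^ a * (q i + d i) ^ m)‖ ≤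
        (5 / 2) ^ m * (P ^ (a + m) * κ ^ (b + h * (a + m))) := by
  have hP := S.P_pos
  have hκ := S.κ_pos
  have hh := S.one_le_h
  induction m with
  | zero =>
    intro a b hw
    have h1 := (norm_fieldProd_mul_pow_le G S i hF a b (List.replicate b i) (by simp)
      (by simpa using hw)).1
    simpa [fieldProd] using h1
  | succ m ih =>
    intro a b hw
    have hdq : d i ^ a * q i = q i * d i ^ a + a • d i ^ (a - 1) := by
      clear hw
      induction a with
      | zero => simp
      | succ a iha =>
        have h2 : a • (d i * d i ^ (a - 1)) = a • d i ^ a := by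
          rcases a with _ | a
          · simp
          · rw [Nat.add_sub_cancel, pow_succ']
        rw [pow_succ', mul_assoc, iha, mul_add, ← mul_assoc, G.d_q, if_pos rfl, mul_smul_comm, h2,
          Nat.add_sub_cancel, add_mul, one_mul, mul_assoc, add_assoc, succ_nsmul' ]
    have h1 : q i ^ b * d i ^ a * (q i + d i) ^ (m + 1) =
        q i ^ (b + 1) * d i ^ a * (q i + d i) ^ m +
          a • (q i ^ b * d i ^ (a - 1) * (q i + d i) ^ m) +
          q i ^ b * d i ^ (a + 1) * (q i + d i) ^ m := by
      have h2 : q i ^ b * d i ^ a * (q i + d i) =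
          q i ^ (b + 1) * d i ^ a + a • (q i ^ b * d i ^ (a - 1)) + q i ^ b * d i ^ (a + 1) := by
        rw [mul_add, mul_assoc, hdq, mul_add, ← mul_assoc, ← pow_succ, mul_smul_comm, mul_assoc,
          ← pow_succ]
      rw [pow_succ', ← mul_assoc, h2, add_mul, add_mul, smul_mul_assoc]
    set T := P ^ (a + (m + 1)) * κ ^ (b + h * (a + (m + 1))) with hT
    have hT0 : 0 ≤ T := S.bound_nonneg _ _
    have e1 : h * (a + (m + 1)) = h * (a + m) + h := by ring
    have h2 := ih a (b + 1) (by omega)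
    have h3 := ih (a + 1) b (by rw [show a + 1 + m = a + (m + 1) by ring]; exact hw)
    rw [show a + 1 + m = a + (m + 1) by ring, ← hT] at h3
    -- Exchanging a field for a derivative multiplies the bound by `P κ^(h-1) ≥ 7/10`, which may be
    -- below one when `h = 1`.
    have hPκ : ∀ {x y : ℝ}, 0 ≤ y → x = P * κ ^ (h - 1) * y → y ≤ 10 / 7 * x := by
      intro x y hy hx
      have h7 : 1 ≤ κ ^ (h - 1) := one_le_pow₀ (by have := S.κ_ge; linarith)
      have h6 : 7 / 10 ≤ P * κ ^ (h - 1) := by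
        have := S.P_ge
        nlinarith
      rw [hx]
      nlinarith
    have h4 : P ^ (a + m) * κ ^ (b + 1 + h * (a + m)) ≤ 10 / 7 * T := by
      have h5 : T = P * κ ^ (h - 1) * (P ^ (a + m) * κ ^ (b + 1 + h * (a + m))) := by
        rw [hT, show b + h * (a + (m + 1)) = (h - 1) + (b + 1 + h * (a + m)) by omega, pow_add κ]
        ring
      exact hPκ (S.bound_nonneg _ _) h5
    have h5 : ‖V (a • (q i ^ b * d i ^ (a - 1) * (q i + d i) ^ m))‖ ≤
        (5 / 2) ^ m * (1 / 14 * T) := by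
      rw [map_nsmul, ← Nat.cast_smul_eq_nsmul ℂ, norm_smul, Complex.norm_natCast]
      rcases a with _ | a
      · simp only [Nat.cast_zero, zero_mul]
        positivity
      · have e2 : h * (a + 1 + m) = h * (a + m) + h := by ring
        have h6 := ih a b (by omega)
        rw [Nat.add_sub_cancel]
        have h7 : ((a + 1 : ℕ) : ℝ) ≤ 2 * w := by
          have : a + 1 ≤ h * (a + 1 + m) := by nlinarith
          have : a + 1 ≤ 2 * w := by omega
          exact_mod_cast this
        have h8 := S.step h7 (a + m) (b + h * (a + m))
        have h9 : P ^ (a + m + 1) * κ ^ (b + h * (a + m) + 1 + h) ≤ 10 / 7 * T := by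
          have h10 : T = P * κ ^ (h - 1) * (P ^ (a + m + 1) * κ ^ (b + h * (a + m) + 1 + h)) := by
            rw [hT, show b + h * (a + 1 + (m + 1)) =
              (h - 1) + (b + h * (a + m) + 1 + h) by rw [e1, e2]; omega, pow_add κ (h - 1)]
            ring
          exact hPκ (S.bound_nonneg _ _) h10
        calc _ ≤ ((a + 1 : ℕ) : ℝ) * ((5 / 2) ^ m * (P ^ (a + m) * κ ^ (b + h * (a + m)))) := by
              gcongr
          _ = (5 / 2) ^ m * (((a + 1 : ℕ) : ℝ) * (P ^ (a + m) * κ ^ (b + h * (a + m)))) := by ring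
          _ ≤ (5 / 2) ^ m * (1 / 14 * T) := by
              refine mul_le_mul_of_nonneg_left (h8.trans ?_) (by positivity)
              linarith
    rw [h1, map_add, map_add]
    refine (norm_add₃_le).trans ((add_le_add (add_le_add
      (h2.trans (mul_le_mul_of_nonneg_left h4 (by positivity))) h5) h3).trans ?_)
    -- The three terms add up to `10/7 + 1/14 + 1 = 5/2`.
    have : 0 ≤ (5 / 2 : ℝ) ^ m * T := by positivity
    rw [pow_succ (5 / 2 : ℝ)]
    nlinarith

end main

/-! ### The ground state as an instance of the abstract moment bound. -/

section instantiate
variable [Fintype Λ]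

instance tameNeg : Neg (tame Λ) := ⟨fun A => (-1 : ℂ) • A⟩

instance tameRing : Ring (tame Λ) where
  __ := (tame Λ).toSemiring
  zsmul := zsmulRec
  neg_add_cancel A := by
    change (-1 : ℂ) • A + A = 0
    nth_rewrite 2 [← one_smul ℂ A]
    rw [← add_smul, neg_add_cancel, zero_smul]

variable [DecidableEq Λ]
variable {k : ℕ} {μ : Λ → ℝ} {f : (r : ℕ) → (Fin (2 * r) → Λ) → ℝ} {Ω : Fock Λ} {e Δ : ℝ} {σ : ℂ}

/-- The field as an element of the algebra of tame operators. -/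
def tamePhi (i : Λ) : tame Λ := ⟨phi i, phi_mem_tame i⟩

/-- The derivative as an element of the algebra of tame operators. -/
def tameDer (i : Λ) : tame Λ := ⟨der i, der_mem_tame i⟩

/-- The potential as an element of the algebra of tame operators. -/
def tamePoly (k : ℕ) (f : (r : ℕ) → (Fin (2 * r) → Λ) → ℝ) : tame Λ :=
  ⟨evenPoly k f, evenPoly_mem_tame k f⟩

theorem coe_fieldProd_tamePhi (l : List Λ) :
    ((fieldProd tamePhi l : tame Λ) : Module.End ℂ (FinVec Λ)) = phiList l := by
  induction l with
  | nil => rfl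
  | cons i l ih =>
    rw [fieldProd_cons, MulMemClass.coe_mul, ih, phiList, phiList, List.map_cons, List.prod_cons]
    rfl

theorem tamePoly_eq (k : ℕ) (f : (r : ℕ) → (Fin (2 * r) → Λ) → ℝ) :
    tamePoly k f = ∑ r ∈ Finset.Icc 1 (k / 2), ∑ t : Fin (2 * r) → Λ,
      ((f r t : ℝ) : ℂ) • fieldProd tamePhi (List.ofFn t) := by
  apply Subtype.ext
  change evenPoly k f = (tame Λ).val _
  rw [map_sum]
  refine Finset.sum_congr rfl fun r _ => ?_
  rw [map_sum]
  refine Finset.sum_congr rfl fun t _ => ?_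
  rw [phiProd_eq, ← coe_fieldProd_tamePhi]
  rfl

theorem tamePhi_mul_comm (i j : Λ) : tamePhi i * tamePhi j = tamePhi j * tamePhi i :=
  Subtype.ext (phi_mul_phi_comm i j)

theorem fieldProd_tamePhi_comm (l : List Λ) (j : Λ) :
    fieldProd tamePhi l * tamePhi j = tamePhi j * fieldProd tamePhi l := by
  induction l with
  | nil => simp [fieldProd]
  | cons i l ih => rw [fieldProd_cons, mul_assoc, ih, ← mul_assoc, tamePhi_mul_comm, mul_assoc]

omit [DecidableEq Λ] in
theorem par_trunc (hΩ : ∀ N, sgn N * Ω N = σ * Ω N) (s : Finset (Config Λ)) :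
    par Λ (trunc Ω s) = σ • trunc Ω s := by
  rw [trunc, map_sum, Finset.smul_sum]
  refine Finset.sum_congr rfl fun N _ => ?_
  rw [par, diag_single, Finsupp.smul_single, hΩ, smul_eq_mul]

omit [DecidableEq Λ] in
-- Truncations of `Ω` keep its parity, and the parity operator preserves inner products, so each
-- approximating expectation equals its own negative.
theorem inner_vec_one_odd (hΩ : ∀ N, sgn N * Ω N = σ * Ω N) (hσ : σ * σ = 1) (hR : Rapid Ω)
    (A : tame Λ) (hA : ∀ u, par Λ (A.1 u) = -A.1 (par Λ u)) :
    inner ℂ (vec Ω hR 1) (vec Ω hR A) = 0 := by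
  have h1 := (tendsto_vec hR 1).inner (𝕜 := ℂ) (tendsto_vec hR A)
  refine tendsto_nhds_unique h1 (tendsto_const_nhds.congr fun s => ?_)
  have h2 : ‖σ‖ = 1 := by
    have := congrArg norm hσ
    rw [norm_mul, norm_one, ← sq] at this
    exact (pow_eq_one_iff_of_nonneg (norm_nonneg _) two_ne_zero).1 this
  have h3 := inner_par_par (trunc Ω s) (A.1 (trunc Ω s))
  rw [hA, par_trunc hΩ, map_smul, map_smul, map_neg, map_smul, inner_neg_right, inner_smul_left,
    inner_smul_right, ← mul_assoc, mul_comm _ σ, Complex.mul_conj, Complex.normSq_eq_norm_sq,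
    h2] at h3
  change 0 = inner ℂ (toFock (trunc Ω s)) _
  simp only [one_pow, Complex.ofReal_one, one_mul] at h3
  linear_combination (1 / 2 : ℂ) * h3

theorem hamEnd_eq_coe (k : ℕ) (μ : Λ → ℝ) (f : (r : ℕ) → (Fin (2 * r) → Λ) → ℝ) :
    hamEnd k μ f = ((∑ j, (-(μ j : ℂ)) • (tameDer j * tameDer j) + tamePoly k f : tame Λ) :
      Module.End ℂ (FinVec Λ)) := by
  refine LinearMap.ext fun u => ?_
  rw [hamEnd_apply, Subalgebra.coe_add, AddSubmonoidClass.coe_finsetSum, LinearMap.add_apply,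
    LinearMap.sum_apply]
  rfl

/-- Each property holds for finite vectors and passes to `Ω` by truncation. `eigen` is the adjoint
form: `H` is moved off `A Ω` and the relation is conjugated. -/
theorem gapRep_vec (hΩ : GappedState (hamEnd k μ f) Ω e Δ σ) (hR : Rapid Ω) :
    GapRep (vec Ω hR) tamePhi tameDer (tamePoly k f) μ e Δ := by
  have inner_d : ∀ j A B, inner ℂ (vec Ω hR (tameDer j * A)) (vec Ω hR B) =
      -inner ℂ (vec Ω hR A) (vec Ω hR (tameDer j * B)) := fun j A B => by
    have := inner_vec hR (S := tameDer j) (T := (-1 : ℂ) • tameDer j) (fun u v => by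
      change _ = inner ℂ (toFock u) (toFock ((-1 : ℂ) • der j v))
      rw [map_smul, inner_smul_right, neg_one_mul]
      exact inner_der_left j u v) A B
    rw [this, smul_mul_assoc, map_smul, inner_smul_right, neg_one_mul]
  set H : tame Λ := ∑ j, (-(μ j : ℂ)) • (tameDer j * tameDer j) + tamePoly k f with hH
  have hHe := hamEnd_eq_coe k μ f
  rw [← hH] at hHe
  have hHs : ∀ A B, inner ℂ (vec Ω hR (H * A)) (vec Ω hR B) =
      inner ℂ (vec Ω hR A) (vec Ω hR (H * B)) := inner_vec hR fun u v => by
    rw [← hHe]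
    exact inner_hamEnd_left k μ f u v
  refine ⟨tamePhi_mul_comm, fun i j => Subtype.ext (der_mul_der_comm i j), fun i j => ?_,
    fun j => ?_, fun j => inner_vec hR (inner_phi_left j), inner_d, ?_, fun j => ?_, fun j => ?_,
    fun A => ?_, fun A => ?_⟩
  · apply Subtype.ext
    have := der_mul_phi i j
    split_ifs at this ⊢ <;> exact this
  · rw [tamePoly_eq]
    simp only [Finset.sum_mul, Finset.mul_sum, smul_mul_assoc, mul_smul_comm, fieldProd_tamePhi_comm]
  · rw [vec_one, hΩ.norm_eq]
  · exact inner_vec_one_odd hΩ.parity hΩ.sq_eq_one hR (tamePhi j) (par_phi j)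
  · exact inner_vec_one_odd hΩ.parity hΩ.sq_eq_one hR (tameDer j) (par_der j)
  · have h1 := tendsto_vec hR A
    have h2 := tendsto_vec hR (H * A)
    have h3 := (((h1.norm.pow 2).sub
      (((tendsto_const_nhds (x := Ω)).inner (𝕜 := ℂ) h1).norm.pow 2)).const_mul Δ)
    have h4 := ((Complex.continuous_re.tendsto _).comp (h1.inner (𝕜 := ℂ) h2)).sub
      ((h1.norm.pow 2).const_mul e)
    have h5 := le_of_tendsto_of_tendsto' h3 h4 fun s => by
      have := hΩ.gap (A.1 (trunc Ω s))
      rw [hHe] at this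
      exact this
    rw [vec_one]
    refine h5.trans (le_of_eq ?_)
    congr 1
    rw [hH, add_mul, map_add, inner_add_right, Complex.add_re, Finset.sum_mul, map_sum, inner_sum,
      Complex.re_sum]
    congr 1
    refine Finset.sum_congr rfl fun j _ => ?_
    rw [smul_mul_assoc, map_smul, inner_smul_right, mul_assoc, ← neg_neg (inner ℂ _ _), ← inner_d,
      neg_mul_neg, Complex.re_ofReal_mul, inner_self_eq_norm_sq_to_K]
    norm_cast
  · have h1 : inner ℂ (vec Ω hR 1) (vec Ω hR (H * A)) =
        (e : ℂ) * inner ℂ (vec Ω hR 1) (vec Ω hR A) := by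
      rw [vec_one]
      have h2 := (tendsto_const_nhds (x := Ω)).inner (𝕜 := ℂ) (tendsto_vec hR (H * A))
      have h3 := ((tendsto_const_nhds (x := Ω)).inner (𝕜 := ℂ) (tendsto_vec hR A)).const_mul (e : ℂ)
      refine tendsto_nhds_unique h2 (h3.congr fun s => ?_)
      have := hΩ.eigen (A.1 (trunc Ω s))
      rw [hHe] at this
      exact this.symm
    rw [← hHs, mul_one] at h1
    have h2 := congrArg (starRingEnd ℂ) h1
    rw [map_mul, inner_conj_symm, inner_conj_symm, Complex.conj_ofReal] at h2
    rw [← h2, hH, map_add, inner_add_right, map_sum, inner_sum]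
    congr 1
    refine Finset.sum_congr rfl fun j _ => ?_
    rw [map_smul, inner_smul_right]

theorem sum_abs_le_fBar (k : ℕ) (f : (r : ℕ) → (Fin (2 * r) → Λ) → ℝ) (i : Λ) :
    ∑ r ∈ Finset.Icc 1 (k / 2), ∑ t : Fin (2 * r) → Λ with ∃ j, t j = i, |f r t| ≤ fBar k f := by
  unfold fBar
  set g : Λ → ℝ := fun i => ∑ r ∈ Finset.Icc 1 (k / 2),
    ∑ t : Fin (2 * r) → Λ with ∃ j, t j = i, |f r t| with hg
  exact le_ciSup (Set.finite_range g).bddAbove i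

/-- Tuples avoiding the site `i` commute with its derivative, so the remaining coefficients are
exactly those summed in `fBar` for that site; each contributes a factor `2 r ≤ 2 h`. -/
theorem poly_adE_tamePoly {E : Type*} [NormedAddCommGroup E] [InnerProductSpace ℂ E]
    {V : tame Λ →ₗ[ℂ] E} (G : GapRep V tamePhi tameDer (tamePoly k f) μ e Δ) {h : ℕ}
    (hk : k = 2 * h) (i : Λ) :
    Poly tamePhi (2 * h - 1) (2 * h * fBar k f) (adE (tameDer i) (tamePoly k f)) := by
  have h1 : adE (tameDer i) (tamePoly k f) = ∑ r ∈ Finset.Icc 1 (k / 2),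
      ∑ t : Fin (2 * r) → Λ with ∃ j, t j = i,
        ((f r t : ℝ) : ℂ) • adE (tameDer i) (fieldProd tamePhi (List.ofFn t)) := by
    conv_lhs => rw [tamePoly_eq]
    rw [map_sum]
    refine Finset.sum_congr rfl fun r _ => ?_
    rw [map_sum, Finset.sum_filter]
    refine Finset.sum_congr rfl fun t _ => ?_
    rw [map_smul]
    split_ifs with ht
    · rfl
    · rw [G.adE_fieldProd, List.count_eq_zero_of_not_mem, Nat.cast_zero, Complex.ofReal_zero, zero_smul,
        smul_zero]
      rwa [List.mem_ofFn]
  rw [h1]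
  refine (Poly.sum (C := fun r => ∑ t : Fin (2 * r) → Λ with ∃ j, t j = i, 2 * h * |f r t|) _
    fun r hr => Poly.sum (C := fun t => 2 * h * |f r t|) _ fun t ht => ?_).le ?_
  · have h2 := ((Poly.adE G i (Poly.mono (q := tamePhi) (List.ofFn t))).1.smul (f r t))
    rw [List.length_ofFn] at h2
    obtain ⟨hr1, hr2⟩ := Finset.mem_Icc.1 hr
    have h3 : 2 * h - 1 = 2 * r - 1 + 2 * (h - r) := by omega
    rw [h3]
    refine h2.weaken _ ?_
    have : (r : ℝ) ≤ h := by
      have : r ≤ h := by omega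
      exact_mod_cast this
    push_cast
    rw [mul_one, mul_comm]
    gcongr
  · simp only [← Finset.mul_sum]
    gcongr
    exact sum_abs_le_fBar k f i

/-- With `s² Δ = μ̄`, the bound on `fb` reads `f̄ ≤ f̄'`. The lower bound on `P` holds since `f̄' ≥
μ̄/2` and `(7/10)² ≤ 1/2`. The total weight `h p` is that of `p` derivatives. -/
theorem momentScale (hΩ : GappedState (hamEnd k μ f) Ω e Δ σ) (hΔ : 0 < Δ) (i : Λ) {h p : ℕ}
    (hh : 1 ≤ h) (hp : 1 ≤ p) :
    MomentScale μ Δ (fBar k f) (Real.sqrt (max (fBar k f) (muBar μ / 2) / muBar μ))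
      (Real.sqrt (muBar μ / Δ))
      (8 * (h * p : ℕ) * (4 * Real.sqrt (muBar μ / Δ) + 1)) h (h * p) := by
  have hμ : ∀ j, μ j ≤ muBar μ := le_ciSup (Set.finite_range μ).bddAbove
  have hμ0 : 0 < muBar μ := (mu_pos hΩ hΔ i).trans_le (hμ i)
  have h1 : Real.sqrt (muBar μ / Δ) ^ 2 * Δ = muBar μ := by
    rw [Real.sq_sqrt (by positivity)]
    field_simp
  refine ⟨?_, Real.sqrt_nonneg _, rfl, hh, Nat.mul_pos hh hp, hΔ, fun j => (hμ j).trans_eq h1.symm, ?_⟩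
  · apply Real.le_sqrt_of_sq_le
    rw [le_div_iff₀ hμ0]
    refine le_trans ?_ (le_max_right _ _)
    linarith
  · rw [h1, Real.sq_sqrt (by have := le_max_right (fBar k f) (muBar μ / 2); positivity),
      div_mul_cancel₀ _ hμ0.ne']
    exact le_max_left _ _

/-- The annihilation operator as an element of the algebra of tame operators. -/
def tameAnn (i : Λ) : tame Λ := ⟨ann i, ann_mem_tame i⟩

/-- The constant is `(5/2)² / 2 = 25/8`, and `8 h p = 4 k p` inside `κ`. -/
theorem norm_vec_ann_pow_le (hΩ : GappedState (hamEnd k μ f) Ω e Δ σ) (hΔ : 0 < Δ) (hR : Rapid Ω)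
    (i : Λ) {h p : ℕ} (hk : k = 2 * h) (hh : 1 ≤ h) (hp : 1 ≤ p) :
    ‖vec Ω hR (tameAnn i ^ p)‖ ^ 2 ≤ (25 / 8 *
      (max (fBar k f) (muBar μ / 2) / muBar μ *
        (4 * k * p * (4 * Real.sqrt (muBar μ / Δ) + 1)) ^ k)) ^ p := by
  have G := gapRep_vec hΩ hR
  have S := momentScale hΩ hΔ i hh hp
  have h1 := norm_fieldProd_mul_pow_mul_pow_le G S i (poly_adE_tamePoly G hk i) p 0 0 (by simp)
  rw [pow_zero, pow_zero, one_mul, one_mul, zero_add, zero_add] at h1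
  have h2 : tameAnn i = ((Real.sqrt 2 : ℝ) : ℂ)⁻¹ • (tamePhi i + tameDer i) :=
    Subtype.ext (ann_eq i)
  have h3 : ‖vec Ω hR (tameAnn i ^ p)‖ =
      (Real.sqrt 2)⁻¹ ^ p * ‖vec Ω hR ((tamePhi i + tameDer i) ^ p)‖ := by
    rw [h2, smul_pow, map_smul, norm_smul, norm_pow, norm_inv, Complex.norm_real,
      Real.norm_of_nonneg (Real.sqrt_nonneg 2)]
  have hϱ : 0 ≤ max (fBar k f) (muBar μ / 2) / muBar μ := by
    by_contra hneg
    have := S.P_pos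
    rw [Real.sqrt_eq_zero_of_nonpos (le_of_not_ge hneg)] at this
    exact this.false
  rw [h3]
  calc _ ≤ ((Real.sqrt 2)⁻¹ ^ p * ((5 / 2) ^ p *
        (Real.sqrt (max (fBar k f) (muBar μ / 2) / muBar μ) ^ p *
          (8 * (h * p : ℕ) * (4 * Real.sqrt (muBar μ / Δ) + 1)) ^ (h * p)))) ^ 2 := by
        gcongr
    _ = (((Real.sqrt 2) ^ 2)⁻¹ * (25 / 4) *
        (Real.sqrt (max (fBar k f) (muBar μ / 2) / muBar μ) ^ 2 *
          (8 * (h * p : ℕ) * (4 * Real.sqrt (muBar μ / Δ) + 1)) ^ k)) ^ p := by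
        rw [show (25 / 4 : ℝ) = (5 / 2) ^ 2 by norm_num, hk]
        generalize (5 / 2 : ℝ) = c
        ring
    _ = _ := by
        rw [Real.sq_sqrt hϱ, Real.sq_sqrt (by norm_num), hk]
        push_cast
        ring

end instantiate

/-! ### From factorial moments to the tail. -/

section tail
variable [DecidableEq Λ]

theorem cre_pow_mul_ann_pow (i : Λ) (p : ℕ) :
    cre i ^ p * ann i ^ p = diag fun N => ((N i).descFactorial p : ℂ) := by
  induction p with
  | zero => exact ext_single fun N => by simp [diag_single]
  | succ p ih =>
    have h1 : cre i ^ (p + 1) * ann i ^ (p + 1) = cre i * (cre i ^ p * ann i ^ p) * ann i := by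
      rw [pow_succ', pow_succ]
      simp only [mul_assoc]
    rw [h1, ih]
    refine ext_single fun N => ?_
    rw [Module.End.mul_apply, Module.End.mul_apply, ann_single, diag_single, cre_single,
      diag_single, Function.update_self, Function.update_idem]
    rcases Nat.eq_zero_or_pos (N i) with h | h
    · simp [h]
    · obtain ⟨n, hn⟩ := Nat.exists_eq_succ_of_ne_zero h.ne'
      have h2 : n + 1 - 1 + 1 = N i := by omega
      rw [hn, Nat.succ_eq_add_one, Nat.succ_descFactorial_succ, h2, Function.update_eq_self,
        Nat.add_sub_cancel]
      congr 1
      have h3 : ((Real.sqrt ((n + 1 : ℕ) : ℝ) : ℝ) : ℂ) * ((Real.sqrt (n + 1 : ℝ) : ℝ) : ℂ) =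
          ((n + 1 : ℕ) : ℂ) := by
        rw [← Complex.ofReal_mul, Nat.cast_add_one, Real.mul_self_sqrt (by positivity)]
        push_cast
        rfl
      push_cast at h3 ⊢
      linear_combination (n.descFactorial p : ℂ) * h3

theorem inner_cre_pow_left (i : Λ) (p : ℕ) (u v : FinVec Λ) :
    inner ℂ (toFock ((cre i ^ p) u)) (toFock v) = inner ℂ (toFock u) (toFock ((ann i ^ p) v)) := by
  induction p generalizing u with
  | zero => rfl
  | succ p ih =>
    rw [pow_succ, pow_succ', Module.End.mul_apply, Module.End.mul_apply, ih, inner_cre_left]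

theorem norm_ann_pow_trunc_sq (i : Λ) (p : ℕ) (ψ : Fock Λ) (s : Finset (Config Λ)) :
    ‖toFock ((ann i ^ p) (trunc ψ s))‖ ^ 2 = ∑ N ∈ s, ((N i).descFactorial p : ℝ) * ‖ψ N‖ ^ 2 := by
  have h1 := inner_self_eq_norm_sq_to_K (𝕜 := ℂ) (toFock ((ann i ^ p) (trunc ψ s)))
  rw [← inner_cre_pow_left, ← Module.End.mul_apply, cre_pow_mul_ann_pow, inner_toFock_left,
    Finsupp.sum_of_support_subset _ (s := s)] at h1
  · have h2 : ∀ N ∈ s, (starRingEnd ℂ) (diag (fun N => ((N i).descFactorial p : ℂ)) (trunc ψ s) N) *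
        toFock (trunc ψ s) N = ((((N i).descFactorial p : ℝ) * ‖ψ N‖ ^ 2 : ℝ) : ℂ) := by
      intro N hN
      rw [diag_apply, toFock_apply, trunc_apply_of_mem ψ hN, map_mul, Complex.conj_natCast,
        mul_assoc, Complex.conj_mul']
      push_cast
      rfl
    rw [Finset.sum_congr rfl h2, ← Complex.ofReal_sum] at h1
    refine (Complex.ofReal_injective ?_).symm
    rw [h1]
    norm_cast
  · intro N hN
    apply support_trunc_subset ψ s
    rw [Finsupp.mem_support_iff, diag_apply] at hN
    exact Finsupp.mem_support_iff.2 fun h => hN (by rw [h, mul_zero])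
  · simp

omit [DecidableEq Λ] in
theorem re_inner_trunc_numberTail (i : Λ) (x : ℝ) (ψ : Fock Λ) (s : Finset (Config Λ)) :
    (inner ℂ (toFock (trunc ψ s)) (numberTail i x ψ)).re =
      ∑ N ∈ s, if x < (N i : ℝ) then ‖ψ N‖ ^ 2 else 0 := by
  rw [inner_toFock_left, Finsupp.sum_of_support_subset _ (support_trunc_subset ψ s) _ (by simp),
    Complex.re_sum]
  refine Finset.sum_congr rfl fun N hN => ?_
  rw [trunc_apply_of_mem ψ hN]
  change ((starRingEnd ℂ) (ψ N) * if x < (N i : ℝ) then ψ N else 0).re = _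
  split_ifs
  · rw [Complex.conj_mul']
    norm_cast
  · simp

/-- Markov's inequality for the factorial moment `‖b^p ψ‖²`: if `N > x` and `p ≤ x/2`, each factor
of `N (N-1) ⋯ (N-p+1)` is at least `x/2`. -/
theorem mul_numberTail_le [Fintype Λ] {ψ : Fock Λ} (hR : Rapid ψ) (i : Λ) {x : ℝ} {p : ℕ}
    (hx : 0 ≤ x) (hp : (p : ℝ) ≤ x / 2) (A : tame Λ) (hA : A.1 = ann i ^ p) :
    (x / 2) ^ p * (inner ℂ ψ (numberTail i x ψ)).re ≤ ‖vec ψ hR A‖ ^ 2 := by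
  have h1 := tendsto_vec hR 1
  rw [vec_one] at h1
  have h2 := ((Complex.continuous_re.tendsto _).comp
    (h1.inner (𝕜 := ℂ) (tendsto_const_nhds (x := numberTail i x ψ)))).const_mul ((x / 2) ^ p)
  refine le_of_tendsto_of_tendsto' h2 ((tendsto_vec hR A).norm.pow 2) fun s => ?_
  rw [hA, norm_ann_pow_trunc_sq]
  change (x / 2) ^ p * (inner ℂ (toFock (trunc ψ s)) (numberTail i x ψ)).re ≤ _
  rw [re_inner_trunc_numberTail, Finset.mul_sum]
  refine Finset.sum_le_sum fun N _ => ?_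
  split_ifs with hN
  · refine mul_le_mul_of_nonneg_right ?_ (sq_nonneg _)
    have h3 : p ≤ N i + 1 := by
      have : (p : ℝ) ≤ (N i + 1 : ℕ) := by push_cast; linarith
      exact_mod_cast this
    calc (x / 2) ^ p ≤ ((N i + 1 - p : ℕ) : ℝ) ^ p := by
          gcongr
          rw [Nat.cast_sub h3]
          push_cast
          linarith
      _ ≤ _ := by exact_mod_cast Nat.pow_sub_le_descFactorial _ _
  · rw [mul_zero]
    positivity

end tail

/-- The Markov bound of order `p` at the optimal `p`. -/
theorem tail_le_of_moments {k : ℕ} (hk : 2 ≤ k) {ϱ a x T : ℝ} (hϱ : 1 / 2 ≤ ϱ) (ha : 1 ≤ a) (hx : 0 ≤ x)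
    (hT : T ≤ 1)
    (h : ∀ p : ℕ, 1 ≤ p → (p : ℝ) ≤ x / 2 →
      (x / 2) ^ p * T ≤ (25 / 8 * (ϱ * (4 * k * p * a) ^ k)) ^ p) :
    T ≤ 4 * Real.exp k * Real.exp (-((k : ℝ) * x ^ (1 / (k : ℝ)) /
      (8 * Real.exp 1 * ((k : ℝ) ^ 2 * ϱ ^ (1 / (k : ℝ)) * a)))) := by
  have hk' : (2 : ℝ) ≤ k := by exact_mod_cast hk
  have hk0 : k ≠ 0 := by omega
  set C := (k : ℝ) ^ 2 * ϱ ^ (1 / (k : ℝ)) * a with hC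
  set y := x ^ (1 / (k : ℝ)) with hy
  set z := ϱ ^ (1 / (k : ℝ)) with hz
  have hy0 : 0 ≤ y := by positivity
  have hyk : y ^ k = x := by
    rw [hy, one_div, Real.rpow_inv_natCast_pow hx hk0]
  have hzk : z ^ k = ϱ := by
    rw [hz, one_div, Real.rpow_inv_natCast_pow (by linarith) hk0]
  have hz2 : 1 / 2 ≤ z := by
    by_contra! hlt
    have h0 : 0 ≤ z := by positivity
    have : z ^ k ≤ z ^ 1 := pow_le_pow_of_le_one h0 (by linarith) (by omega)
    rw [hzk, pow_one] at this
    linarith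
  have hC2 : 2 ≤ C := by
    have h1 : (4 : ℝ) ≤ (k : ℝ) ^ 2 := by nlinarith
    have h2 : (4 : ℝ) * (1 / 2) * 1 ≤ C := by rw [hC]; gcongr
    linarith
  have he : 2 ≤ Real.exp 1 := by have := Real.add_one_le_exp (1 : ℝ); linarith
  -- Chosen so that for `p ≤ Y` each of the `p` factors in the moment bound is at most `x/2 · exp
  -- (-k)`.
  set Y := y / (5 * Real.exp 1 * C) with hY
  have hden : 0 < 5 * Real.exp 1 * C := by positivity
  have hY0 : 0 ≤ Y := by positivity
  set p := ⌊Y⌋₊ with hp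
  have hpY : (p : ℝ) ≤ Y := Nat.floor_le hY0
  have hpY' : Y < p + 1 := Nat.lt_floor_add_one Y
  have hmain : T ≤ Real.exp (-(k * p)) := by
    rcases Nat.eq_zero_or_pos p with h0 | h0
    · rw [h0]; simpa using hT
    have hp1 : (1 : ℝ) ≤ p := by exact_mod_cast h0
    have hpy : 5 * Real.exp 1 * C * p ≤ y := by
      rw [hY, le_div_iff₀ hden] at hpY
      linarith
    have h20 : 20 ≤ 5 * Real.exp 1 * C := by nlinarith
    have hy20 : 20 * (p : ℝ) ≤ y := le_trans (by gcongr) hpy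
    have hy1 : 1 ≤ y := by linarith
    have hyx : y ≤ x := by rw [← hyk]; exact le_self_pow₀ hy1 hk0
    have hx0 : 0 < x := by linarith
    have h1 := h p h0 (by linarith)
    have h2 : 25 / 8 * (ϱ * (4 * k * p * a) ^ k) ≤ x / 2 * Real.exp (-k) := by
      have h3 : ϱ * (4 * k * p * a) ^ k = (4 * p * C / k) ^ k := by
        rw [← hzk, ← mul_pow]
        congr 1
        rw [hC]
        field_simp
      -- Moves the numerical constant inside the `k`-th power at the cost of `5/2` per factor; `k ≥
      -- 2` is used here and again to replace `10 / k` by `5`.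
      have h4 : (25 / 4 : ℝ) ≤ (5 / 2) ^ k := by
        calc (25 / 4 : ℝ) = (5 / 2) ^ 2 := by norm_num
          _ ≤ _ := pow_le_pow_right₀ (by norm_num) hk
      have h5 : Real.exp (-k) = (Real.exp (-1)) ^ k := by
        rw [← Real.exp_nat_mul]; congr 1; ring
      have h6 : 5 / 2 * (4 * p * C / k) ≤ y * Real.exp (-1) := by
        have h7 : 5 / 2 * (4 * p * C / k) ≤ 5 * p * C := by
          rw [mul_div_assoc', div_le_iff₀ (by linarith)]
          have : 0 ≤ 5 * p * C := by positivity
          nlinarith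
        refine h7.trans ?_
        rw [Real.exp_neg, ← div_eq_mul_inv, le_div_iff₀ (Real.exp_pos 1)]
        linarith
      have h0' : 0 ≤ (4 * p * C / k) ^ k := by positivity
      rw [h3, h5]
      calc 25 / 8 * (4 * p * C / k) ^ k = 1 / 2 * (25 / 4 * (4 * p * C / k) ^ k) := by ring
        _ ≤ 1 / 2 * ((5 / 2) ^ k * (4 * p * C / k) ^ k) := by gcongr
        _ = 1 / 2 * (5 / 2 * (4 * p * C / k)) ^ k := by rw [mul_pow]
        _ ≤ 1 / 2 * (y * Real.exp (-1)) ^ k := by gcongr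
        _ = _ := by rw [mul_pow, hyk]; ring
    have h3 : (x / 2) ^ p * T ≤ (x / 2) ^ p * Real.exp (-(k * p)) := by
      have h4 : Real.exp (-(k * p)) = Real.exp (-k) ^ p := by
        rw [← Real.exp_nat_mul]; congr 1; ring
      rw [h4, ← mul_pow]
      refine h1.trans ?_
      gcongr
    exact le_of_mul_le_mul_left h3 (by positivity)
  refine hmain.trans ?_
  have h1 : (k : ℝ) * y / (8 * Real.exp 1 * C) ≤ k * Y := by
    rw [hY, ← mul_div_assoc]
    gcongr
    norm_num
  rw [mul_assoc, ← Real.exp_add]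
  -- Rounding `Y` down to `p` costs the factor `exp k`. The prefactor `4` and the step from `5` to
  -- `8` are slack.
  have h2 : Real.exp (-(k * p)) ≤ Real.exp (k + -(k * y / (8 * Real.exp 1 * C))) := by
    apply Real.exp_le_exp.2
    nlinarith
  have := Real.exp_pos (k + -(k * y / (8 * Real.exp 1 * C)))
  linarith

end Phi4

end

theorem mainTheorem3 {Λ : Type*} [Fintype Λ] [DecidableEq Λ]
    (k : ℕ) (hk : Even k) (hk2 : 2 ≤ k)
    (μ : Λ → ℝ) (f : (r : ℕ) → (Fin (2 * r) → Λ) → ℝ)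
    (Ω : (Phi4.hamiltonian k μ f).domain)
    (hΩ : Phi4.IsGroundState (Phi4.hamiltonian k μ f) Ω)
    (Δ : ℝ) (hΔ : 0 < Δ) (hgap : Phi4.IsSpectralGap (Phi4.hamiltonian k μ f) Ω Δ)
    (i : Λ) (x : ℝ) (hx : 0 ≤ x) :
    (inner ℂ (Ω : Phi4.Fock Λ) (Phi4.numberTail i x (Ω : Phi4.Fock Λ))).re ≤
      4 * Real.exp k *
        Real.exp (-((k : ℝ) * x ^ (1 / (k : ℝ)) /
          (8 * Real.exp 1 * Phi4.Ctilde k μ f Δ))) := by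
  have hk0 : 1 ≤ k / 2 := by omega
  have hk' : k = 2 * (k / 2) := by obtain ⟨n, hn⟩ := hk; omega
  obtain ⟨e, σ, hG⟩ := Phi4.exists_gappedState k μ f Ω hΩ Δ hΔ hgap
  have hR := Phi4.rapid_ground hG hΔ
  have hμ0 : 0 < Phi4.muBar μ :=
    (Phi4.mu_pos hG hΔ i).trans_le (le_ciSup (Set.finite_range μ).bddAbove i)
  refine Phi4.tail_le_of_moments hk2 ?_ ?_ hx ?_ fun p hp hpx => ?_
  · rw [le_div_iff₀ hμ0]
    refine le_trans ?_ (le_max_right _ _)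
    linarith
  · have := Real.sqrt_nonneg (Phi4.muBar μ / Δ)
    linarith
  -- The trivial bound by one is the Markov bound of order zero.
  · have := Phi4.mul_numberTail_le hR i (x := x) (p := 0) hx (by simpa using by linarith) 1 rfl
    rwa [pow_zero, one_mul, Phi4.vec_one, hG.norm_eq, one_pow] at this
  · exact (Phi4.mul_numberTail_le hR i hx hpx (Phi4.tameAnn i ^ p) rfl).trans
      (Phi4.norm_vec_ann_pow_le hG hΔ hR i hk' hk0 hp)
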